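/- Let $d\ge 1$ be an integer and let $p',q'\ge 1$ be real numbers with $$1+\frac d2\le q'<\infty\qquad\text{and}\qquad \frac{2}{p'}+\frac{d}{q'}=2 .$$ Then there is a constant $C_{d,q}<\infty$, depending only on $d$ and $q'$, such that the following holds. For every measurable $V:\mathbb R\times\mathbb R^d\to\mathbb C$ with $$\|V\|_{L^{p'}_t(\mathbb R,L^{q'}_x(\mathbb R^d))}=\Big(\int_{\mathbb R}\Big(\int_{\mathbb R^d}|V(t,x)|^{q'}dx\Big)^{p'/q'}dt\Big)^{1/p'}<\infty$$ there is a bounded operator $A_V=\int_{\mathbb R}e^{-it\Delta}V(t,x)e^{it\Delta}\,dt$ on $L^2(\mathbb R^d)$, in the weak sense that $$\langle g,A_Vf\rangle=\int_{\mathbb R}\int_{\mathbb R^d}\overline{(e^{it\Delta}g)(x)}\,V(t,x)\,(e^{it\Delta}f)(x)\,dx\,dt\qquad\text{for all } f,g\in L^2(\mathbb R^d),$$ with an absolutely convergent integral, and $$\Big\|\int_{\mathbb R}e^{-it\Delta}V(t,x)e^{it\Delta}\,dt\Big\|_{\mathfrak S^{2q'}}\le C_{d,q}\,\|V\|_{L^{p'}_t(\mathbb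 R,L^{q'}_x(\mathbb R^d))},$$ where $\|A\|_{\mathfrak S^{r}}=(\mathrm{Tr}\,|A|^r)^{1/r}$ is the Schatten norm. Moreover, the same constant is valid in the Strichartz inequality for orthonormal functions: if $1/p+1/p'=1$ and $1/q+1/q'=1$, then for every finite or countable orthonormal system $(u_j)$ in $L^2(\mathbb R^d)$ and all complex numbers $(n_j)$ with $\sum_j|n_j|^{2q/(q+1)}<\infty$, the series $\sum_j n_j|(e^{it\Delta}u_j)(x)|^2$ converges absolutely for almost every $t$ and $x$, and $$\Big\|\sum_j n_j\,|e^{it\Delta}u_j|^2\Big\|_{L^p_t(\mathbb R,L^q_x(\mathbb R^d))}\le C_{d,q}\Big(\sum_j|n_j|^{\frac{2q}{q+1}}\Big)^{\frac{q+1}{2q}} .$$ -/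

import Mathlib

open MeasureTheory
open scoped ENNReal NNReal FourierTransform ComplexConjugate InnerProductSpace

/-- Physical space `ℝ^d` with its Euclidean norm. -/
abbrev RSpace (d : ℕ) : Type := EuclideanSpace ℝ (Fin d)

/-- The complex Hilbert space `L²(ℝ^d)`. -/
abbrev L2Space (d : ℕ) : Type := Lp ℂ 2 (volume : Measure (RSpace d))

/-- The symbol of `e^{itΔ}`. For the Fourier transform `∫ e^{-2πi⟨x,ξ⟩} f(x) dx` the operator `-Δ`
is multiplication by `4π²|ξ|²`, so that `e^{itΔ}` is multiplication by `e^{-it4π²|ξ|²}`. -/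
noncomputable def schrodingerSymbol (d : ℕ) (t : ℝ) (ξ : RSpace d) : ℂ :=
  Complex.exp (((-(t * (4 * Real.pi ^ 2 * ‖ξ‖ ^ 2)) : ℝ) : ℂ) * Complex.I)

theorem schrodingerSymbol_memLp (d : ℕ) (t : ℝ) :
    MemLp (schrodingerSymbol d t) ∞ (volume : Measure (RSpace d)) := by
  refine memLp_top_of_bound (Continuous.aestronglyMeasurable ?_) 1 (.of_forall fun ξ => ?_)
  · unfold schrodingerSymbol; fun_prop
  · exact (Complex.norm_exp_ofReal_mul_I _).le

/-- The free Schrödinger propagator `e^{itΔ}` on `L²(ℝ^d)`, i.e. the Fourier multiplier with symbol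
`e^{-it4π²|ξ|²}`. -/
noncomputable def freeProp {d : ℕ} (t : ℝ) (f : L2Space d) : L2Space d :=
  𝓕⁻ (((schrodingerSymbol_memLp d t).toLp (schrodingerSymbol d t) • 𝓕 f : L2Space d))

/-- The mixed norm `‖V‖_{L^p_t(ℝ, L^q_x(ℝ^d))}` for finite exponents `p, q`,
with values in `[0, ∞]`. -/
noncomputable def mixedNorm {d : ℕ} (p q : ℝ) (V : ℝ → RSpace d → ℂ) : ℝ≥0∞ :=
  (∫⁻ t : ℝ, (∫⁻ x : RSpace d, ‖V t x‖ₑ ^ q) ^ (p / q)) ^ (1 / p)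

/-- The trace of a positive operator `T`, as an element of `[0, ∞]`: the sum of `⟨e, T e⟩` over
the vectors `e` of an orthonormal basis (it does not depend on the basis). -/
noncomputable def positiveTrace {H : Type*} [NormedAddCommGroup H] [InnerProductSpace ℂ H]
    [CompleteSpace H] (T : H →L[ℂ] H) : ℝ≥0∞ :=
  ∑' e : (exists_hilbertBasis ℂ H).choose, ENNReal.ofReal (RCLike.re ⟪(e : H), T (e : H)⟫_ℂ)

/-- The Schatten norm `‖A‖_{𝔖^r} = (Tr |A|^r)^{1/r}`, `|A| = (A*A)^{1/2}`, of a bounded operator,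
for a finite exponent `r`; it is finite exactly when `A` belongs to the Schatten space `𝔖^r`. -/
noncomputable def schattenNorm {H : Type*} [NormedAddCommGroup H] [InnerProductSpace ℂ H]
    [CompleteSpace H] (r : ℝ) (A : H →L[ℂ] H) : ℝ≥0∞ :=
  positiveTrace (CFC.abs A ^ r) ^ (1 / r)

/-- `A` is the operator `∫_ℝ e^{-itΔ} V(t,x) e^{itΔ} dt`, in the weak sense: for all
`f, g ∈ L²(ℝ^d)` one has `⟨g, A f⟩ = ∫_ℝ ⟨e^{itΔ} g, V(t,·) e^{itΔ} f⟩ dt`, where the integral over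
`t` and `x` converges absolutely. This determines the bounded operator `A`. -/
def IsConjugatedTimeIntegral {d : ℕ} (V : ℝ → RSpace d → ℂ) (A : L2Space d →L[ℂ] L2Space d) :
    Prop :=
  ∀ f g : L2Space d,
    (∀ᵐ t : ℝ, Integrable fun x : RSpace d =>
      conj (freeProp t g x) * (V t x * freeProp t f x)) ∧
    (Integrable fun t : ℝ => ∫ x : RSpace d,
      ‖conj (freeProp t g x) * (V t x * freeProp t f x)‖) ∧
    ⟪g, A f⟫_ℂ = ∫ t : ℝ, ∫ x : RSpace d,
      conj (freeProp t g x) * (V t x * freeProp t f x)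

/-- The Strichartz inequality for orthonormal functions with exponents `p, q` and constant `C`:
for every finite or countable orthonormal system `(u_j)` in `L²(ℝ^d)` and complex `(n_j)` with
`∑ |n_j|^{2q/(q+1)} < ∞`, the series `ρ(t,x) = ∑ n_j |(e^{itΔ} u_j)(x)|²` converges (absolutely)
almost everywhere and `‖ρ‖_{L^p_t L^q_x} ≤ C (∑ |n_j|^{2q/(q+1)})^{(q+1)/(2q)}`. -/
def OrthonormalStrichartz (d : ℕ) (p q : ℝ) (C : ℝ≥0) : Prop :=
  ∀ (ι : Type) [Countable ι] (u : ι → L2Space d) (n : ι → ℂ), Orthonormal ℂ u →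
    ∑' j, ‖n j‖ₑ ^ (2 * q / (q + 1)) < ∞ →
    (∀ᵐ t : ℝ, ∀ᵐ x : RSpace d, Summable fun j => n j * (‖freeProp t (u j) x‖ : ℂ) ^ 2) ∧
    mixedNorm p q (fun t x => ∑' j, n j * (‖freeProp t (u j) x‖ : ℂ) ^ 2) ≤
      C * (∑' j, ‖n j‖ₑ ^ (2 * q / (q + 1))) ^ ((q + 1) / (2 * q))

/-! ### The Fourier transform on `L¹ ∩ L²` -/

section FourierLOneLTwo

variable {V : Type*} [NormedAddCommGroup V] [InnerProductSpace ℝ V] [FiniteDimensional ℝ V]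
  [MeasurableSpace V] [BorelSpace V]

/-! Everything rests on one diagonal estimate. Put κ = 1 + d/2 and let V ≥ 0. For finite orthonormal
systems, Σ (∫∫ V |e^{itΔ}u_i|²)^{2κ} ≤ C (∫∫ V^κ)². With B f = √V e^{itΔ} f, the operator BB* has
kernel √V(t) e^{i(t-s)Δ} √V(s), and its quadratic form is twice the real part of that of its
retarded half t > s. The retarded half is the value at z = 1/κ of an analytic family with weights
V^{κz/2} and time factor (ζ+1)(t-s)_+^ζ, where ζ = -1 + κz.

On Re z = 0 the time factor is a bounded Fourier multiplier, since its transform is Γ(ζ+2) times a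
power (`norm_fourier_powKernel_le`); this gives an operator bound (`norm_steinForm_left_le`). On Re
z = 1 it grows like (t-s)^{d/2}, which cancels the dispersive decay (`norm_gaussKernel_le`), so the
kernel is Hilbert–Schmidt with norm controlled by ∫∫ V^κ (`norm_sum_steinForm_right_le`).
Interpolation by the three lines theorem gives the Schatten bound of order 2κ for the retarded half,
tested on orthonormal systems (`norm_sum_retardedForm_le`). Testing on the normalised images B ψ_i,
with weights chosen by ℓ^p duality, proves the diagonal estimate when these images are orthogonal.
Diagonalising the Gram matrix removes orthogonality (`sum_norm_map_pow_le_of_orthogonal`).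

The computation is regularised by a heat factor e^{ηΔ}, by the time damping e^{-δt} with a shift of
ζ by δ, and by cutting V off to a bounded set where it is bounded above and below. All constants are
uniform in these parameters, which are then removed by limits and Fatou's lemma.

At the other end p' = 1, q' = ∞, unitarity of e^{itΔ} is enough. Hölder's inequality with a weight
depending only on t joins the two ends (`sum_lintegral_evol_rpow_le_mixed`). The orthonormal
Strichartz inequality follows by duality in mixed Lebesgue norms (`lintegral_mixed_le_of_dual`). For
the operator, Cauchy–Schwarz with |V| = |V|^{1/2}|V|^{1/2} bounds Σ |⟨f_i, A g_i⟩|^{2q'} over pairs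
of orthonormal systems, and such a bound controls the Schatten norm (`sum_norm_map_rpow_le`,
`schattenNorm_le_of_sum_norm_map_rpow_le`). -/

/-- On `L¹ ∩ L²` the Fourier transform of `L²` is given by the Fourier integral. -/
theorem fourier_toLp_ae_eq {h : V → ℂ} (h1 : Integrable h) (h2 : MemLp h 2) :
    ((𝓕 (h2.toLp h) : Lp ℂ 2 (volume : Measure V)) : V → ℂ) =ᵐ[volume] 𝓕 h := by
  -- Both functions are tested against Schwartz functions: the `L²` transform through tempered
  -- distributions, the Fourier integral through its self-duality.
  have key : ∀ g : SchwartzMap V ℂ,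
      ∫ x, g x * (𝓕 (h2.toLp h) : Lp ℂ 2 (volume : Measure V)) x = ∫ x, g x * 𝓕 h x := by
    intro g
    have e := congrArg (fun T => T g) (Lp.fourier_toTemperedDistribution_eq (h2.toLp h))
    simp only [TemperedDistribution.fourier_apply, Lp.toTemperedDistribution_apply,
      smul_eq_mul] at e
    rw [← e]
    have e2 := VectorFourier.integral_bilin_fourierIntegral_eq_flip (μ := (volume : Measure V))
      (ν := (volume : Measure V)) (L := innerₗ V) (ContinuousLinearMap.mul ℂ ℂ)
      Real.continuous_fourierChar continuous_inner g.integrable h1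
    simp only [ContinuousLinearMap.mul_apply', flip_innerₗ] at e2
    change ∫ x, 𝓕 (g : V → ℂ) x * h x = ∫ x, g x * 𝓕 h x at e2
    rw [← e2]
    refine integral_congr_ae ?_
    filter_upwards [h2.coeFn_toLp] with x hx
    rw [hx]
    rfl
  have hc : Continuous (𝓕 h) := VectorFourier.fourierIntegral_continuous
      Real.continuous_fourierChar continuous_inner h1
  refine ae_eq_of_integral_contDiff_smul_eq ?_ hc.locallyIntegrable ?_
  · exact (Lp.memLp _).locallyIntegrable (by norm_num)
  · intro g hg hg'
    have hg2 : HasCompactSupport (fun x => (g x : ℂ)) := hg'.comp_left (g := fun x : ℝ => (x : ℂ)) (by simp)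
    have := key (hg2.toSchwartzMap (Complex.ofRealCLM.contDiff.comp hg))
    simp only [Complex.real_smul]
    exact this

theorem memLp_fourier {h : V → ℂ} (h1 : Integrable h) (h2 : MemLp h 2) : MemLp (𝓕 h) 2 :=
  (memLp_congr_ae (fourier_toLp_ae_eq h1 h2)).1 (Lp.memLp _)

theorem integral_conj_fourier_mul_fourier {a b : V → ℂ} (ha : Integrable a) (ha' : MemLp a 2)
    (hb : Integrable b) (hb' : MemLp b 2) :
    ∫ ξ, conj (𝓕 a ξ) * 𝓕 b ξ = ∫ x, conj (a x) * b x := by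
  have e := Lp.inner_fourier_eq (ha'.toLp a) (hb'.toLp b)
  rw [L2.inner_def, L2.inner_def] at e
  refine Eq.trans ?_ (e.trans ?_)
  · refine integral_congr_ae ?_
    filter_upwards [fourier_toLp_ae_eq ha ha', fourier_toLp_ae_eq hb hb'] with x h1 h2
    rw [h1, h2, RCLike.inner_apply, mul_comm]
  · refine integral_congr_ae ?_
    filter_upwards [ha'.coeFn_toLp, hb'.coeFn_toLp] with x h1 h2
    rw [h1, h2, RCLike.inner_apply, mul_comm]

theorem lintegral_enorm_fourier_sq {a : V → ℂ} (ha : Integrable a) (ha' : MemLp a 2) :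
    ∫⁻ ξ, ‖𝓕 a ξ‖ₑ ^ 2 = ∫⁻ x, ‖a x‖ₑ ^ 2 := by
  have e : eLpNorm (𝓕 a) 2 volume = eLpNorm a 2 volume := by
    rw [← eLpNorm_congr_ae (fourier_toLp_ae_eq ha ha'), ← eLpNorm_congr_ae ha'.coeFn_toLp,
      ← Lp.enorm_def, ← Lp.enorm_def, ← ofReal_norm, ← ofReal_norm, Lp.norm_fourier_eq]
  simp only [eLpNorm_eq_lintegral_rpow_enorm_toReal (p := 2) (by norm_num) (by norm_num)] at e
  simpa using ENNReal.rpow_left_injective (by norm_num) e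

/-- On `L¹ ∩ L²` the inverse Fourier transform of `L²` is given by the inverse Fourier integral. -/
theorem fourierInv_toLp_ae_eq {h : V → ℂ} (h1 : Integrable h) (h2 : MemLp h 2) :
    ((𝓕⁻ (h2.toLp h) : Lp ℂ 2 (volume : Measure V)) : V → ℂ) =ᵐ[volume] 𝓕⁻ h := by
  have key : ∀ g : SchwartzMap V ℂ,
      ∫ x, g x * (𝓕⁻ (h2.toLp h) : Lp ℂ 2 (volume : Measure V)) x = ∫ x, g x * 𝓕⁻ h x := by
    intro g
    have e := congrArg (fun T => T g) (Lp.fourierInv_toTemperedDistribution_eq (h2.toLp h))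
    simp only [TemperedDistribution.fourierInv_apply, Lp.toTemperedDistribution_apply,
      smul_eq_mul] at e
    rw [← e]
    have e2 := VectorFourier.integral_bilin_fourierIntegral_eq_flip (μ := (volume : Measure V))
      (ν := (volume : Measure V)) (L := -innerₗ V) (ContinuousLinearMap.mul ℂ ℂ)
      Real.continuous_fourierChar continuous_inner.neg g.integrable h1
    have e3 : (-innerₗ V).flip = -innerₗ V := by
      ext x y; simp [real_inner_comm]
    rw [e3] at e2
    simp only [ContinuousLinearMap.mul_apply'] at e2
    change ∫ x, 𝓕⁻ (g : V → ℂ) x * h x = ∫ x, g x * 𝓕⁻ h x at e2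
    rw [← e2]
    refine integral_congr_ae ?_
    filter_upwards [h2.coeFn_toLp] with x hx
    rw [hx, SchwartzMap.fourierInv_coe]
  have hc : Continuous (𝓕⁻ h) := VectorFourier.fourierIntegral_continuous
      Real.continuous_fourierChar continuous_inner.neg h1
  refine ae_eq_of_integral_contDiff_smul_eq ?_ hc.locallyIntegrable ?_
  · exact (Lp.memLp _).locallyIntegrable (by norm_num)
  · intro g hg hg'
    have hg2 : HasCompactSupport (fun x => (g x : ℂ)) := hg'.comp_left (g := fun x : ℝ => (x : ℂ)) (by simp)
    have := key (hg2.toSchwartzMap (Complex.ofRealCLM.contDiff.comp hg))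
    simp only [Complex.real_smul]
    exact this

end FourierLOneLTwo

/-! ### Quadratic forms of convolutions in time -/

theorem MeasureTheory.Integrable.memLp_two_of_bound {α : Type*} [MeasurableSpace α] {μ : Measure α}
    {f : α → ℂ} (hf : Integrable f μ) {c : ℝ} (hc : ∀ x, ‖f x‖ ≤ c) : MemLp f 2 μ := by
  rw [memLp_two_iff_integrable_sq_norm hf.aestronglyMeasurable]
  refine (hf.norm.const_mul c).mono' (hf.aestronglyMeasurable.norm.pow 2) (.of_forall fun x => ?_)
  rw [Real.norm_of_nonneg (by positivity), sq]
  exact mul_le_mul_of_nonneg_right (hc x) (norm_nonneg _)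

theorem norm_mul_le_half_sq_add_sq (z w : ℂ) : ‖z * w‖ ≤ (‖z‖ ^ 2 + ‖w‖ ^ 2) / 2 := by
  rw [norm_mul]; nlinarith [sq_nonneg (‖z‖ - ‖w‖)]

/-- The quadratic form of convolution by `k` is controlled by the supremum of `𝓕 k`. -/
theorem norm_integral_conj_mul_convolution_le {k α β : ℝ → ℂ} (hk : Integrable k)
    (hα : Integrable α) (hα' : MemLp α 2) (hβ : Integrable β) {c : ℝ} (hβc : ∀ s, ‖β s‖ ≤ c)
    {M : ℝ} (hM : ∀ ω, ‖𝓕 k ω‖ ≤ M) :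
    ‖∫ t, conj (α t) * ∫ s, k (t - s) * β s‖ ≤ M * ((∫ t, ‖α t‖ ^ 2) + ∫ t, ‖β t‖ ^ 2) / 2 := by
  open scoped Convolution in
  set f : ℝ → ℂ := β ⋆[ContinuousLinearMap.mul ℂ ℂ] k with hf
  have hM0 : 0 ≤ M := (norm_nonneg _).trans (hM 0)
  have hβ' := hβ.memLp_two_of_bound hβc
  have hf1 : Integrable f := hβ.integrable_convolution _ hk
  have hfe : ∀ t, f t = ∫ s, k (t - s) * β s := fun t => by
    simp only [hf, convolution_def, ContinuousLinearMap.mul_apply', mul_comm]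
  -- Boundedness of β makes the convolution bounded, hence in `L¹ ∩ L²`, where Plancherel is
  -- available for Fourier integrals.
  have hfb : ∀ t, ‖f t‖ ≤ (∫ s, ‖k s‖) * c := fun t => by
    rw [hfe, ← integral_mul_const, ← integral_sub_left_eq_self (fun s => ‖k s‖ * c) volume t]
    refine norm_integral_le_of_norm_le ((hk.comp_sub_left t).norm.mul_const c)
      (.of_forall fun s => ?_)
    rw [norm_mul]
    exact mul_le_mul_of_nonneg_left (hβc s) (norm_nonneg _)
  have hF : ∀ ω, 𝓕 f ω = 𝓕 β ω * 𝓕 k ω := fun ω => Real.fourier_mul_convolution_eq hβ hk ω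
  simp_rw [← hfe]
  rw [← integral_conj_fourier_mul_fourier hα hα' hf1 (hf1.memLp_two_of_bound hfb)]
  have e1 : ∀ {g : ℝ → ℂ}, Integrable g → MemLp g 2 → ∫ ω, ‖𝓕 g ω‖ ^ 2 = ∫ t, ‖g t‖ ^ 2 := by
    intro g h1 h2
    have := integral_conj_fourier_mul_fourier h1 h2 h1 h2
    simp only [Complex.conj_mul'] at this
    exact_mod_cast this
  rw [← e1 hα hα', ← e1 hβ hβ']
  have i1 := (memLp_two_iff_integrable_sq_norm (memLp_fourier hα hα').1).1 (memLp_fourier hα hα')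
  have i2 := (memLp_two_iff_integrable_sq_norm (memLp_fourier hβ hβ').1).1 (memLp_fourier hβ hβ')
  rw [← integral_add i1 i2, ← integral_const_mul, ← integral_div]
  refine norm_integral_le_of_norm_le (((i1.add i2).const_mul M).div_const 2) (.of_forall fun ω => ?_)
  rw [hF, ← mul_assoc, norm_mul, mul_comm, mul_div_assoc]
  refine mul_le_mul (hM ω) ?_ (norm_nonneg _) hM0
  simpa using norm_mul_le_half_sq_add_sq (conj (𝓕 α ω)) (𝓕 β ω)

/-! ### Holomorphic parameter integrals and the transform of the power kernel -/

/-- A dominated integral of holomorphic functions is holomorphic. -/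
theorem differentiableOn_integral_of_dominated {α : Type*} [MeasurableSpace α] {μ : Measure α}
    {U : Set ℂ} (hU : IsOpen U) {f : ℂ → α → ℂ} {bound : α → ℝ}
    (hm : ∀ z ∈ U, AEStronglyMeasurable (f z) μ)
    (hd : ∀ᵐ x ∂μ, DifferentiableOn ℂ (fun z => f z x) U)
    (hb : ∀ᵐ x ∂μ, ∀ z ∈ U, ‖f z x‖ ≤ bound x) (hi : Integrable bound μ) :
    DifferentiableOn ℂ (fun z => ∫ x, f z x ∂μ) U := by
  intro z₀ hz₀
  obtain ⟨r, hr, hrU⟩ := Metric.isOpen_iff.1 hU z₀ hz₀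
  have hr2 : 0 < r / 2 := by positivity
  have hball : Metric.ball z₀ (r / 2) ⊆ U := (Metric.ball_subset_ball (by linarith)).trans hrU
  -- The derivative is dominated by Cauchy's estimate on circles of radius `r / 3`: around points of
  -- the ball of radius `r / 2` they stay inside the ball of radius `r`.
  refine (hasDerivAt_integral_of_dominated_loc_of_deriv_le (F := f)
    (F' := fun z x => deriv (fun w => f w x) z) (bound := fun x => bound x / (r / 3))
    (Metric.ball_mem_nhds z₀ hr2) ?_ ?_ ?_ ?_ ?_ ?_).2.differentiableAt.differentiableWithinAt
  · filter_upwards [hU.mem_nhds hz₀] with z hz using hm z hz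
  · exact hi.mono' (hm z₀ hz₀) (by filter_upwards [hb] with x hx using hx z₀ hz₀)
  -- The derivative at `z₀` is measurable in `x` as the limit of difference quotients along a
  -- sequence.
  · obtain ⟨u, hu⟩ : ∃ u : ℕ → ℂ, (∀ n, u n ≠ z₀ ∧ u n ∈ U) ∧
        Filter.Tendsto u Filter.atTop (nhds z₀) := by
      have : Filter.Tendsto (fun n : ℕ => z₀ + ((r / 2 * (1 / ((n : ℝ) + 1)) : ℝ) : ℂ))
          Filter.atTop (nhds (z₀ + ((r / 2 * 0 : ℝ) : ℂ))) :=
        tendsto_const_nhds.add ((Complex.continuous_ofReal.tendsto _).comp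
          (tendsto_const_nhds.mul tendsto_one_div_add_atTop_nhds_zero_nat))
      refine ⟨fun n : ℕ => z₀ + ((r / 2 * (1 / ((n : ℝ) + 1)) : ℝ) : ℂ), fun n => ⟨?_, hrU ?_⟩, by
        simpa using this⟩
      · rw [Ne, add_eq_left, Complex.ofReal_eq_zero]
        positivity
      · rw [mem_ball_iff_norm, add_sub_cancel_left, Complex.norm_real,
          Real.norm_of_nonneg (by positivity)]
        have : 1 / ((n : ℝ) + 1) ≤ 1 := by
          rw [div_le_one (by positivity)]; linarith [(Nat.cast_nonneg n : (0 : ℝ) ≤ n)]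
        nlinarith
    refine aestronglyMeasurable_of_tendsto_ae Filter.atTop
      (f := fun n x => slope (fun w => f w x) z₀ (u n)) (fun n => ?_) ?_
    · simp only [slope_def_field]
      simp only [div_eq_mul_inv]
      exact ((hm _ (hu.1 n).2).sub (hm _ hz₀)).mul_const _
    · filter_upwards [hd] with x hx
      have := (hx.differentiableAt (hU.mem_nhds hz₀)).hasDerivAt.tendsto_slope
      exact this.comp (tendsto_nhdsWithin_iff.2 ⟨hu.2, .of_forall fun n => (hu.1 n).1⟩)
  · filter_upwards [hd, hb] with x hx hbx z hz
    refine Complex.norm_deriv_le_of_forall_mem_sphere_norm_le (by positivity) ?_ fun w hw => hbx w ?_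
    · refine hx.diffContOnCl_ball fun w hw => hrU ?_
      rw [Metric.mem_closedBall] at hw
      rw [Metric.mem_ball] at hz ⊢
      linarith [dist_triangle w z z₀]
    · refine hrU ?_
      rw [Metric.mem_sphere] at hw
      rw [Metric.mem_ball] at hz ⊢
      linarith [dist_triangle w z z₀]
  · exact hi.div_const _
  · filter_upwards [hd] with x hx z hz
    exact (hx.differentiableAt (hU.mem_nhds (hball hz))).hasDerivAt

theorem integrableOn_rpow_mul_exp_neg {a ε : ℝ} (ha : -1 < a) (hε : 0 < ε) :
    IntegrableOn (fun t : ℝ => t ^ a * Real.exp (-(ε * t))) (Set.Ioi 0) := by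
  simpa [Real.rpow_one] using integrableOn_rpow_mul_exp_neg_mul_rpow ha one_pos hε

theorem norm_cpow_mul_cexp_neg_mul {t : ℝ} (ht : 0 < t) (a c : ℂ) :
    ‖(t : ℂ) ^ a * Complex.exp (-(c * t))‖ = t ^ a.re * Real.exp (-(c.re * t)) := by
  rw [norm_mul, Complex.norm_cpow_eq_rpow_re_of_pos ht, Complex.norm_exp]
  simp

theorem aestronglyMeasurable_cpow_mul_cexp (a c : ℂ) :
    AEStronglyMeasurable (fun t : ℝ => (t : ℂ) ^ a * Complex.exp (-(c * t)))
      (volume.restrict (Set.Ioi 0)) := by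
  refine ContinuousOn.aestronglyMeasurable (fun t ht => ?_) measurableSet_Ioi
  refine ((Complex.continuousAt_ofReal_cpow_const _ _ (Or.inr (ne_of_gt ht))).mul
    ?_).continuousWithinAt
  fun_prop

/-- The integral of `t ^ (a - 1) * exp (-(c * t))` over `(0, ∞)`, for complex `a` and `c`. -/
theorem integral_cpow_mul_cexp_neg_mul_Ioi {a c : ℂ} (ha : 0 < a.re) (hc : 0 < c.re) :
    ∫ t : ℝ in Set.Ioi 0, (t : ℂ) ^ (a - 1) * Complex.exp (-(c * t)) =
      (1 / c) ^ a * Complex.Gamma a := by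
  set U : Set ℂ := {z | 0 < z.re}
  have hU : IsOpen U := isOpen_lt continuous_const Complex.continuous_re
  have hf : DifferentiableOn ℂ
      (fun c : ℂ => ∫ t : ℝ in Set.Ioi 0, (t : ℂ) ^ (a - 1) * Complex.exp (-(c * t))) U := by
    intro c₀ hc₀
    set U' : Set ℂ := {z | c₀.re / 2 < z.re}
    have hU' : IsOpen U' := isOpen_lt continuous_const Complex.continuous_re
    have hc₀' : c₀ ∈ U' := by simp only [U', Set.mem_ofPred_eq]; linarith [Set.mem_ofPred.1 hc₀]
    refine ((differentiableOn_integral_of_dominated hU'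
      (bound := fun t => t ^ (a.re - 1) * Real.exp (-(c₀.re / 2 * t)))
      (fun z _ => aestronglyMeasurable_cpow_mul_cexp _ _) ?_ ?_ ?_).differentiableAt
        (hU'.mem_nhds hc₀')).differentiableWithinAt
    · refine .of_forall fun t => ?_
      fun_prop
    · filter_upwards [ae_restrict_mem measurableSet_Ioi] with t ht z hz
      rw [norm_cpow_mul_cexp_neg_mul ht]
      simp only [Complex.sub_re, Complex.one_re]
      have := Real.rpow_nonneg (le_of_lt ht) (a.re - 1)
      gcongr
      · exact le_of_lt ht
      · exact le_of_lt hz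
    · exact integrableOn_rpow_mul_exp_neg (by linarith) (half_pos hc₀)
  have hg : DifferentiableOn ℂ (fun c : ℂ => (1 / c) ^ a * Complex.Gamma a) U := by
    intro z hz
    have hz0 : z ≠ 0 := fun h => by simp [U, h] at hz
    refine DifferentiableAt.differentiableWithinAt ?_
    refine DifferentiableAt.mul_const ?_ _
    refine DifferentiableAt.cpow ((differentiableAt_const _).div differentiableAt_id hz0)
      (differentiableAt_const _) ?_
    left
    simp only [one_div, Complex.inv_re]
    exact div_pos hz (Complex.normSq_pos.2 hz0)
  have h1 : (1 : ℂ) ∈ U := by simp [U]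
  -- For real positive `c` the formula is the classical one. The points `1 + 1/(n+1)` accumulate at
  -- 1, and the identity theorem carries it to the half plane.
  have hfg : ∃ᶠ z in nhdsWithin (1 : ℂ) {1}ᶜ,
      (∫ t : ℝ in Set.Ioi 0, (t : ℂ) ^ (a - 1) * Complex.exp (-(z * t))) =
        (1 / z) ^ a * Complex.Gamma a := by
    have ht : Filter.Tendsto (fun n : ℕ => (1 : ℂ) + ((1 / ((n : ℝ) + 1) : ℝ) : ℂ))
        Filter.atTop (nhdsWithin (1 : ℂ) {1}ᶜ) := by
      refine tendsto_nhdsWithin_iff.2 ⟨?_, .of_forall fun n => ?_⟩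
      · have : Filter.Tendsto (fun n : ℕ => (1 : ℂ) + ((1 / ((n : ℝ) + 1) : ℝ) : ℂ))
            Filter.atTop (nhds ((1 : ℂ) + ((0 : ℝ) : ℂ))) :=
          tendsto_const_nhds.add ((Complex.continuous_ofReal.tendsto _).comp
            tendsto_one_div_add_atTop_nhds_zero_nat)
        simpa using this
      · simp only [Set.mem_compl_iff, Set.mem_singleton_iff, add_eq_left, Complex.ofReal_eq_zero]
        positivity
    refine ht.frequently (.of_forall fun n => ?_)
    have := Complex.integral_cpow_mul_exp_neg_mul_Ioi ha
      (show (0 : ℝ) < 1 + 1 / ((n : ℝ) + 1) by positivity)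
    push_cast at this ⊢
    exact this
  exact (hf.analyticOnNhd hU).eqOn_of_preconnected_of_frequently_eq (hg.analyticOnNhd hU)
    (convex_halfSpace_re_gt 0).isPreconnected h1 hfg hc

/-- The kernel `(z + 1) t_+^z e^{-εt}`. -/
noncomputable def powKernel (ε : ℝ) (z : ℂ) (t : ℝ) : ℂ :=
  (Set.Ioi (0 : ℝ)).indicator (fun t : ℝ => (z + 1) * ((t : ℂ) ^ z * Complex.exp (-((ε : ℂ) * t)))) t

theorem powKernel_of_nonpos {ε : ℝ} {z : ℂ} {t : ℝ} (ht : t ≤ 0) : powKernel ε z t = 0 := by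
  simp [powKernel, ht]

theorem powKernel_of_pos {ε : ℝ} {z : ℂ} {t : ℝ} (ht : 0 < t) :
    powKernel ε z t = (z + 1) * ((t : ℂ) ^ z * Complex.exp (-((ε : ℂ) * t))) := by
  simp [powKernel, ht]

theorem measurable_powKernel (ε : ℝ) (z : ℂ) : Measurable (powKernel ε z) := by
  unfold powKernel
  refine Measurable.indicator ?_ measurableSet_Ioi
  fun_prop

theorem norm_powKernel_of_pos {ε : ℝ} {z : ℂ} {t : ℝ} (ht : 0 < t) :
    ‖powKernel ε z t‖ = ‖z + 1‖ * (t ^ z.re * Real.exp (-(ε * t))) := by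
  rw [powKernel_of_pos ht, norm_mul, norm_cpow_mul_cexp_neg_mul ht, Complex.ofReal_re]

theorem integrable_powKernel {ε : ℝ} (hε : 0 < ε) {z : ℂ} (hz : -1 < z.re) :
    Integrable (powKernel ε z) := by
  have h : IntegrableOn (powKernel ε z) (Set.Ioi 0) := by
    refine ((integrableOn_rpow_mul_exp_neg hz hε).const_mul ‖z + 1‖).mono'
      (measurable_powKernel ε z).aestronglyMeasurable ?_
    filter_upwards [ae_restrict_mem measurableSet_Ioi] with t ht
    rw [norm_powKernel_of_pos ht]
  rw [← integrable_indicator_iff measurableSet_Ioi] at h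
  refine h.congr (.of_forall fun t => ?_)
  by_cases ht : 0 < t <;> simp [powKernel, ht]

/-- In this strip |t^{a-1}| ≤ 1 + t, and ∫ (1 + t) e^{-t} = 2 over the half line. -/
theorem norm_Gamma_le_two {a : ℂ} (h1 : 1 ≤ a.re) (h2 : a.re ≤ 2) : ‖Complex.Gamma a‖ ≤ 2 := by
  rw [Complex.Gamma_eq_integral (by linarith), Complex.GammaIntegral]
  have i1 : IntegrableOn (fun t : ℝ => (1 + t) * Real.exp (-t)) (Set.Ioi 0) := by
    have := (integrableOn_rpow_mul_exp_neg (a := 0) (by norm_num) one_pos).add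
      (integrableOn_rpow_mul_exp_neg (a := 1) (by norm_num) one_pos)
    refine this.congr_fun (fun t _ => ?_) measurableSet_Ioi
    simp; ring
  have e : ∫ t : ℝ in Set.Ioi 0, (1 + t) * Real.exp (-t) = 2 := by
    have h1 := Real.Gamma_eq_integral (s := 1) one_pos
    have h2 := Real.Gamma_eq_integral (s := 2) two_pos
    rw [Real.Gamma_one] at h1
    rw [Real.Gamma_two] at h2
    calc _ = ∫ t : ℝ in Set.Ioi 0,
            (Real.exp (-t) * t ^ ((1 : ℝ) - 1) + Real.exp (-t) * t ^ ((2 : ℝ) - 1)) := by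
          refine setIntegral_congr_fun measurableSet_Ioi fun t _ => ?_
          norm_num; ring
      _ = 1 + 1 := by
          rw [integral_add (Real.GammaIntegral_convergent one_pos)
            (Real.GammaIntegral_convergent two_pos), ← h1, ← h2]
      _ = 2 := by norm_num
  rw [← e]
  refine norm_integral_le_of_norm_le i1 ?_
  filter_upwards [ae_restrict_mem measurableSet_Ioi] with t ht
  have ht' : 0 < t := ht
  rw [norm_mul, Complex.norm_cpow_eq_rpow_re_of_pos ht', Complex.norm_real,
    Real.norm_of_nonneg (Real.exp_pos _).le, mul_comm]
  refine mul_le_mul_of_nonneg_right ?_ (Real.exp_pos _).le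
  simp only [Complex.sub_re, Complex.one_re]
  rcases le_total t 1 with h | h
  · exact (Real.rpow_le_one ht'.le h (by linarith)).trans (by linarith)
  · exact (Real.rpow_le_rpow_of_exponent_le h (show a.re - 1 ≤ 1 by linarith)).trans (by
      rw [Real.rpow_one]; linarith)

/-- With c = ε + 2πiω the transform is (z+1) Γ(z+1) c^{-(z+1)}. The factor z+1 built into the kernel
turns this into Γ(z+2), which has no pole at Re z = -1, so the bound survives δ → 0. As c lies in
the right half plane, its argument costs at most e^{π|τ|/2}. -/
theorem norm_fourier_powKernel_le {ε δ : ℝ} (hε : 0 < ε) (hδ : 0 < δ) (hδ1 : δ ≤ 1) (τ ω : ℝ) :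
    ‖𝓕 (powKernel ε (-1 + δ + τ * Complex.I)) ω‖ ≤
      2 * ε ^ (-δ) * Real.exp (Real.pi / 2 * |τ|) := by
  set z : ℂ := -1 + δ + τ * Complex.I with hz
  set c : ℂ := ε + 2 * Real.pi * ω * Complex.I with hc
  have hcre : c.re = ε := by simp [hc]
  have hc0 : c ≠ 0 := fun h => by rw [h] at hcre; simp at hcre; linarith
  have hzre : (z + 1).re = δ := by simp [hz]
  have hzim : (z + 1).im = τ := by simp [hz]
  have e : 𝓕 (powKernel ε z) ω = (1 / c) ^ (z + 1) * Complex.Gamma (z + 1 + 1) := by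
    rw [Real.fourier_real_eq_integral_exp_smul, Complex.Gamma_add_one _ (fun h => by
      rw [h] at hzre; simp at hzre; linarith)]
    rw [mul_left_comm, ← integral_cpow_mul_cexp_neg_mul_Ioi (by rw [hzre]; exact hδ)
      (by rw [hcre]; exact hε), ← integral_const_mul, ← integral_indicator measurableSet_Ioi]
    refine integral_congr_ae (.of_forall fun t => ?_)
    by_cases ht : 0 < t
    · simp only [powKernel, Set.indicator_of_mem (Set.mem_Ioi.2 ht), add_sub_cancel_right,
        smul_eq_mul]
      rw [mul_left_comm, mul_left_comm (Complex.exp _), ← Complex.exp_add]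
      congr 3
      rw [hc]; push_cast; ring
    · simp [powKernel, ht]
  rw [e, norm_mul]
  have h1 : ‖Complex.Gamma (z + 1 + 1)‖ ≤ 2 :=
    norm_Gamma_le_two (by simp [hzre, hδ.le]) (by rw [Complex.add_re, hzre]; norm_num; linarith)
  have h2 : ‖(1 / c) ^ (z + 1)‖ ≤ ε ^ (-δ) * Real.exp (Real.pi / 2 * |τ|) := by
    rw [Complex.norm_cpow_of_ne_zero (one_div_ne_zero hc0), hzre, hzim, div_eq_mul_inv,
      ← Real.exp_neg, norm_div, norm_one, one_div, Real.inv_rpow (norm_nonneg _),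
      ← Real.rpow_neg (norm_nonneg _)]
    refine mul_le_mul ?_ ?_ (Real.exp_pos _).le (by positivity)
    · refine Real.rpow_le_rpow_of_nonpos hε ?_ (by linarith)
      rw [← hcre]; exact Complex.re_le_norm c
    · refine Real.exp_le_exp.2 ((neg_le_abs _).trans ?_)
      rw [abs_mul]
      refine mul_le_mul_of_nonneg_right ?_ (abs_nonneg _)
      rw [Complex.abs_arg_le_pi_div_two_iff, one_div, Complex.inv_re, hcre]
      exact div_nonneg hε.le (Complex.normSq_nonneg _)
  calc _ ≤ ε ^ (-δ) * Real.exp (Real.pi / 2 * |τ|) * 2 :=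
        mul_le_mul h2 h1 (norm_nonneg _) (by positivity)
    _ = _ := by ring

/-! ### The heat-regularised Schrödinger kernel and compactly supported test functions -/

section

variable {d : ℕ}

/-- The plane wave `e^{2πi⟨x,ξ⟩}` evolved by `e^{itΔ}` and damped by the heat semigroup `e^{ηΔ}`. -/
noncomputable def heatWave (η : ℝ) (X : ℝ × RSpace d) (ξ : RSpace d) : ℂ :=
  Complex.exp (-(4 * Real.pi ^ 2 * (η + X.1 * Complex.I)) * ‖ξ‖ ^ 2 +
    2 * Real.pi * Complex.I * (⟪X.2, ξ⟫_ℝ : ℝ))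

/-- The integral kernel of `e^{ηΔ} e^{itΔ}`. -/
noncomputable def gaussKernel (η : ℝ) (X : ℝ × RSpace d) : ℂ := ∫ ξ, heatWave η X ξ

theorem continuous_heatWave (η : ℝ) :
    Continuous fun p : (ℝ × RSpace d) × RSpace d => heatWave η p.1 p.2 := by
  unfold heatWave; fun_prop

theorem Continuous.heatWave {Z : Type*} [TopologicalSpace Z] (η : ℝ) {f : Z → ℝ × RSpace d}
    {g : Z → RSpace d} (hf : Continuous f) (hg : Continuous g) :
    Continuous fun z => heatWave η (f z) (g z) := by
  unfold _root_.heatWave; fun_prop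

theorem norm_heatWave (η : ℝ) (X : ℝ × RSpace d) (ξ : RSpace d) :
    ‖heatWave η X ξ‖ = Real.exp (-(4 * Real.pi ^ 2 * η) * ‖ξ‖ ^ 2) := by
  rw [heatWave, Complex.norm_exp]
  congr 1
  simp only [Complex.add_re, Complex.mul_re, Complex.neg_re, Complex.neg_im, Complex.mul_im,
    Complex.add_im, Complex.ofReal_re, Complex.ofReal_im, Complex.I_re, Complex.I_im, sq,
    Complex.re_ofNat, Complex.im_ofNat]
  ring

theorem norm_heatWave_le_one {η : ℝ} (hη : 0 ≤ η) (X : ℝ × RSpace d) (ξ : RSpace d) :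
    ‖heatWave η X ξ‖ ≤ 1 := by
  rw [norm_heatWave]
  refine Real.exp_le_one_iff.2 ?_
  have : 0 ≤ 4 * Real.pi ^ 2 * η * ‖ξ‖ ^ 2 := by positivity
  linarith

/-- This splits the kernel of e^{2ηΔ}e^{i(t-s)Δ} into a function of `X` times a function of `Y` at
each frequency; it is the reason why `2 * η` appears in all the forms below. -/
theorem heatWave_mul_conj (η : ℝ) (X Y : ℝ × RSpace d) (ξ : RSpace d) :
    heatWave η X ξ * conj (heatWave η Y ξ) = heatWave (2 * η) (X - Y) ξ := by
  simp only [heatWave, ← Complex.exp_conj, ← Complex.exp_add]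
  congr 1
  simp only [map_add, map_mul, map_neg, map_pow, Complex.conj_ofReal, Complex.conj_I, map_ofNat,
    Prod.fst_sub, Prod.snd_sub, inner_sub_left]
  push_cast
  ring

theorem integrable_exp_neg_mul_sq_norm {b : ℝ} (hb : 0 < b) :
    Integrable fun ξ : RSpace d => Real.exp (-b * ‖ξ‖ ^ 2) := by
  have := (GaussianFourier.integrable_cexp_neg_mul_sq_norm_add (V := RSpace d) (b := b)
    (by simpa using hb) 0 0).norm
  refine this.congr (.of_forall fun ξ => ?_)
  beta_reduce
  rw [Complex.norm_exp]
  simp [← Complex.ofReal_pow]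

theorem integrable_heatWave {η : ℝ} (hη : 0 < η) (X : ℝ × RSpace d) :
    Integrable (heatWave η X) := by
  refine (integrable_exp_neg_mul_sq_norm (b := 4 * Real.pi ^ 2 * η) (by positivity)).mono'
    ((continuous_heatWave η).comp (Continuous.prodMk_right X)).aestronglyMeasurable
    (.of_forall fun ξ => (norm_heatWave η X ξ).le)

theorem stronglyMeasurable_gaussKernel (η : ℝ) :
    StronglyMeasurable (gaussKernel η : ℝ × RSpace d → ℂ) :=
  (continuous_heatWave (d := d) η).stronglyMeasurable.integral_prod_right

theorem exists_norm_gaussKernel_le {η : ℝ} (hη : 0 < η) :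
    ∃ c : ℝ, ∀ X : ℝ × RSpace d, ‖gaussKernel η X‖ ≤ c :=
  ⟨∫ ξ : RSpace d, Real.exp (-(4 * Real.pi ^ 2 * η) * ‖ξ‖ ^ 2), fun X =>
    norm_integral_le_of_norm_le (integrable_exp_neg_mul_sq_norm (by positivity))
      (.of_forall fun ξ => (norm_heatWave η X ξ).le)⟩

/-- The dispersive bound for the regularised Schrödinger kernel. -/
theorem norm_gaussKernel_le {η : ℝ} (hη : 0 < η) {X : ℝ × RSpace d} (hX : X.1 ≠ 0) :
    ‖gaussKernel η X‖ ≤ |X.1| ^ (-(d : ℝ) / 2) := by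
  set b : ℂ := 4 * Real.pi ^ 2 * (η + X.1 * Complex.I) with hb
  have hbre : b.re = 4 * Real.pi ^ 2 * η := by
    simp [hb, ← Complex.ofReal_pow]
  have hbim : b.im = 4 * Real.pi ^ 2 * X.1 := by
    simp [hb, ← Complex.ofReal_pow]
  have hbpos : 0 < b.re := by rw [hbre]; positivity
  have hb0 : b ≠ 0 := fun h => by rw [h] at hbpos; simp at hbpos
  have hX0 : 0 < |X.1| := abs_pos.2 hX
  -- A crude bound that discards a factor 4π, which makes the dispersive constant exactly 1.
  have hbn : Real.pi * |X.1| ≤ ‖b‖ := by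
    refine le_trans ?_ (Complex.abs_im_le_norm b)
    rw [hbim, abs_mul, abs_of_pos (show 0 < 4 * Real.pi ^ 2 by positivity)]
    refine mul_le_mul_of_nonneg_right ?_ hX0.le
    nlinarith [Real.pi_gt_three]
  have e := GaussianFourier.integral_cexp_neg_mul_sq_norm_add (V := RSpace d) hbpos
    (2 * Real.pi * Complex.I) X.2
  have e' : gaussKernel η X = _ := e
  rw [e', norm_mul, finrank_euclideanSpace, Fintype.card_fin]
  -- The exponent is a nonpositive real number times `b⁻¹`, and `b⁻¹` has positive real part.
  have h1 : ‖Complex.exp ((2 * Real.pi * Complex.I) ^ 2 * ‖X.2‖ ^ 2 / (4 * b))‖ ≤ 1 := by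
    rw [Complex.norm_exp]
    refine Real.exp_le_one_iff.2 ?_
    have : (2 * Real.pi * Complex.I) ^ 2 * ‖X.2‖ ^ 2 / (4 * b) =
        ((-(Real.pi ^ 2 * ‖X.2‖ ^ 2) : ℝ) : ℂ) * b⁻¹ := by
      rw [mul_pow, Complex.I_sq]; push_cast; field_simp; ring
    rw [this, Complex.re_ofReal_mul, Complex.inv_re]
    refine mul_nonpos_of_nonpos_of_nonneg (by simp only [Left.neg_nonpos_iff]; positivity) ?_
    exact div_nonneg hbpos.le (Complex.normSq_nonneg _)
  have h2 : ‖(Real.pi / b) ^ ((d : ℂ) / 2)‖ ≤ |X.1| ^ (-(d : ℝ) / 2) := by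
    have : ((d : ℂ) / 2) = ((d / 2 : ℝ) : ℂ) := by push_cast; rfl
    rw [this, Complex.norm_cpow_of_ne_zero (by
      exact div_ne_zero (by exact_mod_cast Real.pi_ne_zero) hb0), Complex.ofReal_re,
      Complex.ofReal_im, mul_zero, Real.exp_zero, div_one, norm_div, Complex.norm_real,
      Real.norm_of_nonneg Real.pi_pos.le, neg_div, Real.rpow_neg hX0.le, ← Real.inv_rpow hX0.le]
    refine Real.rpow_le_rpow (by positivity) ?_ (by positivity)
    rw [div_le_iff₀ (norm_pos_iff.2 hb0), inv_mul_eq_div, le_div_iff₀ hX0]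
    exact hbn
  calc _ ≤ |X.1| ^ (-(d : ℝ) / 2) * 1 := mul_le_mul h2 h1 (norm_nonneg _) (by positivity)
    _ = _ := mul_one _

/-- A bounded measurable function supported in a bounded space-time box. -/
structure BoxFun (R c : ℝ) (a : ℝ × RSpace d → ℂ) : Prop where
  measurable : Measurable a
  bound : ∀ X, ‖a X‖ ≤ c
  support : ∀ X, a X ≠ 0 → X ∈ Set.Icc (-R) R ×ˢ Metric.closedBall (0 : RSpace d) R

namespace BoxFun

variable {R c : ℝ} {a b : ℝ × RSpace d → ℂ}

theorem norm_le (ha : BoxFun R c a) (t : ℝ) (x : RSpace d) :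
    ‖a (t, x)‖ ≤ (Set.Icc (-R) R).indicator (fun _ => c) t *
      (Metric.closedBall (0 : RSpace d) R).indicator (fun _ => 1) x := by
  by_cases h : a (t, x) = 0
  · rw [h, norm_zero]
    have := (norm_nonneg _).trans (ha.bound (t, x))
    refine mul_nonneg (Set.indicator_nonneg (fun _ _ => this) _)
      (Set.indicator_nonneg (fun _ _ => zero_le_one) _)
  · have := ha.support _ h
    rw [Set.indicator_of_mem this.1, Set.indicator_of_mem this.2, mul_one]
    exact ha.bound _

theorem integrable_indicator_closedBall (R : ℝ) : Integrable
    ((Metric.closedBall (0 : RSpace d) R).indicator fun _ => (1 : ℝ)) :=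
  (integrable_indicator_iff measurableSet_closedBall).2
    (integrableOn_const (isCompact_closedBall _ _).measure_lt_top.ne)

theorem integrable_indicator_Icc (R c : ℝ) : Integrable ((Set.Icc (-R) R).indicator fun _ => c) :=
  (integrable_indicator_iff measurableSet_Icc).2
    (integrableOn_const isCompact_Icc.measure_lt_top.ne)

theorem integrable (ha : BoxFun R c a) : Integrable a :=
  ((integrable_indicator_Icc R c).mul_prod (integrable_indicator_closedBall (d := d) R)).mono'
    ha.measurable.aestronglyMeasurable (.of_forall fun X => ha.norm_le X.1 X.2)

theorem memLp_two (ha : BoxFun R c a) : MemLp a 2 := ha.integrable.memLp_two_of_bound ha.bound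

theorem integrable_sq (ha : BoxFun R c a) : Integrable fun X => ‖a X‖ ^ 2 :=
  (memLp_two_iff_integrable_sq_norm ha.memLp_two.1).1 ha.memLp_two

theorem mul_bounded (ha : BoxFun R c a) {g : ℝ × RSpace d → ℂ} (hg : Measurable g) {m : ℝ}
    (hm : ∀ X, ‖g X‖ ≤ m) : BoxFun R (c * m) (fun X => a X * g X) where
  measurable := ha.measurable.mul hg
  bound X := by
    rw [norm_mul]
    exact mul_le_mul (ha.bound X) (hm X) (norm_nonneg _) ((norm_nonneg _).trans (ha.bound X))
  support X h := ha.support X (left_ne_zero_of_mul h)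

theorem star (ha : BoxFun R c a) : BoxFun R c (fun X => conj (a X)) where
  measurable := Complex.continuous_conj.measurable.comp ha.measurable
  bound X := by simpa using ha.bound X
  support X h := ha.support X (by simpa using h)

theorem slice_measurable (ha : BoxFun R c a) (t : ℝ) : Measurable fun x => a (t, x) :=
  ha.measurable.comp measurable_prodMk_left

theorem slice_integrable (ha : BoxFun R c a) (t : ℝ) : Integrable fun x => a (t, x) :=
  ((integrable_indicator_closedBall (d := d) R).const_mul _).mono'
    (ha.slice_measurable t).aestronglyMeasurable (.of_forall fun x => ha.norm_le t x)

theorem slice_memLp_two (ha : BoxFun R c a) (t : ℝ) : MemLp (fun x => a (t, x)) 2 :=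
  (ha.slice_integrable t).memLp_two_of_bound fun x => ha.bound (t, x)

theorem norm_integral_slice_le (ha : BoxFun R c a) (t : ℝ) :
    ‖∫ x, a (t, x)‖ ≤ (Set.Icc (-R) R).indicator (fun _ => c) t *
      ∫ x, (Metric.closedBall (0 : RSpace d) R).indicator (fun _ => 1) x := by
  rw [← integral_const_mul]
  exact norm_integral_le_of_norm_le ((integrable_indicator_closedBall (d := d) R).const_mul _)
    (.of_forall fun x => ha.norm_le t x)

theorem stronglyMeasurable_integral_slice (ha : BoxFun R c a) :
    StronglyMeasurable fun t => ∫ x, a (t, x) :=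
  ha.measurable.stronglyMeasurable.integral_prod_right'

theorem integrable_integral_slice (ha : BoxFun R c a) : Integrable fun t => ∫ x, a (t, x) :=
  ((integrable_indicator_Icc R c).mul_const _).mono'
    ha.stronglyMeasurable_integral_slice.aestronglyMeasurable
    (.of_forall fun t => ha.norm_integral_slice_le t)

theorem exists_bound_integral_slice (ha : BoxFun R c a) : ∃ m, ∀ t, ‖∫ x, a (t, x)‖ ≤ m := by
  refine ⟨c * ∫ x, (Metric.closedBall (0 : RSpace d) R).indicator (fun _ => 1) x,
    fun t => (ha.norm_integral_slice_le t).trans ?_⟩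
  have := (norm_nonneg _).trans (ha.bound (0, 0))
  refine mul_le_mul_of_nonneg_right (Set.indicator_le_self' (fun _ _ => this) _) ?_
  exact integral_nonneg fun x => Set.indicator_nonneg (fun _ _ => zero_le_one) _

variable {k : ℝ → ℂ}

theorem integrable_kernel_mul (hb : BoxFun R c b) (hk : Integrable k) (hkm : Measurable k) (t : ℝ) :
    Integrable fun Y : ℝ × RSpace d => k (t - Y.1) * b Y := by
  refine (((hk.comp_sub_left t).norm.mul_const c).mul_prod
    (integrable_indicator_closedBall (d := d) R)).mono' ?_ (.of_forall fun Y => ?_)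
  · exact ((hkm.comp (measurable_const.sub measurable_fst)).mul hb.measurable).aestronglyMeasurable
  · rw [norm_mul, mul_assoc]
    refine mul_le_mul_of_nonneg_left ((hb.norm_le Y.1 Y.2).trans ?_) (norm_nonneg _)
    have := (norm_nonneg _).trans (hb.bound (0, 0))
    exact mul_le_mul_of_nonneg_right (Set.indicator_le_self' (fun _ _ => this) _)
      (Set.indicator_nonneg (fun _ _ => zero_le_one) _)

theorem integrable_mul_kernel_mul (ha : BoxFun R c a) {c' : ℝ} (hb : BoxFun R c' b)
    (hk : Integrable k) (hkm : Measurable k) :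
    Integrable fun p : (ℝ × RSpace d) × (ℝ × RSpace d) => a p.1 * (k (p.1.1 - p.2.1) * b p.2) := by
  have hm : Measurable fun p : (ℝ × RSpace d) × (ℝ × RSpace d) =>
      a p.1 * (k (p.1.1 - p.2.1) * b p.2) :=
    (ha.measurable.comp measurable_fst).mul
      ((hkm.comp ((measurable_fst.comp measurable_fst).sub (measurable_fst.comp measurable_snd))).mul
        (hb.measurable.comp measurable_snd))
  refine (integrable_prod_iff hm.aestronglyMeasurable).2 ⟨.of_forall fun X => ?_, ?_⟩
  · exact (hb.integrable_kernel_mul hk hkm X.1).const_mul (a X)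
  · set J := (∫ s, ‖k s‖ * c') * ∫ x, (Metric.closedBall (0 : RSpace d) R).indicator (fun _ => 1) x
    refine (ha.integrable.norm.mul_const J).mono'
      hm.norm.stronglyMeasurable.integral_prod_right.aestronglyMeasurable (.of_forall fun X => ?_)
    rw [Real.norm_of_nonneg (integral_nonneg fun _ => norm_nonneg _)]
    simp only [norm_mul]
    rw [integral_const_mul]
    refine mul_le_mul_of_nonneg_left ?_ (norm_nonneg _)
    have e : J = ∫ Y : ℝ × RSpace d, (‖k (X.1 - Y.1)‖ * c') *
        (Metric.closedBall (0 : RSpace d) R).indicator (fun _ => 1) Y.2 := by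
      rw [Measure.volume_eq_prod, integral_prod_mul (fun s => ‖k (X.1 - s)‖ * c'),
        integral_sub_left_eq_self (fun s => ‖k s‖ * c')]
    rw [e]
    refine integral_mono_of_nonneg (.of_forall fun _ => by positivity)
      (((hk.comp_sub_left X.1).norm.mul_const c').mul_prod
        (integrable_indicator_closedBall (d := d) R)) (.of_forall fun Y => ?_)
    simp only [mul_assoc]
    refine mul_le_mul_of_nonneg_left ((hb.norm_le Y.1 Y.2).trans ?_) (norm_nonneg _)
    have := (norm_nonneg _).trans (hb.bound (0, 0))
    exact mul_le_mul_of_nonneg_right (Set.indicator_le_self' (fun _ _ => this) _)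
      (Set.indicator_nonneg (fun _ _ => zero_le_one) _)

end BoxFun

end

/-! ### The operator bound and the Hilbert–Schmidt bound for space-time kernels -/

section

theorem ofReal_integral_norm_sq {α : Type*} [MeasurableSpace α] {μ : Measure α} {f : α → ℂ}
    (hf : Integrable (fun x => ‖f x‖ ^ 2) μ) :
    ENNReal.ofReal (∫ x, ‖f x‖ ^ 2 ∂μ) = ∫⁻ x, ‖f x‖ₑ ^ 2 ∂μ := by
  rw [ofReal_integral_eq_lintegral_ofReal hf (.of_forall fun x => by positivity)]
  refine lintegral_congr fun x => ?_
  rw [ENNReal.ofReal_pow (norm_nonneg _), ofReal_norm]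

theorem integrable_norm_sq_of_lintegral_lt_top {α : Type*} [MeasurableSpace α] {μ : Measure α}
    {f : α → ℂ} (hm : AEStronglyMeasurable f μ) (hf : ∫⁻ x, ‖f x‖ₑ ^ 2 ∂μ < ∞) :
    Integrable (fun x => ‖f x‖ ^ 2) μ := by
  refine ⟨hm.norm.pow 2, ?_⟩
  rw [HasFiniteIntegral]
  refine lt_of_eq_of_lt (lintegral_congr fun x => ?_) hf
  rw [enorm_pow, enorm_norm]

variable {d : ℕ}

namespace BoxFun

variable {R c : ℝ} {a b : ℝ × RSpace d → ℂ} {η : ℝ}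

/-- At fixed `t` and `ξ` the heat wave is a plane wave times a factor that does not depend on `x`
and has modulus at most 1. -/
theorem norm_heatTransform_le (a : ℝ × RSpace d → ℂ) (hη : 0 ≤ η) (t : ℝ) (ξ : RSpace d) :
    ‖∫ x, a (t, x) * conj (heatWave η (t, x) ξ)‖ ≤ ‖𝓕 (fun x => a (t, x)) ξ‖ := by
  have e : ∀ x, a (t, x) * conj (heatWave η (t, x) ξ) =
      conj (heatWave η (t, (0 : RSpace d)) ξ) *
        (Complex.exp ((-2 * Real.pi * ⟪x, ξ⟫_ℝ : ℝ) * Complex.I) • a (t, x)) := fun x => by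
    rw [smul_eq_mul, ← mul_assoc, mul_comm (a _)]
    congr 1
    simp only [heatWave, ← Complex.exp_conj, ← Complex.exp_add]
    congr 1
    simp only [map_add, map_mul, map_neg, map_pow, Complex.conj_ofReal, Complex.conj_I, map_ofNat,
      inner_zero_left]
    push_cast
    ring
  simp_rw [e]
  rw [integral_const_mul, ← Real.fourier_eq', norm_mul]
  refine mul_le_of_le_one_left (norm_nonneg _) ?_
  simpa using norm_heatWave_le_one hη _ ξ

theorem heatWave_mul (ha : BoxFun R c a) (hη : 0 ≤ η) (ξ : RSpace d) :
    BoxFun R (c * 1) (fun X => a X * conj (heatWave η X ξ)) :=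
  ha.mul_bounded (g := fun X => conj (heatWave η X ξ))
    (Complex.continuous_conj.comp (continuous_id.heatWave η continuous_const)).measurable
    fun X => by simpa using norm_heatWave_le_one hη X ξ

theorem stronglyMeasurable_heatTransform (ha : BoxFun R c a) (η : ℝ) :
    StronglyMeasurable fun q : RSpace d × ℝ =>
      ∫ x, a (q.2, x) * conj (heatWave η (q.2, x) q.1) := by
  refine StronglyMeasurable.integral_prod_right'
    (f := fun p : (RSpace d × ℝ) × RSpace d => a (p.1.2, p.2) *
      conj (heatWave η (p.1.2, p.2) p.1.1)) (Measurable.stronglyMeasurable ?_)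
  have h1 : Measurable fun p : (RSpace d × ℝ) × RSpace d => (p.1.2, p.2) := by fun_prop
  have h2 : Continuous fun p : (RSpace d × ℝ) × RSpace d => heatWave η (p.1.2, p.2) p.1.1 :=
    Continuous.heatWave η (by fun_prop) (by fun_prop)
  exact (ha.measurable.comp h1).mul (Complex.continuous_conj.comp h2).measurable

theorem lintegral_heatTransform_le (ha : BoxFun R c a) (hη : 0 ≤ η) :
    ∫⁻ q : RSpace d × ℝ, ‖∫ x, a (q.2, x) * conj (heatWave η (q.2, x) q.1)‖ₑ ^ 2 ≤
      ∫⁻ X, ‖a X‖ₑ ^ 2 := by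
  have hm := ha.stronglyMeasurable_heatTransform η
  rw [Measure.volume_eq_prod, Measure.volume_eq_prod,
    lintegral_prod_symm _ (hm.measurable.enorm.pow_const 2).aemeasurable,
    lintegral_prod _ (ha.measurable.enorm.pow_const 2).aemeasurable]
  refine lintegral_mono fun t => ?_
  rw [← lintegral_enorm_fourier_sq (ha.slice_integrable t) (ha.slice_memLp_two t)]
  refine lintegral_mono fun ξ => ?_
  gcongr
  rw [enorm_le_iff_norm_le]
  exact norm_heatTransform_le a hη t ξ

theorem integrable_heatTransform_sq (ha : BoxFun R c a) (hη : 0 ≤ η) :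
    Integrable fun q : RSpace d × ℝ =>
      ‖∫ x, a (q.2, x) * conj (heatWave η (q.2, x) q.1)‖ ^ 2 := by
  refine integrable_norm_sq_of_lintegral_lt_top
    (ha.stronglyMeasurable_heatTransform η).aestronglyMeasurable
    ((ha.lintegral_heatTransform_le hη).trans_lt ?_)
  rw [← ofReal_integral_norm_sq ha.integrable_sq]
  exact ENNReal.ofReal_lt_top

theorem integral_heatTransform_sq_le (ha : BoxFun R c a) (hη : 0 ≤ η) :
    ∫ ξ, ∫ t, ‖∫ x, a (t, x) * conj (heatWave η (t, x) ξ)‖ ^ 2 ≤ ∫ X, ‖a X‖ ^ 2 := by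
  have e := integral_prod _ (ha.integrable_heatTransform_sq hη)
  rw [← e, ← ENNReal.ofReal_le_ofReal_iff (integral_nonneg fun _ => by positivity),
    ofReal_integral_norm_sq ha.integrable_sq]
  have := ofReal_integral_norm_sq (ha.integrable_heatTransform_sq hη)
  exact this.trans_le (ha.lintegral_heatTransform_le hη)

/-- The sesquilinear form with space-time kernel `k(t - s) e^{2ηΔ} e^{i(t - s)Δ}` is controlled
by the supremum of `𝓕 k`. -/
theorem norm_kernelForm_le (ha : BoxFun R c a) {c' : ℝ} (hb : BoxFun R c' b) (hη : 0 < η)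
    {k : ℝ → ℂ} (hk : Integrable k) (hkm : Measurable k) {M : ℝ} (hM : ∀ ω, ‖𝓕 k ω‖ ≤ M) :
    ‖∫ p : (ℝ × RSpace d) × (ℝ × RSpace d),
      conj (a p.1) * (k (p.1.1 - p.2.1) * b p.2) * gaussKernel (2 * η) (p.1 - p.2)‖ ≤
      M * ((∫ X, ‖a X‖ ^ 2) + ∫ X, ‖b X‖ ^ 2) / 2 := by
  have hI := ha.star.integrable_mul_kernel_mul hb hk hkm
  set Φ : (ℝ × RSpace d) × (ℝ × RSpace d) → RSpace d → ℂ := fun p ξ =>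
    conj (a p.1) * (k (p.1.1 - p.2.1) * b p.2) * heatWave (2 * η) (p.1 - p.2) ξ with hΦ
  have hΦi : Integrable (Function.uncurry Φ) (volume.prod volume) := by
    refine (hI.norm.mul_prod (integrable_exp_neg_mul_sq_norm (d := d)
      (b := 4 * Real.pi ^ 2 * (2 * η)) (by positivity))).mono' ?_ (.of_forall fun q => ?_)
    · have h2 : Continuous fun q : ((ℝ × RSpace d) × (ℝ × RSpace d)) × RSpace d =>
          heatWave (2 * η) (q.1.1 - q.1.2) q.2 :=
        Continuous.heatWave _ (by fun_prop) (by fun_prop)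
      exact hI.aestronglyMeasurable.comp_fst.mul h2.aestronglyMeasurable
    · simp only [Function.uncurry, hΦ]
      rw [norm_mul, norm_heatWave]
  have e1 : ∀ p : (ℝ × RSpace d) × (ℝ × RSpace d),
      conj (a p.1) * (k (p.1.1 - p.2.1) * b p.2) * gaussKernel (2 * η) (p.1 - p.2) =
        ∫ ξ, Φ p ξ := fun p => by rw [gaussKernel, ← integral_const_mul]
  simp_rw [e1]
  rw [integral_integral_swap hΦi]
  set α : RSpace d → ℝ → ℂ := fun ξ t => ∫ x, a (t, x) * conj (heatWave η (t, x) ξ) with hα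
  set β : RSpace d → ℝ → ℂ := fun ξ t => ∫ x, b (t, x) * conj (heatWave η (t, x) ξ) with hβ
  have e2 : ∀ ξ, ∫ p, Φ p ξ = ∫ t, conj (α ξ t) * ∫ s, k (t - s) * β ξ s := by
    intro ξ
    have hA := ha.heatWave_mul hη.le ξ
    have hB := hb.heatWave_mul hη.le ξ
    have hAB := hA.star.integrable_mul_kernel_mul hB hk hkm
    have e3 : ∀ p, Φ p ξ = conj (a p.1 * conj (heatWave η p.1 ξ)) *
        (k (p.1.1 - p.2.1) * (b p.2 * conj (heatWave η p.2 ξ))) := fun p => by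
      simp only [hΦ, ← heatWave_mul_conj, map_mul, Complex.conj_conj]
      ring
    simp_rw [e3]
    rw [Measure.volume_eq_prod, integral_prod _ hAB]
    have e4 : ∀ X : ℝ × RSpace d, ∫ Y : ℝ × RSpace d, conj (a X * conj (heatWave η X ξ)) *
        (k (X.1 - Y.1) * (b Y * conj (heatWave η Y ξ))) =
        conj (a X * conj (heatWave η X ξ)) * ∫ s, k (X.1 - s) * β ξ s := fun X => by
      rw [integral_const_mul, Measure.volume_eq_prod,
        integral_prod _ (hB.integrable_kernel_mul hk hkm X.1)]
      simp only [integral_const_mul, hβ]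
    have hint := hAB.integral_prod_left
    simp_rw [e4] at hint ⊢
    rw [Measure.volume_eq_prod, integral_prod _ hint]
    simp only [integral_mul_const, hα, integral_conj]
  simp_rw [e2]
  have ia := (ha.integrable_heatTransform_sq hη.le).integral_prod_left
  have ib := (hb.integrable_heatTransform_sq hη.le).integral_prod_left
  have hM0 : 0 ≤ M := (norm_nonneg _).trans (hM 0)
  calc _ ≤ ∫ ξ, M * ((∫ t, ‖α ξ t‖ ^ 2) + ∫ t, ‖β ξ t‖ ^ 2) / 2 := by
        refine norm_integral_le_of_norm_le (((ia.add ib).const_mul M).div_const 2)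
          (.of_forall fun ξ => ?_)
        have hA := ha.heatWave_mul hη.le ξ
        have hB := hb.heatWave_mul hη.le ξ
        obtain ⟨m, hm⟩ := hA.exists_bound_integral_slice
        obtain ⟨m', hm'⟩ := hB.exists_bound_integral_slice
        exact norm_integral_conj_mul_convolution_le hk hA.integrable_integral_slice
          (hA.integrable_integral_slice.memLp_two_of_bound hm) hB.integrable_integral_slice hm' hM
    _ = M * ((∫ ξ, ∫ t, ‖α ξ t‖ ^ 2) + ∫ ξ, ∫ t, ‖β ξ t‖ ^ 2) / 2 := by
        rw [integral_div, integral_const_mul, integral_add ia ib]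
    _ ≤ _ := by
        have := ha.integral_heatTransform_sq_le hη.le
        have := hb.integral_heatTransform_sq_le hη.le
        gcongr

end BoxFun

/-- The Hilbert–Schmidt bound: testing a square integrable kernel on an orthonormal family. -/
theorem norm_sum_integral_kernel_le {α : Type*} [MeasurableSpace α] {μ : Measure α} [SFinite μ]
    {ι : Type*} [Fintype ι] [DecidableEq ι] {φ : ι → α → ℂ} (hφ : ∀ i, MemLp (φ i) 2 μ)
    (ho : ∀ i j, ∫ x, conj (φ i x) * φ j x ∂μ = if i = j then 1 else 0) (ν : ι → ℂ)
    {H : α × α → ℂ} (hH : MemLp H 2 (μ.prod μ)) :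
    ‖∑ i, ν i * ∫ p, conj (φ i p.1) * H p * φ i p.2 ∂μ.prod μ‖ ≤
      Real.sqrt (∑ i, ‖ν i‖ ^ 2) * Real.sqrt (∫ p, ‖H p‖ ^ 2 ∂μ.prod μ) := by
  -- The rank-one kernels φ_i ⊗ conj φ_i are orthonormal in `L²` of the product, so the bound is
  -- Cauchy–Schwarz between Σ conj(ν_i) Ψ_i and `H`.
  set Ψ : ι → α × α → ℂ := fun i p => φ i p.1 * conj (φ i p.2) with hΨ
  have hΨm : ∀ i, MemLp (Ψ i) 2 (μ.prod μ) := fun i => by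
    have hm : AEStronglyMeasurable (Ψ i) (μ.prod μ) :=
      (hφ i).1.comp_fst.mul (Complex.continuous_conj.comp_aestronglyMeasurable (hφ i).1.comp_snd)
    refine (memLp_two_iff_integrable_sq_norm hm).2 ?_
    have := (memLp_two_iff_integrable_sq_norm (hφ i).1).1 (hφ i)
    refine (this.mul_prod this).congr (.of_forall fun p => ?_)
    simp only [hΨ, norm_mul, RCLike.norm_conj, mul_pow]
  have hinner : ∀ i j, ⟪(hΨm i).toLp, (hΨm j).toLp⟫_ℂ = if i = j then (1 : ℂ) else 0 := by
    intro i j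
    rw [L2.inner_def]
    have : ∫ p, conj (Ψ i p) * Ψ j p ∂μ.prod μ =
        (∫ x, conj (φ i x) * φ j x ∂μ) * ∫ y, conj (φ j y) * φ i y ∂μ := by
      rw [← integral_prod_mul]
      refine integral_congr_ae (.of_forall fun p => ?_)
      simp only [hΨ, map_mul, Complex.conj_conj]
      ring
    rw [ho, ho] at this
    refine (integral_congr_ae ?_).trans (this.trans ?_)
    · filter_upwards [(hΨm i).coeFn_toLp, (hΨm j).coeFn_toLp] with p h1 h2
      rw [h1, h2, RCLike.inner_apply, mul_comm]
    · by_cases h : i = j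
      · simp [h]
      · simp [h]
  have horth : Orthonormal ℂ fun i => (hΨm i).toLp := by
    rw [orthonormal_iff_ite]; exact hinner
  have e : ∑ i, ν i * ∫ p, conj (φ i p.1) * H p * φ i p.2 ∂μ.prod μ =
      ⟪∑ i, conj (ν i) • (hΨm i).toLp, hH.toLp⟫_ℂ := by
    rw [sum_inner]
    refine Finset.sum_congr rfl fun i _ => ?_
    rw [inner_smul_left, Complex.conj_conj, L2.inner_def]
    congr 1
    refine integral_congr_ae ?_
    filter_upwards [(hΨm i).coeFn_toLp, hH.coeFn_toLp] with p h1 h2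
    rw [h1, h2, RCLike.inner_apply]
    simp only [hΨ, map_mul, Complex.conj_conj]
    ring
  rw [e]
  refine (norm_inner_le_norm _ _).trans (le_of_eq ?_)
  congr 1
  · have := horth.inner_sum (fun i => conj (ν i)) (fun i => conj (ν i)) Finset.univ
    rw [norm_eq_sqrt_re_inner (𝕜 := ℂ), this]
    congr 1
    simp only [Complex.conj_conj, Complex.mul_conj', map_sum]
    refine Finset.sum_congr rfl fun i _ => ?_
    rw [← Complex.ofReal_pow]; rfl
  · rw [norm_eq_sqrt_re_inner (𝕜 := ℂ), L2.inner_def]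
    congr 1
    rw [← integral_re (L2.integrable_inner _ _)]
    refine integral_congr_ae ?_
    filter_upwards [hH.coeFn_toLp] with p h1
    rw [h1, RCLike.inner_apply, Complex.mul_conj', ← Complex.ofReal_pow]; rfl

end

/-! ### The analytic family and its bounds on the two boundary lines -/

section

/-- A real kernel dominating `powKernel` for a range of exponents. -/
noncomputable def domKernel (ε a₁ a₂ : ℝ) (t : ℝ) : ℝ :=
  (Set.Ioi (0 : ℝ)).indicator (fun t => t ^ a₁ * Real.exp (-(ε * t)) + t ^ a₂ * Real.exp (-(ε * t))) t

theorem measurable_domKernel (ε a₁ a₂ : ℝ) : Measurable (domKernel ε a₁ a₂) := by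
  unfold domKernel
  exact Measurable.indicator (by fun_prop) measurableSet_Ioi

theorem domKernel_nonneg (ε a₁ a₂ t : ℝ) : 0 ≤ domKernel ε a₁ a₂ t := by
  refine Set.indicator_nonneg (fun t ht => ?_) t
  have : 0 < t := ht
  positivity

theorem integrable_domKernel {ε a₁ a₂ : ℝ} (hε : 0 < ε) (h₁ : -1 < a₁) (h₂ : -1 < a₂) :
    Integrable (domKernel ε a₁ a₂) :=
  (integrable_indicator_iff measurableSet_Ioi).2
    ((integrableOn_rpow_mul_exp_neg h₁ hε).add (integrableOn_rpow_mul_exp_neg h₂ hε))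

theorem norm_powKernel_le_domKernel {ε a₁ a₂ : ℝ} {z : ℂ} (h₁ : a₁ ≤ z.re) (h₂ : z.re ≤ a₂)
    (t : ℝ) : ‖powKernel ε z t‖ ≤ ‖z + 1‖ * domKernel ε a₁ a₂ t := by
  by_cases ht : 0 < t
  · rw [norm_powKernel_of_pos ht, domKernel, Set.indicator_of_mem (Set.mem_Ioi.2 ht), ← add_mul]
    gcongr
    have p1 := Real.rpow_pos_of_pos ht a₁
    have p2 := Real.rpow_pos_of_pos ht a₂
    rcases le_total t 1 with h | h
    · have := Real.rpow_le_rpow_of_exponent_ge ht h h₁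
      linarith
    · have := Real.rpow_le_rpow_of_exponent_le h h₂
      linarith
  · rw [powKernel_of_nonpos (not_lt.1 ht), norm_zero]
    exact mul_nonneg (norm_nonneg _) (domKernel_nonneg _ _ _ _)

/-- Since log t ≤ t - 1. This is why the damping rate is taken equal to the shift δ of the exponent:
the surplus t^δ is absorbed with constant 1. -/
theorem rpow_mul_exp_neg_le_one {δ t : ℝ} (hδ : 0 ≤ δ) (ht : 0 < t) :
    t ^ δ * Real.exp (-(δ * t)) ≤ 1 := by
  rw [Real.rpow_def_of_pos ht, ← Real.exp_add, Real.exp_le_one_iff]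
  nlinarith [Real.log_le_sub_one_of_pos ht]

variable {d : ℕ}

/-- The analytic family of quadratic forms used in Stein interpolation. -/
noncomputable def steinForm (η δ κ : ℝ) (w : ℝ × RSpace d → ℝ) (φ : ℝ × RSpace d → ℂ) (z : ℂ) : ℂ :=
  ∫ p : (ℝ × RSpace d) × (ℝ × RSpace d), conj (φ p.1) *
    (Complex.exp (z * κ * (w p.1 + w p.2)) * powKernel δ (-1 + δ + κ * z) (p.1.1 - p.2.1) *
      gaussKernel (2 * η) (p.1 - p.2)) * φ p.2

section

variable {R c m η δ κ : ℝ} {φ : ℝ × RSpace d → ℂ} {w : ℝ × RSpace d → ℝ}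

theorem aestronglyMeasurable_steinForm_integrand (hφ : BoxFun R c φ) (hw : Measurable w) (z : ℂ) :
    AEStronglyMeasurable (fun p : (ℝ × RSpace d) × (ℝ × RSpace d) => conj (φ p.1) *
    (Complex.exp (z * κ * (w p.1 + w p.2)) * powKernel δ (-1 + δ + κ * z) (p.1.1 - p.2.1) *
      gaussKernel (2 * η) (p.1 - p.2)) * φ p.2) := by
  have h1 : Measurable fun p : (ℝ × RSpace d) × (ℝ × RSpace d) => conj (φ p.1) :=
    hφ.star.measurable.comp measurable_fst
  have h2 : Measurable fun p : (ℝ × RSpace d) × (ℝ × RSpace d) => φ p.2 :=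
    hφ.measurable.comp measurable_snd
  have h3 : Measurable fun p : (ℝ × RSpace d) × (ℝ × RSpace d) =>
      powKernel δ (-1 + δ + κ * z) (p.1.1 - p.2.1) :=
    (measurable_powKernel _ _).comp (by fun_prop)
  have h4 : Measurable fun p : (ℝ × RSpace d) × (ℝ × RSpace d) =>
      gaussKernel (2 * η) (p.1 - p.2) :=
    (stronglyMeasurable_gaussKernel _).measurable.comp (by fun_prop)
  have h5 : Measurable fun p : (ℝ × RSpace d) × (ℝ × RSpace d) =>
      Complex.exp (z * κ * (w p.1 + w p.2)) := by fun_prop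
  exact ((h1.mul ((h5.mul h3).mul h4)).mul h2).aestronglyMeasurable

theorem norm_steinForm_integrand_le (hwm : ∀ X, |w X| ≤ m) {G : ℝ}
    (hG : ∀ X : ℝ × RSpace d, ‖gaussKernel (2 * η) X‖ ≤ G) (hκ : 0 ≤ κ) {z : ℂ} (hz : |z.re| ≤ 2)
    {a₁ a₂ : ℝ} (h₁ : a₁ ≤ -1 + δ + κ * z.re) (h₂ : -1 + δ + κ * z.re ≤ a₂)
    (p : (ℝ × RSpace d) × (ℝ × RSpace d)) :
    ‖conj (φ p.1) *
    (Complex.exp (z * κ * (w p.1 + w p.2)) * powKernel δ (-1 + δ + κ * z) (p.1.1 - p.2.1) *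
      gaussKernel (2 * η) (p.1 - p.2)) * φ p.2‖ ≤
    ‖(δ : ℂ) + κ * z‖ * (Real.exp (4 * κ * m) * G) *
      ‖conj (φ p.1) * (((domKernel δ a₁ a₂ (p.1.1 - p.2.1) : ℝ) : ℂ) * φ p.2)‖ := by
  have e1 : ‖Complex.exp (z * κ * (w p.1 + w p.2))‖ ≤ Real.exp (4 * κ * m) := by
    rw [Complex.norm_exp, Real.exp_le_exp, ← Complex.ofReal_add, Complex.re_mul_ofReal,
      Complex.re_mul_ofReal]
    have h3 : |w p.1 + w p.2| ≤ 2 * m := (abs_add_le _ _).trans (by linarith [hwm p.1, hwm p.2])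
    calc z.re * κ * (w p.1 + w p.2) ≤ |z.re * κ * (w p.1 + w p.2)| := le_abs_self _
      _ = |z.re| * κ * |w p.1 + w p.2| := by rw [abs_mul, abs_mul, abs_of_nonneg hκ]
      _ ≤ 2 * κ * (2 * m) := by gcongr
      _ = 4 * κ * m := by ring
  have e2 : ‖powKernel δ (-1 + δ + κ * z) (p.1.1 - p.2.1)‖ ≤
      ‖(δ : ℂ) + κ * z‖ * domKernel δ a₁ a₂ (p.1.1 - p.2.1) := by
    have := norm_powKernel_le_domKernel (ε := δ) (z := -1 + δ + κ * z) (a₁ := a₁) (a₂ := a₂)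
      (by simpa using h₁) (by simpa using h₂) (p.1.1 - p.2.1)
    rwa [show (-1 : ℂ) + δ + κ * z + 1 = δ + κ * z by ring] at this
  have e3 := hG (p.1 - p.2)
  simp only [norm_mul, Complex.norm_real, Real.norm_of_nonneg (domKernel_nonneg _ _ _ _)]
  have hd := domKernel_nonneg δ a₁ a₂ (p.1.1 - p.2.1)
  calc _ ≤ ‖conj (φ p.1)‖ * (Real.exp (4 * κ * m) *
        (‖(δ : ℂ) + κ * z‖ * domKernel δ a₁ a₂ (p.1.1 - p.2.1)) * G) * ‖φ p.2‖ := by gcongr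
    _ = _ := by ring

theorem integrable_steinForm_dom (hφ : BoxFun R c φ) (hδ : 0 < δ) {a₁ a₂ : ℝ} (h₁ : -1 < a₁)
    (h₂ : -1 < a₂) : Integrable fun p : (ℝ × RSpace d) × (ℝ × RSpace d) =>
      conj (φ p.1) * (((domKernel δ a₁ a₂ (p.1.1 - p.2.1) : ℝ) : ℂ) * φ p.2) :=
  hφ.star.integrable_mul_kernel_mul hφ (k := fun t => ((domKernel δ a₁ a₂ t : ℝ) : ℂ))
    (integrable_domKernel hδ h₁ h₂).ofReal
    (Complex.measurable_ofReal.comp (measurable_domKernel _ _ _))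

/-- The condition `-δ < κ * z.re` says that the exponent of the time kernel has real part above -1,
so that the kernel is integrable at 0. Because δ > 0, the domain contains the closed strip 0 ≤ Re z
≤ 1. -/
theorem differentiableOn_steinForm (hφ : BoxFun R c φ) (hw : Measurable w)
    (hwm : ∀ X, |w X| ≤ m) (hη : 0 < η) (hδ : 0 < δ) (hκ : 0 < κ) :
    DifferentiableOn ℂ (steinForm η δ κ w φ) {z | -δ < κ * z.re ∧ |z.re| < 2} := by
  intro z₀ hz₀
  obtain ⟨G, hG⟩ := exists_norm_gaussKernel_le (d := d) (show 0 < 2 * η by positivity)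
  set b : ℝ := (-δ + κ * z₀.re) / 2 with hb
  have hb1 : -δ < b := by have := hz₀.1; linarith
  have hb2 : b < κ * z₀.re := by have := hz₀.1; linarith
  -- The margin `b` keeps the exponent away from -1, and the ball bounds the factor δ + κz; both are
  -- needed for one dominating function.
  set U : Set ℂ := ({z | b < κ * z.re} ∩ {z | |z.re| < 2}) ∩ Metric.ball 0 (‖z₀‖ + 1) with hU
  have hUo : IsOpen U :=
    ((isOpen_lt continuous_const (by fun_prop)).inter (isOpen_lt (by fun_prop)
      continuous_const)).inter Metric.isOpen_ball
  have hz₀U : z₀ ∈ U := ⟨⟨hb2, hz₀.2⟩, by simp⟩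
  have hG0 : 0 ≤ G := (norm_nonneg _).trans (hG 0)
  refine ((differentiableOn_integral_of_dominated hUo
    (f := fun z (p : (ℝ × RSpace d) × (ℝ × RSpace d)) => conj (φ p.1) *
    (Complex.exp (z * κ * (w p.1 + w p.2)) * powKernel δ (-1 + δ + κ * z) (p.1.1 - p.2.1) *
      gaussKernel (2 * η) (p.1 - p.2)) * φ p.2)
    (bound := fun p => (δ + κ * (‖z₀‖ + 1)) * (Real.exp (4 * κ * m) * G) *
      ‖conj (φ p.1) * (((domKernel δ (-1 + δ + b) (-1 + δ + κ * 2) (p.1.1 - p.2.1) : ℝ) : ℂ) *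
        φ p.2)‖)
    (fun z _ => aestronglyMeasurable_steinForm_integrand hφ hw z) ?_ ?_
    ?_).differentiableAt (hUo.mem_nhds hz₀U)).differentiableWithinAt
  · refine .of_forall fun p => DifferentiableOn.mul_const (DifferentiableOn.const_mul ?_ _) _
    refine DifferentiableOn.mul_const (DifferentiableOn.mul (by fun_prop) ?_) _
    by_cases ht : 0 < p.1.1 - p.2.1
    · simp only [powKernel_of_pos ht]
      refine DifferentiableOn.mul (by fun_prop) (DifferentiableOn.mul_const ?_ _)
      intro z _
      refine (DifferentiableAt.const_cpow (by fun_prop) (Or.inl ?_)).differentiableWithinAt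
      exact_mod_cast ht.ne'
    · simp only [powKernel_of_nonpos (not_lt.1 ht)]
      exact differentiableOn_const _
  · refine .of_forall fun p z hz => ?_
    have hz2 := abs_lt.1 (show |z.re| < 2 from hz.1.2)
    refine (norm_steinForm_integrand_le hwm hG hκ.le hz.1.2.le
      (show -1 + δ + b ≤ _ by have := hz.1.1; simp only [Set.mem_ofPred_eq] at this; linarith)
      (show _ ≤ -1 + δ + κ * 2 by gcongr; linarith) p).trans ?_
    gcongr
    refine (norm_add_le _ _).trans ?_
    rw [Complex.norm_real, Real.norm_of_nonneg hδ.le, norm_mul, Complex.norm_real,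
      Real.norm_of_nonneg hκ.le]
    have := mem_ball_zero_iff.1 hz.2
    gcongr
  · exact (integrable_steinForm_dom hφ hδ (by linarith) (by linarith)).norm.const_mul _

/-- A qualitative bound, not uniform in δ or in the weight. It only supplies the a priori
boundedness that the three lines theorem asks for. -/
theorem exists_norm_steinForm_le (hφ : BoxFun R c φ)
    (hwm : ∀ X, |w X| ≤ m) (hη : 0 < η) (hδ : 0 < δ) (hκ : 0 < κ) :
    ∃ B, 0 ≤ B ∧ ∀ z : ℂ, 0 ≤ z.re → z.re ≤ 1 → ‖steinForm η δ κ w φ z‖ ≤ B * ‖(δ : ℂ) + κ * z‖ := by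
  obtain ⟨G, hG⟩ := exists_norm_gaussKernel_le (d := d) (show 0 < 2 * η by positivity)
  have hG0 : 0 ≤ G := (norm_nonneg _).trans (hG 0)
  have hI := (integrable_steinForm_dom hφ hδ (a₁ := -1 + δ) (a₂ := -1 + δ + κ)
    (by linarith) (by linarith)).norm
  refine ⟨Real.exp (4 * κ * m) * G * ∫ p : (ℝ × RSpace d) × (ℝ × RSpace d), ‖conj (φ p.1) *
    (((domKernel δ (-1 + δ) (-1 + δ + κ) (p.1.1 - p.2.1) : ℝ) : ℂ) * φ p.2)‖,
    mul_nonneg (by positivity) (integral_nonneg fun _ => norm_nonneg _), fun z h0 h1 => ?_⟩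
  refine (norm_integral_le_of_norm_le
    (hI.const_mul (‖(δ : ℂ) + κ * z‖ * (Real.exp (4 * κ * m) * G))) (.of_forall fun p => ?_)).trans ?_
  · exact norm_steinForm_integrand_le hwm hG hκ.le (by rw [abs_le]; constructor <;> linarith)
      (by nlinarith) (by nlinarith) p
  · rw [integral_const_mul, mul_assoc, mul_comm]

/-- The operator bound on the line `Re z = 0`. -/
theorem norm_steinForm_left_le (hφ : BoxFun R c φ) (hw : Measurable w) (h1 : ∫ X, ‖φ X‖ ^ 2 = 1)
    (hη : 0 < η) (hδ : 0 < δ) (hδ1 : δ ≤ 1) {z : ℂ} (hz : z.re = 0) :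
    ‖steinForm η δ κ w φ z‖ ≤ 2 * δ ^ (-δ) * Real.exp (Real.pi / 2 * |κ * z.im|) := by
  have hz' : z = z.im * Complex.I := by
    conv_lhs => rw [← Complex.re_add_im z, hz]
    simp
  -- For imaginary `z` the weights are unimodular, so they can be moved into the test functions
  -- without changing their `L²` norm.
  have hb : BoxFun R (c * 1) fun X => φ X * Complex.exp (z * κ * w X) := by
    refine hφ.mul_bounded (by fun_prop) fun X => ?_
    rw [Complex.norm_exp, Complex.re_mul_ofReal, Complex.re_mul_ofReal, hz]
    simp
  have ha : BoxFun R (c * 1) fun X => φ X * conj (Complex.exp (z * κ * w X)) := by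
    refine hφ.mul_bounded (g := fun X => conj (Complex.exp (z * κ * w X)))
      (Complex.continuous_conj.measurable.comp (by fun_prop)) fun X => ?_
    rw [RCLike.norm_conj, Complex.norm_exp, Complex.re_mul_ofReal, Complex.re_mul_ofReal, hz]
    simp
  have hn : ∀ X, ‖Complex.exp (z * κ * w X)‖ = 1 := fun X => by
    rw [Complex.norm_exp, Complex.re_mul_ofReal, Complex.re_mul_ofReal, hz]
    simp
  have hζ : (-1 : ℂ) + δ + κ * z = -1 + δ + ((κ * z.im : ℝ) : ℂ) * Complex.I := by
    conv_lhs => rw [hz']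
    push_cast; ring
  have hk : Integrable (powKernel δ (-1 + δ + κ * z)) :=
    integrable_powKernel hδ (by simp [hz, hδ])
  have := ha.norm_kernelForm_le hb hη hk (measurable_powKernel _ _)
    (M := 2 * δ ^ (-δ) * Real.exp (Real.pi / 2 * |κ * z.im|)) fun ω => by
      rw [hζ]; exact norm_fourier_powKernel_le hδ hδ hδ1 _ ω
  simp only [norm_mul, RCLike.norm_conj, hn, mul_one, h1] at this
  refine le_trans (le_of_eq ?_) (this.trans (le_of_eq (by ring)))
  congr 1
  refine integral_congr_ae (.of_forall fun p => ?_)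
  simp only [map_mul, Complex.conj_conj, mul_add, Complex.exp_add]
  ring

/-- The Hilbert–Schmidt bound on the line `Re z = 1`. -/
theorem norm_sum_steinForm_right_le {ι : Type*} [Fintype ι] [DecidableEq ι]
    {φ : ι → ℝ × RSpace d → ℂ} (hφ : ∀ i, BoxFun R c (φ i))
    (ho : ∀ i j, ∫ X, conj (φ i X) * φ j X = if i = j then 1 else 0)
    {S : Set (ℝ × RSpace d)} (hS : MeasurableSet S) (hφS : ∀ i X, φ i X ≠ 0 → X ∈ S)
    (hw : Measurable w) (hSi : IntegrableOn (fun X => Real.exp (2 * κ * w X)) S)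
    (hη : 0 < η) (hδ : 0 < δ) (hκ : κ = (d + 2) / 2) {z : ℂ} (hz : z.re = 1) (ν : ι → ℂ) :
    ‖∑ i, ν i * steinForm η δ κ w (φ i) z‖ ≤
      Real.sqrt (∑ i, ‖ν i‖ ^ 2) * (‖(δ : ℂ) + κ * z‖ * ∫ X in S, Real.exp (2 * κ * w X)) := by
  set g : ℝ × RSpace d → ℝ := S.indicator fun X => Real.exp (2 * κ * w X) with hg
  have hgi : Integrable g := (integrable_indicator_iff hS).2 hSi
  set H : (ℝ × RSpace d) × (ℝ × RSpace d) → ℂ := fun p =>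
    (S.indicator (fun _ => (1 : ℂ)) p.1 * S.indicator (fun _ => (1 : ℂ)) p.2) *
    (Complex.exp (z * κ * (w p.1 + w p.2)) * powKernel δ (-1 + δ + κ * z) (p.1.1 - p.2.1) *
      gaussKernel (2 * η) (p.1 - p.2)) with hH
  have hζ : ((-1 : ℂ) + δ + κ * z).re = d / 2 + δ := by
    simp [hz, hκ]; ring
  have hHm : AEStronglyMeasurable H := by
    have h0 : Measurable (S.indicator (fun _ => (1 : ℂ))) := measurable_const.indicator hS
    have h1 : Measurable fun p : (ℝ × RSpace d) × (ℝ × RSpace d) =>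
      S.indicator (fun _ => (1 : ℂ)) p.1 := h0.comp measurable_fst
    have h2 : Measurable fun p : (ℝ × RSpace d) × (ℝ × RSpace d) =>
      S.indicator (fun _ => (1 : ℂ)) p.2 := h0.comp measurable_snd
    have h3 : Measurable fun p : (ℝ × RSpace d) × (ℝ × RSpace d) =>
        powKernel δ (-1 + δ + κ * z) (p.1.1 - p.2.1) :=
      (measurable_powKernel _ _).comp (by fun_prop)
    have h4 : Measurable fun p : (ℝ × RSpace d) × (ℝ × RSpace d) =>
        gaussKernel (2 * η) (p.1 - p.2) :=
      (stronglyMeasurable_gaussKernel _).measurable.comp (by fun_prop)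
    have h5 : Measurable fun p : (ℝ × RSpace d) × (ℝ × RSpace d) =>
        Complex.exp (z * κ * (w p.1 + w p.2)) := by fun_prop
    exact ((h1.mul h2).mul ((h5.mul h3).mul h4)).aestronglyMeasurable
  have hHb : ∀ p, ‖H p‖ ^ 2 ≤ ‖(δ : ℂ) + κ * z‖ ^ 2 * (g p.1 * g p.2) := by
    intro p
    by_cases h1 : p.1 ∈ S
    swap
    · simp [hH, hg, h1]
    by_cases h2 : p.2 ∈ S
    swap
    · simp [hH, hg, h2]
    simp only [hH, hg, Set.indicator_of_mem h1, Set.indicator_of_mem h2, one_mul]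
    -- The time kernel has size t^{d/2 + δ} e^{-δt} and the dispersive bound is t^{-d/2}; this
    -- cancellation is what fixes κ = (d + 2) / 2.
    have e0 : ‖powKernel δ (-1 + δ + κ * z) (p.1.1 - p.2.1) * gaussKernel (2 * η) (p.1 - p.2)‖ ≤
        ‖(δ : ℂ) + κ * z‖ := by
      by_cases ht : 0 < p.1.1 - p.2.1
      · rw [norm_mul, norm_powKernel_of_pos ht, hζ,
          show (-1 : ℂ) + δ + κ * z + 1 = δ + κ * z by ring]
        have hk := norm_gaussKernel_le (show 0 < 2 * η by positivity) (X := p.1 - p.2) ht.ne'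
        rw [Prod.fst_sub, abs_of_pos ht] at hk
        calc _ ≤ ‖(δ : ℂ) + κ * z‖ * ((p.1.1 - p.2.1) ^ ((d : ℝ) / 2 + δ) *
              Real.exp (-(δ * (p.1.1 - p.2.1)))) * (p.1.1 - p.2.1) ^ (-(d : ℝ) / 2) := by gcongr
          _ = ‖(δ : ℂ) + κ * z‖ * ((p.1.1 - p.2.1) ^ δ * Real.exp (-(δ * (p.1.1 - p.2.1)))) := by
              rw [Real.rpow_add ht, neg_div, Real.rpow_neg ht.le]
              have := (Real.rpow_pos_of_pos ht ((d : ℝ) / 2)).ne'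
              field_simp
          _ ≤ ‖(δ : ℂ) + κ * z‖ * 1 := by
              gcongr
              exact rpow_mul_exp_neg_le_one hδ.le ht
          _ = _ := mul_one _
      · rw [powKernel_of_nonpos (not_lt.1 ht)]
        simp
    have e1 : ‖Complex.exp (z * κ * (w p.1 + w p.2))‖ ^ 2 =
        Real.exp (2 * κ * w p.1) * Real.exp (2 * κ * w p.2) := by
      rw [Complex.norm_exp, ← Complex.ofReal_add, Complex.re_mul_ofReal, Complex.re_mul_ofReal, hz,
        ← Real.exp_add, ← Real.exp_nat_mul]
      congr 1
      push_cast; ring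
    rw [mul_assoc, norm_mul, mul_pow, e1, mul_comm]
    gcongr
  have hgg : Integrable (fun p : (ℝ × RSpace d) × (ℝ × RSpace d) =>
      ‖(δ : ℂ) + κ * z‖ ^ 2 * (g p.1 * g p.2)) := (hgi.mul_prod hgi).const_mul _
  have hH2 : MemLp H 2 (volume.prod volume) := by
    refine (memLp_two_iff_integrable_sq_norm hHm).2 (hgg.mono' (hHm.norm.pow 2) ?_)
    exact .of_forall fun p => by rw [Real.norm_of_nonneg (by positivity)]; exact hHb p
  have key := norm_sum_integral_kernel_le (fun i => (hφ i).memLp_two) ho ν hH2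
  refine le_trans (le_of_eq ?_) (key.trans ?_)
  · congr 1
    refine Finset.sum_congr rfl fun i _ => ?_
    congr 1
    refine integral_congr_ae (.of_forall fun p => ?_)
    simp only [hH]
    by_cases h1 : φ i p.1 = 0
    · simp [h1]
    by_cases h2 : φ i p.2 = 0
    · simp [h2]
    simp [Set.indicator_of_mem (hφS i _ h1), Set.indicator_of_mem (hφS i _ h2)]
  · refine mul_le_mul_of_nonneg_left ?_ (Real.sqrt_nonneg _)
    have hgS : ∫ X in S, Real.exp (2 * κ * w X) = ∫ X, g X := (integral_indicator hS).symm
    have hg0 : 0 ≤ ∫ X, g X := integral_nonneg fun X =>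
      Set.indicator_nonneg (fun _ _ => (Real.exp_pos _).le) _
    rw [hgS]
    refine Real.sqrt_le_iff.2 ⟨by positivity, ?_⟩
    calc _ ≤ ∫ p : (ℝ × RSpace d) × (ℝ × RSpace d), ‖(δ : ℂ) + κ * z‖ ^ 2 * (g p.1 * g p.2) :=
          integral_mono_of_nonneg (.of_forall fun _ => by positivity) hgg (.of_forall hHb)
      _ = ‖(δ : ℂ) + κ * z‖ ^ 2 * ((∫ X, g X) * ∫ X, g X) := by
          rw [integral_const_mul]; congr 1; exact integral_prod_mul g g
      _ = _ := by ring

end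

end

/-! ### Three lines interpolation and removal of the time damping -/

section

variable {d : ℕ}

/-- The quadratic form with the retarded kernel `1_{t > s} e^{2ηΔ} e^{i(t - s)Δ}`. -/
noncomputable def retardedForm (η : ℝ) (w : ℝ × RSpace d → ℝ) (φ : ℝ × RSpace d → ℂ) : ℂ :=
  ∫ p : (ℝ × RSpace d) × (ℝ × RSpace d), conj (φ p.1) *
    (Complex.exp (w p.1 + w p.2) * (if 0 < p.1.1 - p.2.1 then 1 else 0) *
      gaussKernel (2 * η) (p.1 - p.2)) * φ p.2

section

variable {R c m η δ κ : ℝ} {w : ℝ × RSpace d → ℝ}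

theorem norm_add_mul_le_one_add (hδ : 0 < δ) (hδ1 : δ ≤ 1) (hκ : 0 < κ) {z : ℂ} (h0 : 0 ≤ z.re)
    (h1 : z.re ≤ 1) : ‖(δ : ℂ) + κ * z‖ ≤ (1 + κ) * (1 + |z.im|) := by
  have hz : ‖z‖ ≤ 1 + |z.im| := (Complex.norm_le_abs_re_add_abs_im z).trans (by
    rw [abs_of_nonneg h0]; linarith)
  calc _ ≤ δ + κ * ‖z‖ := by
        refine (norm_add_le _ _).trans ?_
        rw [Complex.norm_real, Real.norm_of_nonneg hδ.le, norm_mul, Complex.norm_real,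
          Real.norm_of_nonneg hκ.le]
    _ ≤ 1 + κ * (1 + |z.im|) := by gcongr
    _ ≤ _ := by nlinarith [abs_nonneg z.im]

/-- The Gaussian decay of e^{z²} along vertical lines absorbs the linear growth of δ + κz, uniformly
in δ. -/
theorem norm_cexp_sq_mul_le (hδ : 0 < δ) (hδ1 : δ ≤ 1) (hκ : 0 < κ) {z : ℂ} (h0 : 0 ≤ z.re)
    (h1 : z.re ≤ 1) : ‖Complex.exp (z ^ 2)‖ * ‖(δ : ℂ) + κ * z‖ ≤ (1 + κ) * Real.exp 2 := by
  have e1 : ‖Complex.exp (z ^ 2)‖ ≤ Real.exp (1 - z.im ^ 2) := by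
    rw [Complex.norm_exp, Real.exp_le_exp, sq, Complex.mul_re]
    nlinarith
  have e2 : 1 + |z.im| ≤ Real.exp |z.im| := by linarith [Real.add_one_le_exp |z.im|]
  calc _ ≤ Real.exp (1 - z.im ^ 2) * ((1 + κ) * Real.exp |z.im|) := by
        refine mul_le_mul e1 ((norm_add_mul_le_one_add hδ hδ1 hκ h0 h1).trans ?_) (norm_nonneg _)
          (Real.exp_pos _).le
        gcongr
    _ = (1 + κ) * Real.exp (1 - z.im ^ 2 + |z.im|) := by rw [Real.exp_add]; ring
    _ ≤ _ := by
        gcongr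
        nlinarith [sq_abs z.im, sq_nonneg (|z.im| - 1 / 2)]

variable {ι : Type*} [Fintype ι] [DecidableEq ι] {φ : ι → ℝ × RSpace d → ℂ}

/-- Stein interpolation in dual form. The exponent α is conjugate to 2κ, and the coefficients are
deformed to μ_i^{α(1 - z/2)}: their moduli are μ_i^α on Re z = 0, paired with the operator bound,
and have squares μ_i^α on Re z = 1, paired with the Hilbert–Schmidt bound. -/
theorem norm_sum_steinForm_le (hφ : ∀ i, BoxFun R c (φ i))
    (ho : ∀ i j, ∫ X, conj (φ i X) * φ j X = if i = j then 1 else 0)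
    {S : Set (ℝ × RSpace d)} (hS : MeasurableSet S) (hφS : ∀ i X, φ i X ≠ 0 → X ∈ S)
    (hw : Measurable w) (hwm : ∀ X, |w X| ≤ m)
    (hSi : IntegrableOn (fun X => Real.exp (2 * κ * w X)) S)
    (hη : 0 < η) (hδ : 0 < δ) (hδ1 : δ ≤ 1) (hκ : κ = (d + 2) / 2) {μ : ι → ℝ} (hμ : ∀ i, 0 < μ i)
    {α : ℝ} (hα : α = (d + 2) / (d + 1)) :
    ‖∑ i, μ i * steinForm η δ κ w (φ i) (1 / κ : ℝ)‖ ≤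
      ((∑ i, μ i ^ α) * (2 * δ ^ (-δ) * Real.exp ((Real.pi * κ / 4) ^ 2))) ^ (1 - 1 / κ) *
      (Real.sqrt (∑ i, μ i ^ α) *
        ((1 + κ) * Real.exp 2 * ∫ X in S, Real.exp (2 * κ * w X))) ^ (1 / κ) := by
  have hd0 : (0 : ℝ) ≤ d := Nat.cast_nonneg d
  have hκ1 : 1 ≤ κ := by rw [hκ]; linarith
  have hκ0 : 0 < κ := by linarith
  have hα0 : 0 < α := by rw [hα]; positivity
  set ν : ι → ℂ → ℂ := fun i z => Complex.exp (α * (1 - z / 2) * Real.log (μ i)) with hν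
  have hνn : ∀ i z, ‖ν i z‖ = Real.exp (α * (1 - z.re / 2) * Real.log (μ i)) := by
    intro i z
    rw [hν]
    simp only [Complex.norm_exp, Complex.re_mul_ofReal, Complex.re_ofReal_mul]
    congr 3
    simp
  -- The factor e^{z²} compensates the growth e^{πκ|Im z|/2} on the left line and |δ + κz| on the
  -- right line.
  set F : ℂ → ℂ := fun z => Complex.exp (z ^ 2) * ∑ i, ν i z * steinForm η δ κ w (φ i) z with hF
  set I := ∫ X in S, Real.exp (2 * κ * w X) with hI
  have hI0 : 0 ≤ I := integral_nonneg fun _ => (Real.exp_pos _).le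
  choose B hB0 hB using fun i => exists_norm_steinForm_le (hφ i) hwm hη hδ hκ0
  have hθ : ((1 / κ : ℝ) : ℂ).re = 1 / κ := Complex.ofReal_re _
  have hθ0 : 0 < 1 / κ := by positivity
  have hθ1 : 1 / κ ≤ 1 := by rw [div_le_one hκ0]; exact hκ1
  have hdiff : DiffContOnCl ℂ F (Complex.HadamardThreeLines.verticalStrip 0 1) := by
    have : DifferentiableOn ℂ F {z | -δ < κ * z.re ∧ |z.re| < 2} := by
      refine DifferentiableOn.mul (by fun_prop) (DifferentiableOn.fun_sum fun i _ => ?_)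
      exact DifferentiableOn.mul (by fun_prop) (differentiableOn_steinForm (hφ i) hw hwm hη hδ hκ0)
    refine DifferentiableOn.diffContOnCl (this.mono fun z hz => ?_)
    have hz' : z ∈ Complex.re ⁻¹' Set.Icc 0 1 :=
      closure_minimal (Set.preimage_mono Set.Ioo_subset_Icc_self)
        (isClosed_Icc.preimage Complex.continuous_re) hz
    have h0 : 0 ≤ z.re := hz'.1
    have h1 : z.re ≤ 1 := hz'.2
    refine ⟨by nlinarith, ?_⟩
    rw [abs_of_nonneg h0]; linarith
  have hbdd : BddAbove ((norm ∘ F) '' Complex.HadamardThreeLines.verticalClosedStrip 0 1) := by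
    refine ⟨∑ i, Real.exp (α * |Real.log (μ i)|) * (B i * ((1 + κ) * Real.exp 2)), ?_⟩
    rintro _ ⟨z, hz, rfl⟩
    have h0 : 0 ≤ z.re := hz.1
    have h1 : z.re ≤ 1 := hz.2
    simp only [Function.comp, hF]
    rw [norm_mul]
    refine (mul_le_mul_of_nonneg_left (norm_sum_le _ _) (norm_nonneg _)).trans ?_
    rw [Finset.mul_sum]
    refine Finset.sum_le_sum fun i _ => ?_
    rw [norm_mul, mul_left_comm]
    refine mul_le_mul ?_ ?_ (by positivity) (Real.exp_pos _).le
    · rw [hνn, Real.exp_le_exp, mul_assoc]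
      refine mul_le_mul_of_nonneg_left ((le_abs_self _).trans ?_) hα0.le
      rw [abs_mul, abs_of_nonneg (by linarith)]
      exact mul_le_of_le_one_left (abs_nonneg _) (by linarith)
    · calc _ ≤ ‖Complex.exp (z ^ 2)‖ * (B i * ‖(δ : ℂ) + κ * z‖) := by
            gcongr; exact hB i z h0 h1
        _ = B i * (‖Complex.exp (z ^ 2)‖ * ‖(δ : ℂ) + κ * z‖) := by ring
        _ ≤ _ := mul_le_mul_of_nonneg_left (norm_cexp_sq_mul_le hδ hδ1 hκ0 h0 h1) (hB0 i)
  have hleft : ∀ z ∈ Complex.re ⁻¹' {0}, ‖F z‖ ≤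
      (∑ i, μ i ^ α) * (2 * δ ^ (-δ) * Real.exp ((Real.pi * κ / 4) ^ 2)) := by
    intro z hz
    have hz0 : z.re = 0 := hz
    simp only [hF]
    rw [norm_mul]
    refine (mul_le_mul_of_nonneg_left (norm_sum_le _ _) (norm_nonneg _)).trans ?_
    rw [Finset.mul_sum, Finset.sum_mul]
    refine Finset.sum_le_sum fun i _ => ?_
    have e1 : ‖ν i z‖ = μ i ^ α := by
      rw [hνn, hz0, Real.rpow_def_of_pos (hμ i)]; ring_nf
    have h1 : ∫ X, ‖φ i X‖ ^ 2 = 1 := by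
      have := ho i i
      simp only [Complex.conj_mul', if_true] at this
      exact_mod_cast this
    have e2 := norm_steinForm_left_le (κ := κ) (hφ i) hw h1 hη hδ hδ1 hz0
    have e3 : ‖Complex.exp (z ^ 2)‖ = Real.exp (-(z.im ^ 2)) := by
      rw [Complex.norm_exp, sq, Complex.mul_re, hz0]; ring_nf
    rw [norm_mul, e1, e3, mul_left_comm]
    refine mul_le_mul_of_nonneg_left ?_ (Real.rpow_nonneg (hμ i).le _)
    calc _ ≤ Real.exp (-(z.im ^ 2)) * (2 * δ ^ (-δ) * Real.exp (Real.pi / 2 * |κ * z.im|)) := by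
          gcongr
      _ = 2 * δ ^ (-δ) * Real.exp (Real.pi / 2 * |κ * z.im| + -(z.im ^ 2)) := by
          rw [Real.exp_add]; ring
      _ ≤ _ := by
          gcongr
          rw [abs_mul, abs_of_pos hκ0, ← sq_abs z.im]
          -- Completing the square; this is the source of the constant (πκ/4)².
          nlinarith [sq_nonneg (Real.pi * κ / 4 - |z.im|)]
  have hright : ∀ z ∈ Complex.re ⁻¹' {1}, ‖F z‖ ≤
      Real.sqrt (∑ i, μ i ^ α) * ((1 + κ) * Real.exp 2 * I) := by
    intro z hz
    have hz1 : z.re = 1 := hz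
    have e1 : ∑ i, ‖ν i z‖ ^ 2 = ∑ i, μ i ^ α := by
      refine Finset.sum_congr rfl fun i _ => ?_
      rw [hνn, hz1, Real.rpow_def_of_pos (hμ i), ← Real.exp_nat_mul]
      congr 1; push_cast; ring
    have key := norm_sum_steinForm_right_le hφ ho hS hφS hw hSi hη hδ hκ hz1 (fun i => ν i z)
    rw [e1] at key
    have e2 := norm_cexp_sq_mul_le hδ hδ1 hκ0 (z := z) (by rw [hz1]; norm_num) hz1.le
    simp only [hF]
    rw [norm_mul]
    calc _ ≤ ‖Complex.exp (z ^ 2)‖ * (Real.sqrt (∑ i, μ i ^ α) * (‖(δ : ℂ) + κ * z‖ * I)) := by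
          gcongr
      _ = Real.sqrt (∑ i, μ i ^ α) * ((‖Complex.exp (z ^ 2)‖ * ‖(δ : ℂ) + κ * z‖) * I) := by ring
      _ ≤ _ := by gcongr
  have main := Complex.HadamardThreeLines.norm_le_interp_of_mem_verticalClosedStrip₀₁' F
    (z := (1 / κ : ℝ)) ⟨by rw [hθ]; exact hθ0.le, by rw [hθ]; exact hθ1⟩ hdiff hbdd hleft hright
  rw [hθ] at main
  refine le_trans ?_ main
  simp only [hF]
  rw [norm_mul]
  have e1 : 1 ≤ ‖Complex.exp (((1 / κ : ℝ) : ℂ) ^ 2)‖ := by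
    rw [← Complex.ofReal_pow, ← Complex.ofReal_exp, Complex.norm_real,
      Real.norm_of_nonneg (Real.exp_pos _).le]
    exact Real.one_le_exp (by positivity)
  -- At z = 1/κ the exponent α(1 - 1/(2κ)) is 1, so the deformed coefficients take their original
  -- values.
  have e2 : ∀ i, ν i (1 / κ : ℝ) = μ i := by
    intro i
    have : α * (1 - 1 / κ / 2) = 1 := by rw [hα, hκ]; field_simp; ring
    have h3 : (α : ℂ) * (1 - ((1 / κ : ℝ) : ℂ) / 2) = 1 := by
      have h4 := congrArg (fun x : ℝ => (x : ℂ)) this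
      push_cast at h4 ⊢
      exact h4
    simp only [hν, h3, one_mul]
    rw [← Complex.ofReal_exp, Real.exp_log (hμ i)]
  simp only [e2]
  exact le_mul_of_one_le_left (norm_nonneg _) e1

/-- At z = 1/κ the time kernel is (1 + δ) t_+^δ e^{-δt}, which is bounded by 2 and tends to the
indicator of t > 0. -/
theorem tendsto_steinForm {φ : ℝ × RSpace d → ℂ} (hφ : BoxFun R c φ) (hw : Measurable w)
    (hwm : ∀ X, |w X| ≤ m) (hη : 0 < η) (hκ : 0 < κ) :
    Filter.Tendsto (fun n : ℕ => steinForm η (1 / ((n : ℝ) + 1)) κ w φ (1 / κ : ℝ)) Filter.atTop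
      (nhds (retardedForm η w φ)) := by
  obtain ⟨G, hG⟩ := exists_norm_gaussKernel_le (d := d) (show 0 < 2 * η by positivity)
  have hκ' : ((1 / κ : ℝ) : ℂ) * κ = 1 := by
    rw [← Complex.ofReal_mul, one_div_mul_cancel hκ.ne', Complex.ofReal_one]
  have hδ0 : ∀ n : ℕ, 0 < 1 / ((n : ℝ) + 1) := fun n => by positivity
  have hδ1 : ∀ n : ℕ, 1 / ((n : ℝ) + 1) ≤ 1 := fun n => by
    rw [div_le_one (by positivity)]; linarith [(Nat.cast_nonneg n : (0 : ℝ) ≤ n)]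
  have hζ : ∀ δ : ℝ, (-1 : ℂ) + δ + κ * ((1 / κ : ℝ) : ℂ) = δ := fun δ => by
    rw [mul_comm, hκ']; ring
  simp only [steinForm, retardedForm, hκ', one_mul, hζ]
  have hi := (hφ.star.integrable.mul_prod hφ.integrable).norm
  refine tendsto_integral_of_dominated_convergence
    (fun p => Real.exp (2 * m) * 2 * G * ‖conj (φ p.1) * φ p.2‖) (fun n => ?_) (hi.const_mul _)
    (fun n => .of_forall fun p => ?_) (.of_forall fun p => ?_)
  · have := aestronglyMeasurable_steinForm_integrand (η := η) (δ := 1 / ((n : ℝ) + 1)) (κ := κ)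
      hφ hw (1 / κ : ℝ)
    simpa only [hκ', one_mul, hζ] using this
  · have e1 : ‖Complex.exp (w p.1 + w p.2)‖ ≤ Real.exp (2 * m) := by
      rw [← Complex.ofReal_add, ← Complex.ofReal_exp, Complex.norm_real,
        Real.norm_of_nonneg (Real.exp_pos _).le, Real.exp_le_exp]
      linarith [(abs_le.1 (hwm p.1)).2, (abs_le.1 (hwm p.2)).2]
    have e2 : ‖powKernel (1 / ((n : ℝ) + 1)) ((1 / ((n : ℝ) + 1) : ℝ) : ℂ) (p.1.1 - p.2.1)‖ ≤ 2 := by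
      by_cases ht : 0 < p.1.1 - p.2.1
      · rw [norm_powKernel_of_pos ht, Complex.ofReal_re, ← Complex.ofReal_one,
          ← Complex.ofReal_add, Complex.norm_real, Real.norm_of_nonneg (by positivity)]
        calc _ ≤ (1 / ((n : ℝ) + 1) + 1) * 1 := by
              gcongr; exact rpow_mul_exp_neg_le_one (hδ0 n).le ht
          _ ≤ _ := by linarith [hδ1 n]
      · rw [powKernel_of_nonpos (not_lt.1 ht)]; simp
    have e3 := hG (p.1 - p.2)
    rw [norm_mul, norm_mul, norm_mul, norm_mul]
    calc _ ≤ ‖conj (φ p.1)‖ * (Real.exp (2 * m) * 2 * G) * ‖φ p.2‖ := by gcongr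
      _ = _ := by rw [norm_mul]; ring
  · refine Filter.Tendsto.mul_const _ (Filter.Tendsto.const_mul _ (Filter.Tendsto.mul_const _
      (Filter.Tendsto.const_mul _ ?_)))
    by_cases ht : 0 < p.1.1 - p.2.1
    · simp only [powKernel_of_pos ht, if_pos ht]
      have ht0 : ((p.1.1 - p.2.1 : ℝ) : ℂ) ≠ 0 := by exact_mod_cast ht.ne'
      have hc : ContinuousAt (fun δ : ℝ => ((δ : ℂ) + 1) * (((p.1.1 - p.2.1 : ℝ) : ℂ) ^ (δ : ℂ) *
          Complex.exp (-((δ : ℂ) * ((p.1.1 - p.2.1 : ℝ) : ℂ))))) 0 := by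
        refine ContinuousAt.mul (by fun_prop) (ContinuousAt.mul ?_ (by fun_prop))
        exact ContinuousAt.const_cpow (by fun_prop) (Or.inl ht0)
      have := hc.tendsto.comp tendsto_one_div_add_atTop_nhds_zero_nat
      simpa [Function.comp_def] using this
    · simp only [powKernel_of_nonpos (not_lt.1 ht), if_neg ht]
      exact tendsto_const_nhds

theorem norm_sum_retardedForm_le (hφ : ∀ i, BoxFun R c (φ i))
    (ho : ∀ i j, ∫ X, conj (φ i X) * φ j X = if i = j then 1 else 0)
    {S : Set (ℝ × RSpace d)} (hS : MeasurableSet S) (hφS : ∀ i X, φ i X ≠ 0 → X ∈ S)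
    (hw : Measurable w) (hwm : ∀ X, |w X| ≤ m)
    (hSi : IntegrableOn (fun X => Real.exp (2 * κ * w X)) S)
    (hη : 0 < η) (hκ : κ = (d + 2) / 2) {μ : ι → ℝ} (hμ : ∀ i, 0 < μ i)
    {α : ℝ} (hα : α = (d + 2) / (d + 1)) :
    ‖∑ i, μ i * retardedForm η w (φ i)‖ ≤
      ((∑ i, μ i ^ α) * (2 * Real.exp ((Real.pi * κ / 4) ^ 2))) ^ (1 - 1 / κ) *
      (Real.sqrt (∑ i, μ i ^ α) *
        ((1 + κ) * Real.exp 2 * ∫ X in S, Real.exp (2 * κ * w X))) ^ (1 / κ) := by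
  have hd0 : (0 : ℝ) ≤ d := Nat.cast_nonneg d
  have hκ1 : 1 ≤ κ := by rw [hκ]; linarith
  have hκ0 : 0 < κ := by linarith
  have hθ1 : 0 ≤ 1 - 1 / κ := by rw [sub_nonneg, div_le_one hκ0]; exact hκ1
  have hl : Filter.Tendsto (fun n : ℕ => ‖∑ i, μ i *
      steinForm η (1 / ((n : ℝ) + 1)) κ w (φ i) (1 / κ : ℝ)‖) Filter.atTop
      (nhds ‖∑ i, μ i * retardedForm η w (φ i)‖) :=
    (tendsto_finsetSum _ fun i _ => (tendsto_steinForm (hφ i) hw hwm hη hκ0).const_mul _).norm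
  -- The only dependence of the interpolated bound on δ is δ^{-δ}, and δ log δ → 0.
  have hr : Filter.Tendsto (fun n : ℕ => (1 / ((n : ℝ) + 1)) ^ (-(1 / ((n : ℝ) + 1))))
      Filter.atTop (nhds 1) := by
    have h1 := (Real.continuous_mul_log.tendsto 0).comp tendsto_one_div_add_atTop_nhds_zero_nat
    have h2 := (Real.continuous_exp.tendsto _).comp h1.neg
    simp only [zero_mul, neg_zero, Real.exp_zero] at h2
    refine h2.congr fun n => ?_
    rw [Real.rpow_def_of_pos (by positivity)]
    simp only [Function.comp]
    congr 1; ring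
  refine le_of_tendsto_of_tendsto' hl ?_ fun n => norm_sum_steinForm_le hφ ho hS hφS hw hwm hSi hη
    (by positivity) ?_ hκ hμ hα
  · refine Filter.Tendsto.mul_const _ ?_
    refine Filter.Tendsto.rpow_const (Filter.Tendsto.const_mul _ (Filter.Tendsto.mul_const _ ?_))
      (Or.inr hθ1)
    simpa using hr.const_mul 2
  · rw [div_le_one (by positivity)]; linarith [(Nat.cast_nonneg n : (0 : ℝ) ≤ n)]

end

end

/-! ### The regularised evolution and its retarded form -/

section

variable {d : ℕ}

/-- The heat-regularised Schrödinger evolution of a function with Fourier transform `ψ`. -/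
noncomputable def heatEvol (η : ℝ) (ψ : L2Space d) (X : ℝ × RSpace d) : ℂ :=
  ∫ ξ, heatWave η X ξ * ψ ξ

theorem memLp_heatWave {η : ℝ} (hη : 0 < η) (X : ℝ × RSpace d) : MemLp (heatWave η X) 2 :=
  (integrable_heatWave hη X).memLp_two_of_bound fun ξ => norm_heatWave_le_one hη.le X ξ

theorem integrable_heatWave_mul {η : ℝ} (hη : 0 < η) (X : ℝ × RSpace d) (ψ : L2Space d) :
    Integrable fun ξ => heatWave η X ξ * ψ ξ :=
  (memLp_heatWave hη X).integrable_mul (Lp.memLp ψ)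

theorem measurable_heatEvol (η : ℝ) (ψ : L2Space d) : Measurable (heatEvol η ψ) := by
  refine StronglyMeasurable.measurable ?_
  refine StronglyMeasurable.integral_prod_right'
    (f := fun p : (ℝ × RSpace d) × RSpace d => heatWave η p.1 p.2 * ψ p.2) ?_
  exact (continuous_heatWave η).stronglyMeasurable.mul
    ((Lp.stronglyMeasurable ψ).comp_measurable measurable_snd)

theorem exists_norm_heatEvol_le {η : ℝ} (hη : 0 < η) (ψ : L2Space d) :
    ∃ c, ∀ X, ‖heatEvol η ψ X‖ ≤ c := by
  have hi : Integrable fun ξ : RSpace d => ‖heatWave η (0 : ℝ × RSpace d) ξ * ψ ξ‖ :=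
    (integrable_heatWave_mul hη 0 ψ).norm
  refine ⟨∫ ξ : RSpace d, ‖heatWave η (0 : ℝ × RSpace d) ξ * ψ ξ‖, fun X => ?_⟩
  refine norm_integral_le_of_norm_le hi (.of_forall fun ξ => ?_)
  rw [norm_mul, norm_mul, norm_heatWave, norm_heatWave]

theorem gaussKernel_neg (η : ℝ) (X : ℝ × RSpace d) : gaussKernel η (-X) = conj (gaussKernel η X) := by
  have h : ∀ Z : ℝ × RSpace d, gaussKernel η Z = ∫ ξ, heatWave (η / 2) Z ξ *
      conj (heatWave (η / 2) (0 : ℝ × RSpace d) ξ) := fun Z => by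
    simp only [heatWave_mul_conj, gaussKernel, sub_zero]
    rw [mul_div_cancel₀ _ two_ne_zero]
  have h' : gaussKernel η (-X) = ∫ ξ, heatWave (η / 2) (0 : ℝ × RSpace d) ξ *
      conj (heatWave (η / 2) X ξ) := by
    simp only [heatWave_mul_conj, gaussKernel, zero_sub]
    rw [mul_div_cancel₀ _ two_ne_zero]
  rw [h', h, ← integral_conj]
  refine integral_congr_ae (.of_forall fun ξ => ?_)
  simp only [map_mul, Complex.conj_conj]
  ring

/-- Equal times form a null set, so the full form is the sum of its retarded and advanced halves. -/
theorem ae_fst_ne_fst : ∀ᵐ p : (ℝ × RSpace d) × (ℝ × RSpace d), p.1.1 ≠ p.2.1 := by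
  have hm : MeasurableSet {p : (ℝ × RSpace d) × (ℝ × RSpace d) | p.1.1 = p.2.1} :=
    measurableSet_eq_fun (by fun_prop) (by fun_prop)
  have h0 : (volume.prod volume : Measure ((ℝ × RSpace d) × (ℝ × RSpace d)))
      {p | p.1.1 = p.2.1} = 0 := by
    rw [Measure.measure_prod_null hm]
    refine .of_forall fun X => ?_
    have : (Prod.mk X ⁻¹' {p : (ℝ × RSpace d) × (ℝ × RSpace d) | p.1.1 = p.2.1}) =
        ({X.1} : Set ℝ) ×ˢ (Set.univ : Set (RSpace d)) := by
      ext Y; simp [eq_comm]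
    change volume (Prod.mk X ⁻¹' _) = 0
    rw [this, Measure.volume_eq_prod, Measure.prod_prod]
    simp
  rw [ae_iff]
  simp only [not_not, ne_eq]
  exact h0

section

variable {R c m η : ℝ} {w : ℝ × RSpace d → ℝ} {φ : ℝ × RSpace d → ℂ}

theorem BoxFun.mul_exp (hφ : BoxFun R c φ) (hw : Measurable w) (hwm : ∀ X, |w X| ≤ m) :
    BoxFun R (c * Real.exp m) fun X => φ X * Complex.exp (w X) := by
  refine hφ.mul_bounded (by fun_prop) fun X => ?_
  rw [← Complex.ofReal_exp, Complex.norm_real, Real.norm_of_nonneg (Real.exp_pos _).le,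
    Real.exp_le_exp]
  exact (abs_le.1 (hwm X)).2

theorem integrable_retardedForm (hφ : BoxFun R c φ) (hw : Measurable w) (hwm : ∀ X, |w X| ≤ m)
    (hη : 0 < η) {g : ℝ → ℂ} (hg : Measurable g) (hg1 : ∀ t, ‖g t‖ ≤ 1) :
    Integrable fun p : (ℝ × RSpace d) × (ℝ × RSpace d) => conj (φ p.1) *
      (Complex.exp (w p.1 + w p.2) * g (p.1.1 - p.2.1) * gaussKernel (2 * η) (p.1 - p.2)) *
        φ p.2 := by
  obtain ⟨G, hG⟩ := exists_norm_gaussKernel_le (d := d) (show 0 < 2 * η by positivity)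
  have ha := hφ.mul_exp hw hwm
  have hi := ((ha.star.integrable.mul_prod ha.integrable).norm.mul_const G)
  refine hi.mono' ?_ (.of_forall fun p => ?_)
  · have h1 : Measurable fun p : (ℝ × RSpace d) × (ℝ × RSpace d) => conj (φ p.1) :=
      hφ.star.measurable.comp measurable_fst
    have h2 : Measurable fun p : (ℝ × RSpace d) × (ℝ × RSpace d) => φ p.2 :=
      hφ.measurable.comp measurable_snd
    have h3 : Measurable fun p : (ℝ × RSpace d) × (ℝ × RSpace d) => g (p.1.1 - p.2.1) :=
      hg.comp (by fun_prop)
    have h4 : Measurable fun p : (ℝ × RSpace d) × (ℝ × RSpace d) =>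
        gaussKernel (2 * η) (p.1 - p.2) :=
      (stronglyMeasurable_gaussKernel _).measurable.comp (by fun_prop)
    have h5 : Measurable fun p : (ℝ × RSpace d) × (ℝ × RSpace d) =>
        Complex.exp (w p.1 + w p.2) := by fun_prop
    exact ((h1.mul ((h5.mul h3).mul h4)).mul h2).aestronglyMeasurable
  · have e : ‖conj (φ p.1 * Complex.exp (w p.1)) * (φ p.2 * Complex.exp (w p.2))‖ =
        ‖conj (φ p.1)‖ * ‖Complex.exp (w p.1 + w p.2)‖ * ‖φ p.2‖ := by
      rw [Complex.exp_add]; simp only [norm_mul, RCLike.norm_conj]; ring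
    rw [e, norm_mul, norm_mul, norm_mul, norm_mul]
    calc _ ≤ ‖conj (φ p.1)‖ * (‖Complex.exp (w p.1 + w p.2)‖ * 1 * G) * ‖φ p.2‖ := by
          gcongr
          · exact hg1 _
          · exact hG _
      _ = _ := by ring

/-- Duality: testing the evolution against `φ` is controlled by the retarded form. -/
theorem norm_integral_conj_mul_heatEvol_sq_le (hφ : BoxFun R c φ) (hw : Measurable w)
    (hwm : ∀ X, |w X| ≤ m) (hη : 0 < η) (ψ : L2Space d) :
    ‖∫ X, conj (φ X) * (Complex.exp (w X) * heatEvol η ψ X)‖ ^ 2 ≤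
      ‖ψ‖ ^ 2 * (2 * (retardedForm η w φ).re) := by
  have ha := hφ.mul_exp hw hwm
  set a : ℝ × RSpace d → ℂ := fun X => φ X * Complex.exp (w X) with ha'
  -- `h` is the adjoint of ψ ↦ e^w · `heatEvol η ψ` applied to φ. The pairing to be bounded is ⟪h,
  -- ψ⟫, and ‖h‖² is the form with kernel e^{2ηΔ}e^{i(t-s)Δ} over all times.
  set h : RSpace d → ℂ := fun ξ => ∫ X, a X * conj (heatWave η X ξ) with hh
  have hwi : Integrable (fun q : (ℝ × RSpace d) × RSpace d => a q.1 * conj (heatWave η q.1 q.2))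
      (volume.prod volume) := by
    refine (ha.integrable.norm.mul_prod (integrable_exp_neg_mul_sq_norm (d := d)
      (b := 4 * Real.pi ^ 2 * η) (by positivity))).mono' ?_ (.of_forall fun q => ?_)
    · exact ha.integrable.aestronglyMeasurable.comp_fst.mul
        (Complex.continuous_conj.comp (continuous_heatWave η)).aestronglyMeasurable
    · rw [norm_mul, RCLike.norm_conj, norm_heatWave]
  have hhi : Integrable h := hwi.integral_prod_right
  have hhb : ∀ ξ, ‖h ξ‖ ≤ ∫ X, ‖a X‖ := fun ξ => by
    refine norm_integral_le_of_norm_le ha.integrable.norm (.of_forall fun X => ?_)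
    rw [norm_mul, RCLike.norm_conj]
    exact mul_le_of_le_one_right (norm_nonneg _) (norm_heatWave_le_one hη.le X ξ)
  have hh2 : MemLp h 2 := hhi.memLp_two_of_bound hhb
  have e1 : ∫ X, conj (φ X) * (Complex.exp (w X) * heatEvol η ψ X) = ⟪hh2.toLp h, ψ⟫_ℂ := by
    have e2 : ∀ X, conj (φ X) * (Complex.exp (w X) * heatEvol η ψ X) =
        ∫ ξ, conj (a X) * (heatWave η X ξ * ψ ξ) := fun X => by
      rw [integral_const_mul, ha', map_mul, ← Complex.exp_conj, Complex.conj_ofReal, heatEvol,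
        mul_assoc]
    simp_rw [e2]
    have hsw : Integrable (Function.uncurry fun (X : ℝ × RSpace d) (ξ : RSpace d) =>
        conj (a X) * (heatWave η X ξ * ψ ξ)) (volume.prod volume) := by
      refine (ha.integrable.norm.mul_prod (integrable_heatWave_mul hη 0 ψ).norm).mono' ?_
        (.of_forall fun q => ?_)
      · exact (Complex.continuous_conj.comp_aestronglyMeasurable
          ha.integrable.aestronglyMeasurable).comp_fst.mul
          ((continuous_heatWave η).aestronglyMeasurable.mul (Lp.aestronglyMeasurable ψ).comp_snd)
      · simp only [Function.uncurry]
        simp only [norm_mul, RCLike.norm_conj, norm_heatWave, ha', le_refl]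
    rw [integral_integral_swap hsw, L2.inner_def]
    refine integral_congr_ae ?_
    filter_upwards [hh2.coeFn_toLp] with ξ hξ
    rw [hξ, RCLike.inner_apply, hh, ← integral_conj, ← integral_const_mul]
    refine integral_congr_ae (.of_forall fun X => ?_)
    simp only [map_mul, Complex.conj_conj]
    ring
  have e3 : (((‖hh2.toLp h‖ ^ 2 : ℝ)) : ℂ) =
      ∫ p : (ℝ × RSpace d) × (ℝ × RSpace d), conj (φ p.1) *
        (Complex.exp (w p.1 + w p.2) * 1 * gaussKernel (2 * η) (p.1 - p.2)) * φ p.2 := by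
    have := inner_self_eq_norm_sq_to_K (𝕜 := ℂ) (hh2.toLp h)
    rw [Complex.ofReal_pow]
    refine this.symm.trans ?_
    rw [L2.inner_def]
    set Φ : (ℝ × RSpace d) × (ℝ × RSpace d) → RSpace d → ℂ := fun p ξ =>
      (conj (a p.1) * a p.2) * heatWave (2 * η) (p.1 - p.2) ξ with hΦ
    have hΦi : Integrable (Function.uncurry Φ) (volume.prod volume) := by
      refine ((ha.star.integrable.mul_prod ha.integrable).norm.mul_prod
        (integrable_exp_neg_mul_sq_norm (d := d)
        (b := 4 * Real.pi ^ 2 * (2 * η)) (by positivity))).mono' ?_ (.of_forall fun q => ?_)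
      · have h2 : Continuous fun q : ((ℝ × RSpace d) × (ℝ × RSpace d)) × RSpace d =>
            heatWave (2 * η) (q.1.1 - q.1.2) q.2 :=
          Continuous.heatWave _ (by fun_prop) (by fun_prop)
        exact (ha.star.integrable.mul_prod ha.integrable).aestronglyMeasurable.comp_fst.mul
          h2.aestronglyMeasurable
      · simp only [Function.uncurry, hΦ]
        rw [norm_mul, norm_heatWave]
    have e4 : ∀ p : (ℝ × RSpace d) × (ℝ × RSpace d), conj (φ p.1) *
        (Complex.exp (w p.1 + w p.2) * 1 * gaussKernel (2 * η) (p.1 - p.2)) * φ p.2 =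
        ∫ ξ, Φ p ξ := fun p => by
      simp only [hΦ]
      rw [integral_const_mul, ← gaussKernel]
      simp only [ha', map_mul, ← Complex.exp_conj, Complex.conj_ofReal, Complex.exp_add]
      ring
    simp_rw [e4]
    rw [integral_integral_swap hΦi]
    refine integral_congr_ae ?_
    filter_upwards [hh2.coeFn_toLp] with ξ hξ
    rw [hξ, RCLike.inner_apply, mul_comm, hh, ← integral_conj, ← integral_prod_mul]
    refine integral_congr_ae (.of_forall fun p => ?_)
    simp only [hΦ, map_mul, Complex.conj_conj, ← heatWave_mul_conj]
    ring
  have e5 : ‖hh2.toLp h‖ ^ 2 = 2 * (retardedForm η w φ).re := by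
    have hg1 : Measurable fun t : ℝ => if 0 < t then (1 : ℂ) else 0 :=
      Measurable.ite measurableSet_Ioi measurable_const measurable_const
    have i1 := integrable_retardedForm hφ hw hwm hη hg1 (fun t => by split_ifs <;> simp)
    -- Exchanging the two space-time variables and using the Hermitian symmetry of the kernel
    -- identifies the advanced half with the conjugate of the retarded one.
    have e6 : conj (retardedForm η w φ) = ∫ p : (ℝ × RSpace d) × (ℝ × RSpace d), conj (φ p.1) *
        (Complex.exp (w p.1 + w p.2) * (if 0 < -(p.1.1 - p.2.1) then 1 else 0) *
          gaussKernel (2 * η) (p.1 - p.2)) * φ p.2 := by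
      rw [retardedForm, ← integral_conj, Measure.volume_eq_prod, ← integral_prod_swap]
      refine integral_congr_ae (.of_forall fun p => ?_)
      simp only [Prod.fst_swap, Prod.snd_swap, map_mul, Complex.conj_conj, ← Complex.exp_conj,
        map_add, Complex.conj_ofReal]
      rw [← neg_sub p.2.1 p.1.1, neg_neg, ← neg_sub p.2 p.1, gaussKernel_neg, add_comm]
      split_ifs <;> simp
      ring
    have hg2 : Measurable fun t : ℝ => if 0 < -t then (1 : ℂ) else 0 :=
      Measurable.ite (measurableSet_lt measurable_const measurable_neg) measurable_const
        measurable_const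
    have i2 := integrable_retardedForm hφ hw hwm hη hg2 (fun t => by split_ifs <;> simp)
    have e7 : (((‖hh2.toLp h‖ ^ 2 : ℝ)) : ℂ) = retardedForm η w φ + conj (retardedForm η w φ) := by
      rw [e3, e6, retardedForm, ← integral_add i1 i2]
      refine integral_congr_ae ?_
      filter_upwards [ae_fst_ne_fst] with p hp
      rcases lt_or_gt_of_ne hp with h | h
      · have h1 : ¬ 0 < p.1.1 - p.2.1 := by linarith
        have h2 : 0 < -(p.1.1 - p.2.1) := by linarith
        rw [if_neg h1, if_pos h2]; ring
      · have h1 : 0 < p.1.1 - p.2.1 := by linarith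
        have h2 : ¬ 0 < -(p.1.1 - p.2.1) := by linarith
        rw [if_pos h1, if_neg h2]; ring
    rw [Complex.add_conj] at e7
    exact_mod_cast e7
  rw [e1, ← e5, ← mul_pow, mul_comm]
  exact pow_le_pow_left₀ (norm_nonneg _) (norm_inner_le_norm _ _) 2

end

/-! ### Reduction to families with orthogonal images -/

/-- Diagonalisation of the Gram matrix: Schatten type bounds for orthonormal families follow from
those for families with orthogonal images. -/
theorem sum_norm_map_pow_le_of_orthogonal {H K : Type*} [NormedAddCommGroup H]
    [InnerProductSpace ℂ H] [NormedAddCommGroup K] [InnerProductSpace ℂ K] (B : H →ₗ[ℂ] K)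
    {ι : Type*} [Fintype ι] [DecidableEq ι] {r M : ℝ} (hr : 1 ≤ r)
    (hB : ∀ v : ι → H, Orthonormal ℂ v → (∀ i j, i ≠ j → ⟪B (v i), B (v j)⟫_ℂ = 0) →
      ∑ i, (‖B (v i)‖ ^ 2) ^ r ≤ M)
    {u : ι → H} (hu : Orthonormal ℂ u) : ∑ i, (‖B (u i)‖ ^ 2) ^ r ≤ M := by
  set G : Matrix ι ι ℂ := Matrix.of fun i j => ⟪B (u i), B (u j)⟫_ℂ with hG
  have hGh : G.IsHermitian := by
    ext i j
    simp [hG, Matrix.conjTranspose_apply]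
  set U : Matrix ι ι ℂ := (hGh.eigenvectorUnitary : Matrix ι ι ℂ) with hU
  set l := hGh.eigenvalues with hl
  have hUU : star U * U = 1 := Unitary.coe_star_mul_self _
  have hUU' : U * star U = 1 := Unitary.coe_mul_star_self _
  have hspec : G = U * Matrix.diagonal (fun i => ((l i : ℝ) : ℂ)) * star U := by
    have := hGh.spectral_theorem
    simpa [Unitary.conjStarAlgAut_apply, Function.comp_def] using this
  have hdiag : star U * G * U = Matrix.diagonal (fun i => ((l i : ℝ) : ℂ)) := by
    rw [hspec]
    simp only [← mul_assoc]
    rw [hUU, one_mul, mul_assoc, hUU, mul_one]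
  -- The rotated system is again orthonormal, and its images under `B` are orthogonal with squared
  -- norms the eigenvalues of the Gram matrix.
  set v : ι → H := fun k => ∑ j, U j k • u j with hv
  have hvo : ∀ k l, ⟪v k, v l⟫_ℂ = if k = l then 1 else 0 := by
    intro k l
    rw [hv]
    have := hu.inner_sum (fun j => U j k) (fun j => U j l) Finset.univ
    rw [this]
    have h2 := congrFun (congrFun hUU k) l
    rw [Matrix.mul_apply, Matrix.one_apply] at h2
    simpa [Matrix.star_apply] using h2
  have hBv : ∀ k l', ⟪B (v k), B (v l')⟫_ℂ = Matrix.diagonal (fun i => ((l i : ℝ) : ℂ)) k l' := by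
    intro k l'
    rw [← hdiag, Matrix.mul_apply, hv]
    simp only [map_sum, map_smul, sum_inner, inner_sum, inner_smul_left, inner_smul_right]
    simp only [Matrix.mul_apply, Matrix.star_apply, Finset.sum_mul, hG, Matrix.of_apply]
    refine Finset.sum_congr rfl fun i _ => ?_
    rw [Finset.mul_sum]
    refine Finset.sum_congr rfl fun j _ => ?_
    simp only [RCLike.star_def]
    ring
  have hlk : ∀ k, ‖B (v k)‖ ^ 2 = l k := by
    intro k
    have := hBv k k
    rw [inner_self_eq_norm_sq_to_K, Matrix.diagonal_apply_eq] at this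
    exact Complex.ofReal_injective (by rw [Complex.ofReal_pow]; exact this)
  have hvon : Orthonormal ℂ v := orthonormal_iff_ite.2 hvo
  have hM := hB v hvon fun i j hij => by rw [hBv, Matrix.diagonal_apply_ne _ hij]
  simp only [hlk] at hM
  have hl0 : ∀ k, 0 ≤ l k := fun k => by rw [← hlk]; positivity
  have hGjj : ∀ j, ‖B (u j)‖ ^ 2 = ∑ k, ‖U j k‖ ^ 2 * l k := by
    intro j
    have h1 : G j j = ((‖B (u j)‖ ^ 2 : ℝ) : ℂ) := by
      simp only [hG, Matrix.of_apply]
      rw [inner_self_eq_norm_sq_to_K]; push_cast; rfl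
    have h2 := congrFun (congrFun hspec j) j
    rw [h1, Matrix.mul_apply] at h2
    have h3 : ∀ k, (U * Matrix.diagonal (fun i => ((l i : ℝ) : ℂ))) j k * star U k j =
        ((‖U j k‖ ^ 2 * l k : ℝ) : ℂ) := by
      intro k
      rw [Matrix.mul_diagonal, Matrix.star_apply, RCLike.star_def, mul_right_comm, Complex.mul_conj']
      push_cast; ring
    simp only [h3] at h2
    exact_mod_cast h2
  have hrow : ∀ j, ∑ k, ‖U j k‖ ^ 2 = 1 := by
    intro j
    have h2 := congrFun (congrFun hUU' j) j
    rw [Matrix.mul_apply, Matrix.one_apply_eq] at h2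
    simp only [Matrix.star_apply, RCLike.star_def, Complex.mul_conj'] at h2
    exact_mod_cast h2
  have hcol : ∀ k, ∑ j, ‖U j k‖ ^ 2 = 1 := by
    intro k
    have h2 := congrFun (congrFun hUU k) k
    rw [Matrix.mul_apply, Matrix.one_apply_eq] at h2
    simp only [Matrix.star_apply, RCLike.star_def, Complex.conj_mul'] at h2
    exact_mod_cast h2
  calc ∑ j, (‖B (u j)‖ ^ 2) ^ r = ∑ j, (∑ k, ‖U j k‖ ^ 2 * l k) ^ r := by simp only [hGjj]
    -- The diagonal of the Gram matrix is the image of its eigenvalues under the doubly stochastic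
    -- matrix ‖U j k‖²: Jensen along rows, then column sums equal to 1.
    _ ≤ ∑ j, ∑ k, ‖U j k‖ ^ 2 * l k ^ r := by
        refine Finset.sum_le_sum fun j _ => ?_
        have := (convexOn_rpow hr).map_sum_le (t := Finset.univ) (w := fun k => ‖U j k‖ ^ 2)
          (p := l) (fun _ _ => by positivity) (hrow j) (fun k _ => hl0 k)
        simpa using this
    _ = ∑ k, l k ^ r := by
        rw [Finset.sum_comm]
        refine Finset.sum_congr rfl fun k _ => ?_
        rw [← Finset.sum_mul, hcol, one_mul]
    _ ≤ M := hM

end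

/-! ### The diagonal estimate for bounded weights -/

section

theorem integral_conj_mul_self {α : Type*} [MeasurableSpace α] {μ : Measure α} (f : α → ℂ) :
    ∫ x, conj (f x) * f x ∂μ = ((∫ x, ‖f x‖ ^ 2 ∂μ : ℝ) : ℂ) := by
  rw [← integral_complex_ofReal]
  refine integral_congr_ae (.of_forall fun x => ?_)
  simp only [Complex.conj_mul']
  push_cast
  rfl

/-- The constant of the diagonal orthonormal Strichartz inequality. -/
noncomputable def steinConst (κ : ℝ) : ℝ :=
  2 * (2 * Real.exp ((Real.pi * κ / 4) ^ 2)) ^ (1 - 1 / κ) * ((1 + κ) * Real.exp 2) ^ (1 / κ)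

theorem steinConst_pos {κ : ℝ} (hκ : 0 < κ) : 0 < steinConst κ := by
  unfold steinConst; positivity

variable {d : ℕ}

section

variable {R m η κ : ℝ} {w : ℝ × RSpace d → ℝ} {S : Set (ℝ × RSpace d)}

/-- The evolution multiplied by the weight `1_S e^w`. -/
noncomputable def weightedEvol (η : ℝ) (S : Set (ℝ × RSpace d)) (w : ℝ × RSpace d → ℝ)
    (ψ : L2Space d) : ℝ × RSpace d → ℂ :=
  S.indicator fun X => Complex.exp (w X) * heatEvol η ψ X

theorem exists_boxFun_weightedEvol (hS : MeasurableSet S)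
    (hSR : S ⊆ Set.Icc (-R) R ×ˢ Metric.closedBall (0 : RSpace d) R) (hw : Measurable w)
    (hwm : ∀ X, |w X| ≤ m) (hη : 0 < η) (ψ : L2Space d) :
    ∃ c, BoxFun R c (weightedEvol η S w ψ) := by
  obtain ⟨c, hc⟩ := exists_norm_heatEvol_le hη ψ
  refine ⟨Real.exp m * c, ?_, fun X => ?_, fun X hX => hSR ?_⟩
  · exact (Measurable.mul (by fun_prop) (measurable_heatEvol η ψ)).indicator hS
  · refine (norm_indicator_le_norm_self _ _).trans ?_
    rw [norm_mul, ← Complex.ofReal_exp, Complex.norm_real, Real.norm_of_nonneg (Real.exp_pos _).le]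
    refine mul_le_mul ?_ (hc X) (norm_nonneg _) (Real.exp_pos _).le
    exact Real.exp_le_exp.2 (abs_le.1 (hwm X)).2
  · by_contra h
    exact hX (Set.indicator_of_notMem h _)

/-- The normalised images φ_i form an orthonormal system, and the retarded form at φ_i has real part
at least half of the squared norm of the i-th image. The interpolated bound on the retarded forms
then becomes a self-improving inequality for the sum itself. -/
theorem sum_integral_weightedEvol_rpow_le_of_orthogonal (hS : MeasurableSet S)
    (hSR : S ⊆ Set.Icc (-R) R ×ˢ Metric.closedBall (0 : RSpace d) R) (hw : Measurable w)
    (hwm : ∀ X, |w X| ≤ m) (hSi : IntegrableOn (fun X => Real.exp (2 * κ * w X)) S) (hη : 0 < η)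
    (hκ : κ = (d + 2) / 2) {ι : Type*} [Fintype ι] [DecidableEq ι] {ψ : ι → L2Space d}
    (hψ : Orthonormal ℂ ψ) (horth : ∀ i j, i ≠ j →
      ∫ X, conj (weightedEvol η S w (ψ i) X) * weightedEvol η S w (ψ j) X = 0) :
    ∑ i, (∫ X, ‖weightedEvol η S w (ψ i) X‖ ^ 2) ^ (2 * κ) ≤
      steinConst κ ^ (2 * κ) * (∫ X in S, Real.exp (2 * κ * w X)) ^ 2 := by
  have hd0 : (0 : ℝ) ≤ d := Nat.cast_nonneg d
  have hκ1 : 1 ≤ κ := by rw [hκ]; linarith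
  have hκ0 : 0 < κ := by linarith
  set g : ι → ℝ × RSpace d → ℂ := fun i => weightedEvol η S w (ψ i) with hg
  set l : ι → ℝ := fun i => ∫ X, ‖g i X‖ ^ 2 with hl
  set I := ∫ X in S, Real.exp (2 * κ * w X) with hI
  have hI0 : 0 ≤ I := integral_nonneg fun _ => (Real.exp_pos _).le
  have hl0 : ∀ i, 0 ≤ l i := fun i => integral_nonneg fun _ => by positivity
  choose c₀ hc₀ using fun i => exists_boxFun_weightedEvol hS hSR hw hwm hη (ψ i)
  -- Vanishing images cannot be normalised and contribute nothing to the sum.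
  set J := {i // 0 < l i} with hJ
  set φ : J → ℝ × RSpace d → ℂ := fun i X => g i X * (((Real.sqrt (l i))⁻¹ : ℝ) : ℂ) with hφ
  have hsq : ∀ i : J, 0 < Real.sqrt (l i) := fun i => Real.sqrt_pos.2 i.2
  obtain ⟨c, hc⟩ : ∃ c, ∀ i : J, BoxFun R c (φ i) := by
    have h1 : ∀ i : J, BoxFun R (c₀ i * ‖(((Real.sqrt (l i))⁻¹ : ℝ) : ℂ)‖) (φ i) := fun i =>
      (hc₀ i).mul_bounded measurable_const fun _ => le_rfl
    refine ⟨∑ i : J, |c₀ i * ‖(((Real.sqrt (l i))⁻¹ : ℝ) : ℂ)‖|, fun i =>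
      ⟨(h1 i).measurable, fun X => ((h1 i).bound X).trans ((le_abs_self _).trans ?_),
        (h1 i).support⟩⟩
    exact Finset.single_le_sum (f := fun i : J => |c₀ i * ‖(((Real.sqrt (l i))⁻¹ : ℝ) : ℂ)‖|)
      (fun _ _ => abs_nonneg _) (Finset.mem_univ i)
  have hgg : ∀ i, ∫ X, conj (g i X) * g i X = (l i : ℂ) := fun i =>
    integral_conj_mul_self (g i)
  have ho : ∀ i j, ∫ X, conj (φ i X) * φ j X = if i = j then 1 else 0 := by
    intro i j
    have e : ∀ X, conj (φ i X) * φ j X = (conj (g i X) * g j X) *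
        ((((Real.sqrt (l i))⁻¹ : ℝ) : ℂ) * (((Real.sqrt (l j))⁻¹ : ℝ) : ℂ)) := fun X => by
      simp only [hφ, map_mul, Complex.conj_ofReal]; ring
    simp_rw [e]
    rw [integral_mul_const]
    by_cases hij : i = j
    · subst hij
      rw [hgg, if_pos rfl, ← Complex.ofReal_mul, ← Complex.ofReal_mul, ← Complex.ofReal_one]
      congr 1
      rw [← mul_inv, Real.mul_self_sqrt (hl0 _)]
      exact mul_inv_cancel₀ i.2.ne'
    · rw [if_neg hij, horth _ _ fun h => hij (Subtype.ext h), zero_mul]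
  have hφS : ∀ i X, φ i X ≠ 0 → X ∈ S := by
    intro i X hX
    by_contra h
    exact hX (by simp [hφ, hg, weightedEvol, h])
  have hlam : ∀ i : J, l i ≤ 2 * (retardedForm η w (φ i)).re := by
    intro i
    have h1 := norm_integral_conj_mul_heatEvol_sq_le (hc i) hw hwm hη (ψ i)
    have e : ∀ X, conj (φ i X) * (Complex.exp (w X) * heatEvol η (ψ i) X) =
        (conj (g i X) * g i X) * (((Real.sqrt (l i))⁻¹ : ℝ) : ℂ) := by
      intro X
      by_cases hX : X ∈ S
      · simp only [hφ, hg, weightedEvol, Set.indicator_of_mem hX, map_mul, Complex.conj_ofReal]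
        ring
      · simp [hφ, hg, weightedEvol, hX]
    simp_rw [e] at h1
    rw [integral_mul_const, hgg, ← Complex.ofReal_mul, Complex.norm_real,
      Real.norm_of_nonneg (mul_nonneg (hl0 _) (inv_nonneg.2 (hsq i).le)), hψ.1, one_pow, one_mul]
      at h1
    refine le_trans (le_of_eq ?_) h1
    rw [mul_pow, inv_pow, Real.sq_sqrt (hl0 _), sq, mul_assoc, mul_inv_cancel₀ i.2.ne', mul_one]
  have hα0 : (0 : ℝ) < d + 1 := by positivity
  -- The weights l_i^{2κ-1} are the extremisers of ℓ^p duality: times l_i, or raised to the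
  -- conjugate exponent, they give l_i^{2κ}.
  have key := norm_sum_retardedForm_le hc ho hS hφS hw hwm hSi hη hκ
    (μ := fun i : J => l i ^ (2 * κ - 1)) (fun i => Real.rpow_pos_of_pos i.2 _) rfl
  have hμα : ∀ i : J, (l i ^ (2 * κ - 1)) ^ (((d : ℝ) + 2) / (d + 1)) = l i ^ (2 * κ) := by
    intro i
    rw [← Real.rpow_mul (hl0 _)]
    congr 1
    rw [hκ]; field_simp; ring
  simp only [hμα] at key
  set N := ∑ i : J, l i ^ (2 * κ) with hN
  have hN0 : 0 ≤ N := Finset.sum_nonneg fun i _ => Real.rpow_nonneg (hl0 _) _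
  have hsum : ∑ i, l i ^ (2 * κ) = N := by
    rw [hN, ← Finset.sum_subtype (Finset.univ.filter fun i => 0 < l i) (by simp)
      (fun i => l i ^ (2 * κ)), Finset.sum_filter_of_ne]
    intro i _ hi
    refine (hl0 i).lt_of_ne fun h => hi ?_
    rw [← h, Real.zero_rpow (by positivity)]
  rw [hsum]
  have h2 : N ≤ 2 * ‖∑ i : J, ((l i ^ (2 * κ - 1) : ℝ) : ℂ) * retardedForm η w (φ i)‖ := by
    refine le_trans ?_ (mul_le_mul_of_nonneg_left (Complex.re_le_norm _) two_pos.le)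
    rw [Complex.re_sum, Finset.mul_sum]
    refine Finset.sum_le_sum fun i _ => ?_
    rw [Complex.re_ofReal_mul, mul_left_comm]
    refine le_trans (le_of_eq ?_) (mul_le_mul_of_nonneg_left (hlam i) (Real.rpow_nonneg (hl0 _) _))
    rw [← Real.rpow_add_one i.2.ne']
    congr 1; ring
  rcases hN0.eq_or_lt with h0 | hpos
  · rw [← h0]
    have := (steinConst_pos hκ0).le
    positivity
  have h3 : N ≤ steinConst κ * N ^ (1 - 1 / (2 * κ)) * I ^ (1 / κ) := by
    refine h2.trans ((mul_le_mul_of_nonneg_left key two_pos.le).trans (le_of_eq ?_))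
    rw [Real.mul_rpow hN0 (by positivity), Real.mul_rpow (Real.sqrt_nonneg _) (by positivity),
      Real.mul_rpow (by positivity) hI0, Real.sqrt_eq_rpow, ← Real.rpow_mul hN0, steinConst]
    have : N ^ (1 - 1 / (2 * κ)) = N ^ (1 - 1 / κ) * N ^ (1 / 2 * (1 / κ)) := by
      rw [← Real.rpow_add hpos]; congr 1; field_simp; ring
    rw [this]; ring
  -- The finite positive factor N^{1 - 1/(2κ)} is cancelled.
  have h4 : N ^ (1 / (2 * κ)) ≤ steinConst κ * I ^ (1 / κ) := by
    have hp := Real.rpow_pos_of_pos hpos (1 - 1 / (2 * κ))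
    refine le_of_mul_le_mul_right ?_ hp
    rw [← Real.rpow_add hpos]
    calc _ = N := by rw [add_sub_cancel, Real.rpow_one]
      _ ≤ _ := h3
      _ = _ := by ring
  calc N = (N ^ (1 / (2 * κ))) ^ (2 * κ) := by
        rw [← Real.rpow_mul hN0, one_div_mul_cancel (by positivity), Real.rpow_one]
    _ ≤ (steinConst κ * I ^ (1 / κ)) ^ (2 * κ) :=
        Real.rpow_le_rpow (Real.rpow_nonneg hN0 _) h4 (by positivity)
    _ = _ := by
        rw [Real.mul_rpow (steinConst_pos hκ0).le (Real.rpow_nonneg hI0 _), ← Real.rpow_mul hI0]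
        congr 1
        rw [← Real.rpow_natCast]
        congr 1
        field_simp
        norm_num

theorem weightedEvol_add (hη : 0 < η) (ψ χ : L2Space d) :
    weightedEvol η S w (ψ + χ) = weightedEvol η S w ψ + weightedEvol η S w χ := by
  have h : ∀ X, heatEvol η (ψ + χ) X = heatEvol η ψ X + heatEvol η χ X := fun X => by
    rw [heatEvol, heatEvol, heatEvol, ← integral_add (integrable_heatWave_mul hη X ψ)
      (integrable_heatWave_mul hη X χ)]
    refine integral_congr_ae ?_
    filter_upwards [Lp.coeFn_add ψ χ] with ξ hξ
    rw [hξ, Pi.add_apply, mul_add]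
  rw [weightedEvol, weightedEvol, weightedEvol, ← Set.indicator_add']
  congr 1
  ext X
  simp only [h, Pi.add_apply, mul_add]

theorem weightedEvol_smul (a : ℂ) (ψ : L2Space d) :
    weightedEvol η S w (a • ψ) = a • weightedEvol η S w ψ := by
  have h : ∀ X, heatEvol η (a • ψ) X = a * heatEvol η ψ X := fun X => by
    rw [heatEvol, heatEvol, ← integral_const_mul]
    refine integral_congr_ae ?_
    filter_upwards [Lp.coeFn_smul a ψ] with ξ hξ
    rw [hξ, Pi.smul_apply, smul_eq_mul, mul_left_comm]
  ext X
  by_cases hX : X ∈ S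
  · simp only [weightedEvol, Set.indicator_of_mem hX, h, Pi.smul_apply, smul_eq_mul, mul_left_comm]
  · simp [weightedEvol, hX]

theorem sum_integral_weightedEvol_rpow_le (hS : MeasurableSet S)
    (hSR : S ⊆ Set.Icc (-R) R ×ˢ Metric.closedBall (0 : RSpace d) R) (hw : Measurable w)
    (hwm : ∀ X, |w X| ≤ m) (hSi : IntegrableOn (fun X => Real.exp (2 * κ * w X)) S) (hη : 0 < η)
    (hκ : κ = (d + 2) / 2) {ι : Type*} [Fintype ι] [DecidableEq ι] {ψ : ι → L2Space d}
    (hψ : Orthonormal ℂ ψ) :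
    ∑ i, (∫ X, ‖weightedEvol η S w (ψ i) X‖ ^ 2) ^ (2 * κ) ≤
      steinConst κ ^ (2 * κ) * (∫ X in S, Real.exp (2 * κ * w X)) ^ 2 := by
  have hmem : ∀ χ : L2Space d, MemLp (weightedEvol η S w χ) 2 := fun χ =>
    (exists_boxFun_weightedEvol hS hSR hw hwm hη χ).choose_spec.memLp_two
  let B : L2Space d →ₗ[ℂ] Lp ℂ 2 (volume : Measure (ℝ × RSpace d)) :=
    { toFun := fun χ => (hmem χ).toLp
      map_add' := fun χ χ' => by
        rw [← MemLp.toLp_add, MemLp.toLp_eq_toLp_iff, weightedEvol_add hη]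
      map_smul' := fun a χ => by
        rw [RingHom.id_apply, ← MemLp.toLp_const_smul, MemLp.toLp_eq_toLp_iff, weightedEvol_smul] }
  have hin : ∀ χ χ' : L2Space d, ⟪B χ, B χ'⟫_ℂ =
      ∫ X, conj (weightedEvol η S w χ X) * weightedEvol η S w χ' X := by
    intro χ χ'
    rw [L2.inner_def]
    refine integral_congr_ae ?_
    filter_upwards [(hmem χ).coeFn_toLp, (hmem χ').coeFn_toLp] with X h1 h2
    change ⟪(hmem χ).toLp _ X, (hmem χ').toLp _ X⟫_ℂ = _
    rw [h1, h2, RCLike.inner_apply, mul_comm]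
  have hn : ∀ χ : L2Space d, ‖B χ‖ ^ 2 = ∫ X, ‖weightedEvol η S w χ X‖ ^ 2 := by
    intro χ
    have h1 := hin χ χ
    rw [inner_self_eq_norm_sq_to_K] at h1
    rw [integral_conj_mul_self] at h1
    exact Complex.ofReal_injective (by rw [Complex.ofReal_pow]; exact h1)
  have hd0 : (0 : ℝ) ≤ d := Nat.cast_nonneg d
  have := sum_norm_map_pow_le_of_orthogonal B (r := 2 * κ)
    (M := steinConst κ ^ (2 * κ) * (∫ X in S, Real.exp (2 * κ * w X)) ^ 2)
    (by rw [hκ]; linarith) (fun v hv hv' => by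
      simp only [hn]
      refine sum_integral_weightedEvol_rpow_le_of_orthogonal hS hSR hw hwm hSi hη hκ hv
        fun i j hij => ?_
      rw [← hin]; exact hv' i j hij) hψ
  simpa only [hn] using this

end

end

/-! ### Arbitrary nonnegative potentials -/

section

variable {d : ℕ}

/-- The level sets used to truncate a weight. -/
def truncSet (V : ℝ × RSpace d → ℝ≥0∞) (n : ℕ) : Set (ℝ × RSpace d) :=
  (Set.Icc (-(n : ℝ)) n ×ˢ Metric.closedBall (0 : RSpace d) n) ∩
    {X | ENNReal.ofReal (1 / ((n : ℝ) + 1)) ≤ V X ∧ V X ≤ ENNReal.ofReal (n : ℝ)}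

theorem measurableSet_truncSet {V : ℝ × RSpace d → ℝ≥0∞} (hV : Measurable V) (n : ℕ) :
    MeasurableSet (truncSet V n) :=
  (measurableSet_Icc.prod measurableSet_closedBall).inter
    ((measurableSet_le measurable_const hV).inter (measurableSet_le hV measurable_const))

theorem truncSet_mono (V : ℝ × RSpace d → ℝ≥0∞) : Monotone (truncSet V) := by
  intro n m hnm X hX
  have h : (n : ℝ) ≤ m := by exact_mod_cast hnm
  refine ⟨⟨⟨by linarith [hX.1.1.1], hX.1.1.2.trans h⟩, Metric.closedBall_subset_closedBall h hX.1.2⟩,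
    le_trans (ENNReal.ofReal_le_ofReal ?_) hX.2.1, hX.2.2.trans (ENNReal.ofReal_le_ofReal h)⟩
  gcongr

theorem eventually_mem_truncSet {V : ℝ × RSpace d → ℝ≥0∞} {X : ℝ × RSpace d} (h0 : V X ≠ 0)
    (h1 : V X ≠ ∞) : ∀ᶠ n in Filter.atTop, X ∈ truncSet V n := by
  have hpos : 0 < (V X).toReal := ENNReal.toReal_pos h0 h1
  obtain ⟨a, ha⟩ := exists_nat_ge (max |X.1| ‖X.2‖)
  obtain ⟨b, hb⟩ := exists_nat_ge ((V X).toReal)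
  obtain ⟨c, hc⟩ := exists_nat_one_div_lt hpos
  filter_upwards [Filter.eventually_ge_atTop a, Filter.eventually_ge_atTop b,
    Filter.eventually_ge_atTop c] with n hna hnb hnc
  have h1' : (a : ℝ) ≤ n := by exact_mod_cast hna
  have h2' : (b : ℝ) ≤ n := by exact_mod_cast hnb
  have h3' : (c : ℝ) ≤ n := by exact_mod_cast hnc
  refine ⟨⟨abs_le.1 ((le_max_left _ _).trans (ha.trans h1')), ?_⟩, ?_, ?_⟩
  · rw [mem_closedBall_zero_iff]
    exact (le_max_right _ _).trans (ha.trans h1')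
  · rw [← ENNReal.ofReal_toReal h1]
    refine ENNReal.ofReal_le_ofReal (le_trans ?_ hc.le)
    gcongr
  · rw [← ENNReal.ofReal_toReal h1]
    exact ENNReal.ofReal_le_ofReal (hb.trans h2')

theorem sum_lintegral_truncSet_heatEvol_rpow_le {V : ℝ × RSpace d → ℝ≥0∞} (hV : Measurable V)
    {η κ : ℝ} (hη : 0 < η) (hκ : κ = (d + 2) / 2) {ι : Type*} [Fintype ι] [DecidableEq ι]
    {ψ : ι → L2Space d} (hψ : Orthonormal ℂ ψ) (n : ℕ) :
    ∑ i, (∫⁻ X in truncSet V n, V X * ‖heatEvol η (ψ i) X‖ₑ ^ 2) ^ (2 * κ) ≤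
      ENNReal.ofReal (steinConst κ) ^ (2 * κ) * (∫⁻ X, V X ^ κ) ^ 2 := by
  have hd0 : (0 : ℝ) ≤ d := Nat.cast_nonneg d
  have hκ0 : 0 < κ := by rw [hκ]; linarith
  set S := truncSet V n with hSdef
  have hS : MeasurableSet S := measurableSet_truncSet hV n
  -- Chosen so that e^{2w} = V on `S`; it is bounded because V lies between 1/(n+1) and n there.
  set w : ℝ × RSpace d → ℝ := S.indicator fun X => 1 / 2 * Real.log (V X).toReal with hw
  have hwm : Measurable w := by
    refine Measurable.indicator ?_ hS
    exact ((Real.measurable_log.comp hV.ennreal_toReal).const_mul _)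
  have hVS : ∀ X ∈ S, V X ≠ ∞ ∧ 1 / ((n : ℝ) + 1) ≤ (V X).toReal ∧ (V X).toReal ≤ n := by
    intro X hX
    have hfin : V X ≠ ∞ := (hX.2.2.trans_lt ENNReal.ofReal_lt_top).ne
    exact ⟨hfin, (ENNReal.ofReal_le_iff_le_toReal hfin).1 hX.2.1,
      ENNReal.toReal_le_of_le_ofReal (Nat.cast_nonneg n) hX.2.2⟩
  have hVpos : ∀ X ∈ S, 0 < (V X).toReal := fun X hX =>
    lt_of_lt_of_le (by positivity) (hVS X hX).2.1
  have hwb : ∀ X, |w X| ≤ 1 / 2 * Real.log ((n : ℝ) + 1) := by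
    intro X
    have hlog0 : 0 ≤ Real.log ((n : ℝ) + 1) :=
      Real.log_nonneg (by linarith [(Nat.cast_nonneg n : (0 : ℝ) ≤ n)])
    by_cases hX : X ∈ S
    · rw [hw, Set.indicator_of_mem hX, abs_mul, abs_of_pos (by norm_num : (0 : ℝ) < 1 / 2)]
      refine mul_le_mul_of_nonneg_left (abs_le.2 ⟨?_, ?_⟩) (by norm_num)
      · rw [← Real.log_inv, ← one_div]
        exact Real.log_le_log (by positivity) (hVS X hX).2.1
      · exact Real.log_le_log (hVpos X hX) ((hVS X hX).2.2.trans (by linarith))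
    · rw [hw, Set.indicator_of_notMem hX, abs_zero]
      positivity
  have hexp : ∀ X ∈ S, ∀ a : ℝ, ENNReal.ofReal (Real.exp (2 * a * w X)) = V X ^ a := by
    intro X hX a
    rw [hw, Set.indicator_of_mem hX, ← ENNReal.ofReal_toReal (hVS X hX).1,
      ENNReal.ofReal_rpow_of_pos (by simpa using hVpos X hX), ENNReal.toReal_ofReal (hVpos X hX).le,
      Real.rpow_def_of_pos (hVpos X hX)]
    congr 2; ring
  have hSR : S ⊆ Set.Icc (-(n : ℝ)) n ×ˢ Metric.closedBall (0 : RSpace d) n := fun X hX => hX.1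
  have hSfin : volume S < ∞ :=
    (measure_mono hSR).trans_lt (isCompact_Icc.prod (isCompact_closedBall _ _)).measure_lt_top
  have hSi : IntegrableOn (fun X => Real.exp (2 * κ * w X)) S := by
    refine Measure.integrableOn_of_bounded (M := Real.exp (2 * κ * (1 / 2 * Real.log ((n : ℝ) + 1))))
      hSfin.ne (by fun_prop) (.of_forall fun X => ?_)
    rw [Real.norm_of_nonneg (Real.exp_pos _).le, Real.exp_le_exp]
    have := (abs_le.1 (hwb X)).2
    gcongr
  have key := sum_integral_weightedEvol_rpow_le hS hSR hwm hwb hSi hη hκ hψ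
  have key2 := ENNReal.ofReal_le_ofReal key
  rw [ENNReal.ofReal_sum_of_nonneg fun i _ => Real.rpow_nonneg (integral_nonneg fun _ => by
    positivity) _] at key2
  refine le_trans (le_of_eq ?_) (key2.trans ?_)
  · refine Finset.sum_congr rfl fun i _ => ?_
    rw [← ENNReal.ofReal_rpow_of_nonneg (integral_nonneg fun _ => by positivity) (by positivity)]
    congr 1
    obtain ⟨c, hc⟩ := exists_boxFun_weightedEvol hS hSR hwm hwb hη (ψ i)
    rw [ofReal_integral_norm_sq hc.integrable_sq, ← lintegral_indicator hS]
    refine lintegral_congr fun X => ?_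
    by_cases hX : X ∈ S
    · have := hexp X hX 1
      rw [ENNReal.rpow_one] at this
      have hV2 : ‖Complex.exp (w X)‖ₑ ^ 2 = V X := by
        rw [← this, ← ofReal_norm (Complex.exp _), Complex.norm_exp,
          ← ENNReal.ofReal_pow (Real.exp_pos _).le, ← Real.exp_nat_mul, Complex.ofReal_re]
        norm_num
      rw [Set.indicator_of_mem hX, weightedEvol, Set.indicator_of_mem hX, enorm_mul, mul_pow, hV2]
    · simp [weightedEvol, hX]
  · have hI : ENNReal.ofReal (∫ X in S, Real.exp (2 * κ * w X)) ≤ ∫⁻ X, V X ^ κ := by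
      rw [ofReal_integral_eq_lintegral_ofReal hSi (.of_forall fun _ => (Real.exp_pos _).le),
        setLIntegral_congr_fun hS fun X hX => hexp X hX κ]
      exact setLIntegral_le_lintegral _ _
    rw [ENNReal.ofReal_mul (Real.rpow_nonneg (steinConst_pos hκ0).le _),
      ENNReal.ofReal_pow (integral_nonneg fun _ => (Real.exp_pos _).le),
      ← ENNReal.ofReal_rpow_of_nonneg (steinConst_pos hκ0).le (by positivity)]
    gcongr

/-- The truncation sets increase to {0 < V < ∞}. If ∫ V^κ is finite, V = ∞ only on a null set, and
monotone convergence applies. -/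
theorem sum_lintegral_heatEvol_rpow_le {V : ℝ × RSpace d → ℝ≥0∞} (hV : Measurable V)
    {η κ : ℝ} (hη : 0 < η) (hκ : κ = (d + 2) / 2) {ι : Type*} [Fintype ι] [DecidableEq ι]
    {ψ : ι → L2Space d} (hψ : Orthonormal ℂ ψ) :
    ∑ i, (∫⁻ X, V X * ‖heatEvol η (ψ i) X‖ₑ ^ 2) ^ (2 * κ) ≤
      ENNReal.ofReal (steinConst κ) ^ (2 * κ) * (∫⁻ X, V X ^ κ) ^ 2 := by
  have hd0 : (0 : ℝ) ≤ d := Nat.cast_nonneg d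
  have hκ0 : 0 < κ := by rw [hκ]; linarith
  by_cases hfin : ∫⁻ X, V X ^ κ = ∞
  · rw [hfin, ENNReal.top_pow two_ne_zero, ENNReal.mul_top]
    · exact le_top
    · exact (ENNReal.rpow_pos (ENNReal.ofReal_pos.2 (steinConst_pos hκ0)) ENNReal.ofReal_ne_top).ne'
  have hVfin : ∀ᵐ X, V X ≠ ∞ := by
    filter_upwards [ae_lt_top (hV.pow_const κ) hfin] with X hX h
    rw [h, ENNReal.top_rpow_of_pos hκ0] at hX
    exact lt_irrefl _ hX
  have hlim : ∀ i, Filter.Tendsto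
      (fun n => ∫⁻ X in truncSet V n, V X * ‖heatEvol η (ψ i) X‖ₑ ^ 2) Filter.atTop
      (nhds (∫⁻ X, V X * ‖heatEvol η (ψ i) X‖ₑ ^ 2)) := by
    intro i
    have hm : Measurable fun X => V X * ‖heatEvol η (ψ i) X‖ₑ ^ 2 :=
      hV.mul ((measurable_heatEvol η (ψ i)).enorm.pow_const 2)
    simp only [← lintegral_indicator (measurableSet_truncSet hV _)]
    refine lintegral_tendsto_of_tendsto_of_monotone
      (fun n => (hm.indicator (measurableSet_truncSet hV n)).aemeasurable)
      (.of_forall fun X n m hnm => ?_) ?_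
    · exact Set.indicator_le_indicator_of_subset (truncSet_mono V hnm) (fun _ => zero_le) X
    · filter_upwards [hVfin] with X hX
      by_cases h0 : V X = 0
      · have : ∀ n, (truncSet V n).indicator (fun X => V X * ‖heatEvol η (ψ i) X‖ₑ ^ 2) X = 0 := by
          intro n
          by_cases h : X ∈ truncSet V n <;> simp [h, h0]
        simp only [this, h0, zero_mul, tendsto_const_nhds]
      · refine tendsto_const_nhds.congr' ?_
        filter_upwards [eventually_mem_truncSet h0 hX] with n hn
        rw [Set.indicator_of_mem hn]
  refine le_of_tendsto' (tendsto_finsetSum _ fun i _ =>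
    ((ENNReal.continuous_rpow_const (y := 2 * κ)).tendsto _).comp (hlim i)) fun n => ?_
  exact sum_lintegral_truncSet_heatEvol_rpow_le hV hη hκ hψ n

end

/-! ### Removal of the heat regularisation and a measurable version of the evolution -/

section

variable {d : ℕ}

theorem norm_schrodingerSymbol (t : ℝ) (ξ : RSpace d) : ‖schrodingerSymbol d t ξ‖ = 1 :=
  Complex.norm_exp_ofReal_mul_I _

theorem norm_freeProp (t : ℝ) (f : L2Space d) : ‖freeProp t f‖ = ‖f‖ := by
  have h1 : ‖freeProp t f‖ = ‖((schrodingerSymbol_memLp d t).toLp (schrodingerSymbol d t) •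
      𝓕 f : L2Space d)‖ := (Lp.fourierTransformₗᵢ (RSpace d) ℂ).symm.norm_map _
  rw [h1, ← Lp.norm_fourier_eq f, Lp.norm_def, Lp.norm_def]
  congr 1
  refine eLpNorm_congr_norm_ae ?_
  filter_upwards [Lp.coeFn_lpSMul (p := ∞) (q := 2) (r := 2)
    ((schrodingerSymbol_memLp d t).toLp (schrodingerSymbol d t)) (𝓕 f : L2Space d),
    (schrodingerSymbol_memLp d t).coeFn_toLp] with ξ h2 h3
  rw [h2, Pi.smul_apply', h3, norm_smul, norm_schrodingerSymbol, one_mul]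

theorem freeProp_add (t : ℝ) (f g : L2Space d) :
    freeProp t (f + g) = freeProp t f + freeProp t g := by
  rw [freeProp, FourierTransform.fourier_add, Lp.add_smul, FourierTransform.fourierInv_add]
  rfl

theorem freeProp_smul (t : ℝ) (c : ℂ) (f : L2Space d) :
    freeProp t (c • f) = c • freeProp t f := by
  have h : ((schrodingerSymbol_memLp d t).toLp (schrodingerSymbol d t) • (c • 𝓕 f) : L2Space d) =
      c • ((schrodingerSymbol_memLp d t).toLp (schrodingerSymbol d t) • 𝓕 f : L2Space d) :=
    (Lp.smul_comm _ _ _).symm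
  rw [freeProp, FourierTransform.fourier_smul, h, FourierTransform.fourierInv_smul]
  rfl

theorem lintegral_enorm_freeProp_sq (t : ℝ) (f : L2Space d) :
    ∫⁻ x, ‖freeProp t f x‖ₑ ^ 2 = ‖f‖ₑ ^ 2 := by
  rw [← ofReal_norm, ← norm_freeProp t f, ofReal_norm, Lp.enorm_def,
    eLpNorm_eq_lintegral_rpow_enorm_toReal (p := 2) (by norm_num) (by norm_num),
    ← ENNReal.rpow_natCast, ← ENNReal.rpow_mul]
  simp

/-- The squared `L²` distance between `e^{ηΔ} f` and `f`. -/
noncomputable def heatDefect (η : ℝ) (f : L2Space d) : ℝ≥0∞ :=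
  ∫⁻ ξ, ‖((Real.exp (-(4 * Real.pi ^ 2 * η * ‖ξ‖ ^ 2)) - 1 : ℝ) : ℂ) *
    (𝓕 f : L2Space d) ξ‖ₑ ^ 2

theorem heatWave_zero_snd (η t : ℝ) (ξ : RSpace d) : heatWave η (t, (0 : RSpace d)) ξ =
    (Real.exp (-(4 * Real.pi ^ 2 * η * ‖ξ‖ ^ 2)) : ℂ) * schrodingerSymbol d t ξ := by
  rw [heatWave, schrodingerSymbol, Complex.ofReal_exp, ← Complex.exp_add]
  congr 1
  simp
  ring

/-- The heat flow commutes with the unitary propagator, so the error does not depend on `t`. One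
sequence of regularisations therefore serves all times. -/
theorem lintegral_enorm_heatEvol_sub_freeProp_sq {η : ℝ} (hη : 0 < η) (t : ℝ) (f : L2Space d) :
    ∫⁻ x, ‖heatEvol η (𝓕 f) (t, x) - freeProp t f x‖ₑ ^ 2 = heatDefect η f := by
  set h : RSpace d → ℂ := fun ξ => heatWave η (t, (0 : RSpace d)) ξ * (𝓕 f : L2Space d) ξ with hh
  have h1 : Integrable h := integrable_heatWave_mul hη _ _
  have h2 : MemLp h 2 := by
    refine (Lp.memLp (𝓕 f : L2Space d)).of_le h1.aestronglyMeasurable (.of_forall fun ξ => ?_)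
    rw [hh, norm_mul]
    exact mul_le_of_le_one_left (norm_nonneg _) (norm_heatWave_le_one hη.le _ _)
  have e1 : ∀ x, heatEvol η (𝓕 f) (t, x) = 𝓕⁻ h x := fun x => by
    rw [Real.fourierInv_eq', heatEvol]
    refine integral_congr_ae (.of_forall fun ξ => ?_)
    simp only [hh, heatWave, smul_eq_mul, ← mul_assoc, ← Complex.exp_add]
    congr 2
    rw [real_inner_comm]
    simp
    ring
  set S : L2Space d := (schrodingerSymbol_memLp d t).toLp (schrodingerSymbol d t) • 𝓕 f with hS
  have e2 : ∫⁻ x, ‖heatEvol η (𝓕 f) (t, x) - freeProp t f x‖ₑ ^ 2 =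
      ‖(𝓕⁻ (h2.toLp h) - freeProp t f : L2Space d)‖ₑ ^ 2 := by
    rw [Lp.enorm_def, eLpNorm_eq_lintegral_rpow_enorm_toReal (p := 2) (by norm_num) (by norm_num),
      ← ENNReal.rpow_natCast, ← ENNReal.rpow_mul]
    simp only [ENNReal.toReal_ofNat, Nat.cast_ofNat, ENNReal.rpow_ofNat, one_div,
      inv_mul_cancel₀ (two_ne_zero (α := ℝ)), ENNReal.rpow_one]
    refine lintegral_congr_ae ?_
    filter_upwards [fourierInv_toLp_ae_eq h1 h2, Lp.coeFn_sub (𝓕⁻ (h2.toLp h)) (freeProp t f)]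
      with x h3 h4
    rw [h4, Pi.sub_apply, h3, e1]
  have e3 : (𝓕⁻ (h2.toLp h) - freeProp t f : L2Space d) = 𝓕⁻ (h2.toLp h - S) :=
    ((Lp.fourierTransformₗᵢ (RSpace d) ℂ).symm.map_sub (h2.toLp h) S).symm
  have e4 : ‖(𝓕⁻ (h2.toLp h - S) : L2Space d)‖ = ‖h2.toLp h - S‖ :=
    (Lp.fourierTransformₗᵢ (RSpace d) ℂ).symm.norm_map _
  rw [e2, e3, ← ofReal_norm, e4, ofReal_norm, Lp.enorm_def,
    eLpNorm_eq_lintegral_rpow_enorm_toReal (p := 2) (by norm_num) (by norm_num),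
      ← ENNReal.rpow_natCast, ← ENNReal.rpow_mul]
  simp only [ENNReal.toReal_ofNat, Nat.cast_ofNat, ENNReal.rpow_ofNat, one_div,
      inv_mul_cancel₀ (two_ne_zero (α := ℝ)), ENNReal.rpow_one]
  refine lintegral_congr_ae ?_
  filter_upwards [h2.coeFn_toLp, Lp.coeFn_sub (h2.toLp h) S, Lp.coeFn_lpSMul (p := ∞) (q := 2)
    (r := 2) ((schrodingerSymbol_memLp d t).toLp (schrodingerSymbol d t)) (𝓕 f : L2Space d),
    (schrodingerSymbol_memLp d t).coeFn_toLp] with ξ h3 h4 h5 h6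
  rw [h4, Pi.sub_apply, h3, hS, h5, Pi.smul_apply', h6, hh]
  simp only [heatWave_zero_snd, smul_eq_mul]
  have : ((Real.exp (-(4 * Real.pi ^ 2 * η * ‖ξ‖ ^ 2)) : ℂ) * schrodingerSymbol d t ξ *
      (𝓕 f : L2Space d) ξ - schrodingerSymbol d t ξ * (𝓕 f : L2Space d) ξ) =
      schrodingerSymbol d t ξ * (((Real.exp (-(4 * Real.pi ^ 2 * η * ‖ξ‖ ^ 2)) - 1 : ℝ) : ℂ) *
        (𝓕 f : L2Space d) ξ) := by
    push_cast; ring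
  rw [this, enorm_mul, ← ofReal_norm, norm_schrodingerSymbol, ENNReal.ofReal_one, one_mul]

open Filter Topology in
theorem tendsto_heatDefect (f : L2Space d) :
    Tendsto (fun η => heatDefect η f) (𝓝[>] 0) (𝓝 0) := by
  have h0 : (0 : ℝ≥0∞) = ∫⁻ _ : RSpace d, 0 := by simp
  rw [h0]
  refine tendsto_lintegral_filter_of_dominated_convergence
    (fun ξ => ‖(𝓕 f : L2Space d) ξ‖ₑ ^ 2) ?_ ?_ ?_ ?_
  · refine .of_forall fun η => ?_
    have := Lp.stronglyMeasurable (𝓕 f : L2Space d)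
    have := this.measurable
    fun_prop
  · filter_upwards [self_mem_nhdsWithin] with η hη
    refine .of_forall fun ξ => ?_
    rw [enorm_mul]
    gcongr
    refine mul_le_of_le_one_left (by positivity) ?_
    have hη' : 0 < η := hη
    have h1 : Real.exp (-(4 * Real.pi ^ 2 * η * ‖ξ‖ ^ 2)) ≤ 1 :=
      Real.exp_le_one_iff.2 (neg_nonpos.2 (by positivity))
    have h2 := Real.exp_pos (-(4 * Real.pi ^ 2 * η * ‖ξ‖ ^ 2))
    rw [← ofReal_norm, Complex.norm_real, Real.norm_eq_abs, ENNReal.ofReal_le_one, abs_le]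
    constructor <;> linarith
  · have h2 : ∫⁻ ξ, ‖(𝓕 f : L2Space d) ξ‖ₑ ^ 2 = ‖(𝓕 f : L2Space d)‖ₑ ^ 2 := by
      rw [Lp.enorm_def,
        eLpNorm_eq_lintegral_rpow_enorm_toReal (p := 2) (by norm_num) (by norm_num),
        ← ENNReal.rpow_natCast, ← ENNReal.rpow_mul]
      simp
    rw [h2]
    finiteness
  · refine .of_forall fun ξ => ?_
    have hc : Continuous fun η : ℝ => ‖((Real.exp (-(4 * Real.pi ^ 2 * η * ‖ξ‖ ^ 2)) - 1 : ℝ) : ℂ) *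
        (𝓕 f : L2Space d) ξ‖ₑ ^ 2 := by fun_prop
    have := hc.tendsto 0
    simp only [mul_zero, zero_mul, neg_zero, Real.exp_zero, sub_self, Complex.ofReal_zero,
      enorm_zero] at this
    simpa using this.mono_left nhdsWithin_le_nhds

open Filter Topology in
theorem exists_seq_heatDefect_le {ι : Type*} [Finite ι] (f : ι → L2Space d) :
    ∃ η : ℕ → ℝ, (∀ n, 0 < η n) ∧ ∀ n i, heatDefect (η n) (f i) ≤ 2⁻¹ ^ n := by
  have h : ∀ n : ℕ, ∃ η : ℝ, 0 < η ∧ ∀ i, heatDefect η (f i) ≤ 2⁻¹ ^ n := fun n => by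
    have h1 : ∀ᶠ η in 𝓝[>] (0 : ℝ), ∀ i, heatDefect η (f i) ≤ 2⁻¹ ^ n :=
      eventually_all.2 fun i => (tendsto_heatDefect (f i)).eventually_le_const
        (ENNReal.pow_pos (by simp) n)
    obtain ⟨η, h2, h3⟩ := (h1.and self_mem_nhdsWithin).exists
    exact ⟨η, h3, h2⟩
  choose η h1 h2 using h
  exact ⟨η, h1, h2⟩

-- The geometric rate makes the squared `L²` errors summable, which upgrades `L²` convergence to
-- convergence almost everywhere without passing to a subsequence depending on `t`.
open Filter Topology in
theorem ae_tendsto_heatEvol {η : ℕ → ℝ} (hη : ∀ n, 0 < η n) {f : L2Space d}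
    (h : ∀ n, heatDefect (η n) f ≤ 2⁻¹ ^ n) (t : ℝ) :
    ∀ᵐ x, Tendsto (fun n => heatEvol (η n) (𝓕 f) (t, x)) atTop (𝓝 (freeProp t f x)) := by
  have hm : ∀ n, Measurable fun x => ‖heatEvol (η n) (𝓕 f) (t, x) - freeProp t f x‖ₑ ^ 2 :=
    fun n => by
      have h1 := (measurable_heatEvol (η n) (𝓕 f)).comp (measurable_prodMk_left (x := t))
      have h2 := (Lp.stronglyMeasurable (freeProp t f)).measurable
      exact ((h1.sub h2).enorm).pow_const 2
  have hs : ∫⁻ x, ∑' n, ‖heatEvol (η n) (𝓕 f) (t, x) - freeProp t f x‖ₑ ^ 2 ≠ ∞ := by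
    rw [lintegral_tsum fun n => (hm n).aemeasurable]
    refine ne_top_of_le_ne_top ?_ (ENNReal.tsum_le_tsum fun n =>
      (lintegral_enorm_heatEvol_sub_freeProp_sq (hη n) t f).le.trans (h n))
    rw [ENNReal.tsum_geometric]
    simp
  filter_upwards [ae_lt_top (Measurable.tsum hm) hs] with x hx
  have h1 := ENNReal.tendsto_atTop_zero_of_tsum_ne_top hx.ne
  rw [tendsto_iff_edist_tendsto_0]
  have h2 := (ENNReal.continuous_rpow_const (y := 1 / 2)).tendsto 0 |>.comp h1
  rw [ENNReal.zero_rpow_of_pos (by norm_num)] at h2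
  refine h2.congr fun n => ?_
  rw [Function.comp_apply, ← ENNReal.rpow_natCast, ← ENNReal.rpow_mul, edist_eq_enorm_sub]
  norm_num

-- The propagator is given as a separate class of functions for each `t`. Joint measurability is
-- recovered from the pointwise limit of the regularised evolutions, which are jointly measurable.
open Filter Topology in
theorem exists_measurable_evol (f : L2Space d) : ∃ F : ℝ × RSpace d → ℂ, Measurable F ∧
    ∀ t, (fun x => F (t, x)) =ᵐ[volume] freeProp t f := by
  obtain ⟨η, hη, h⟩ := exists_seq_heatDefect_le fun _ : Unit => f
  refine ⟨fun X => limUnder atTop fun n => heatEvol (η n) (𝓕 f) X,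
    (StronglyMeasurable.limUnder fun n =>
      (measurable_heatEvol (η n) (𝓕 f)).stronglyMeasurable).measurable, fun t => ?_⟩
  filter_upwards [ae_tendsto_heatEvol hη (fun n => h n ()) t] with x hx
  exact hx.limUnder_eq

/-- A jointly measurable version of `(t, x) ↦ (e^{itΔ} f)(x)`. -/
noncomputable def evol (f : L2Space d) : ℝ × RSpace d → ℂ := (exists_measurable_evol f).choose

@[fun_prop]
theorem measurable_evol (f : L2Space d) : Measurable (evol f) :=
  (exists_measurable_evol f).choose_spec.1

theorem evol_ae_eq (f : L2Space d) (t : ℝ) : (fun x => evol f (t, x)) =ᵐ[volume] freeProp t f :=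
  (exists_measurable_evol f).choose_spec.2 t

theorem lintegral_enorm_evol_sq (f : L2Space d) (t : ℝ) :
    ∫⁻ x, ‖evol f (t, x)‖ₑ ^ 2 = ‖f‖ₑ ^ 2 := by
  rw [← lintegral_enorm_freeProp_sq t f]
  refine lintegral_congr_ae ?_
  filter_upwards [evol_ae_eq f t] with x hx
  rw [hx]

theorem ae_prod_of_forall_ae {p : ℝ × RSpace d → Prop} (hp : MeasurableSet {X | p X})
    (h : ∀ᵐ t : ℝ, ∀ᵐ x : RSpace d, p (t, x)) : ∀ᵐ X, p X := by
  rw [Measure.volume_eq_prod]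
  exact (Measure.ae_prod_iff_ae_ae hp).2 h

theorem evol_add (f g : L2Space d) : evol (f + g) =ᵐ[volume] fun X => evol f X + evol g X := by
  refine ae_prod_of_forall_ae (measurableSet_eq_fun (by fun_prop) (by fun_prop))
    (.of_forall fun t => ?_)
  filter_upwards [evol_ae_eq f t, evol_ae_eq g t, evol_ae_eq (f + g) t,
    Lp.coeFn_add (freeProp t f) (freeProp t g)] with x h1 h2 h3 h4
  rw [h1, h2, h3, freeProp_add, h4, Pi.add_apply]

theorem evol_smul (c : ℂ) (f : L2Space d) : evol (c • f) =ᵐ[volume] fun X => c * evol f X := by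
  refine ae_prod_of_forall_ae (measurableSet_eq_fun (by fun_prop) (by fun_prop))
    (.of_forall fun t => ?_)
  filter_upwards [evol_ae_eq f t, evol_ae_eq (c • f) t,
    Lp.coeFn_smul c (freeProp t f)] with x h1 h2 h3
  rw [h1, h2, freeProp_smul, h3, Pi.smul_apply, smul_eq_mul]

open Filter Topology in
theorem ae_tendsto_heatEvol_evol {η : ℕ → ℝ} (hη : ∀ n, 0 < η n) {f : L2Space d}
    (h : ∀ n, heatDefect (η n) f ≤ 2⁻¹ ^ n) :
    ∀ᵐ X, Tendsto (fun n => heatEvol (η n) (𝓕 f) X) atTop (𝓝 (evol f X)) := by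
  have hm : MeasurableSet {X | Tendsto (fun n => heatEvol (η n) (𝓕 f) X) atTop (𝓝 (evol f X))} :=
    measurableSet_tendsto_fun (fun n => measurable_heatEvol (η n) (𝓕 f)) (measurable_evol f)
  refine ae_prod_of_forall_ae hm (.of_forall fun t => ?_)
  filter_upwards [ae_tendsto_heatEvol hη h t, evol_ae_eq f t] with x h1 h2
  rwa [h2]

open Filter in
theorem sum_liminf_le_liminf_sum {ι : Type*} [Fintype ι] (a : ℕ → ι → ℝ≥0∞) :
    ∑ i, liminf (fun n => a n i) atTop ≤ liminf (fun n => ∑ i, a n i) atTop := by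
  let _ : MeasurableSpace ι := ⊤
  have := lintegral_liminf_le (μ := (Measure.count : Measure ι)) (f := a) (u := atTop)
    fun n => measurable_from_top
  simpa [lintegral_count, tsum_fintype] using this

open Filter in
theorem liminf_rpow {a : ℕ → ℝ≥0∞} {r : ℝ} (hr : 0 < r) :
    (liminf a atTop) ^ r = liminf (fun n => a n ^ r) atTop :=
  (ENNReal.orderIsoRpow r hr).liminf_apply

-- Fatou's lemma is used twice along the common sequence of regularisations, for the space-time
-- integrals and for the sum over `i`; the bound for the regularised evolution does not depend on η.
open Filter Topology in
theorem sum_lintegral_evol_rpow_le {V : ℝ × RSpace d → ℝ≥0∞} (hV : Measurable V)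
    {κ : ℝ} (hκ : κ = (d + 2) / 2) {ι : Type*} [Fintype ι] {u : ι → L2Space d}
    (hu : Orthonormal ℂ u) :
    ∑ i, (∫⁻ X, V X * ‖evol (u i) X‖ₑ ^ 2) ^ (2 * κ) ≤
      ENNReal.ofReal (steinConst κ) ^ (2 * κ) * (∫⁻ X, V X ^ κ) ^ 2 := by
  classical
  have hd0 : (0 : ℝ) ≤ d := Nat.cast_nonneg d
  have hκ0 : 0 < κ := by rw [hκ]; linarith
  by_cases hfin : ∫⁻ X, V X ^ κ = ∞
  · rw [hfin, ENNReal.top_pow two_ne_zero, ENNReal.mul_top]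
    · exact le_top
    · exact (ENNReal.rpow_pos (ENNReal.ofReal_pos.2 (steinConst_pos hκ0)) ENNReal.ofReal_ne_top).ne'
  have hVfin : ∀ᵐ X, V X ≠ ∞ := by
    filter_upwards [ae_lt_top (hV.pow_const κ) hfin] with X hX h
    simp [h, hκ0] at hX
  obtain ⟨η, hη, h⟩ := exists_seq_heatDefect_le u
  have hFu : Orthonormal ℂ fun i => (𝓕 (u i) : L2Space d) :=
    hu.comp_linearIsometry (Lp.fourierTransformₗᵢ (RSpace d) ℂ).toLinearIsometry
  have hF : ∀ i, ∫⁻ X, V X * ‖evol (u i) X‖ₑ ^ 2 ≤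
      liminf (fun n => ∫⁻ X, V X * ‖heatEvol (η n) (𝓕 (u i)) X‖ₑ ^ 2) atTop := fun i => by
    refine le_trans (le_of_eq ?_) (lintegral_liminf_le fun n =>
      hV.mul ((measurable_heatEvol (η n) _).enorm.pow_const 2))
    refine lintegral_congr_ae ?_
    filter_upwards [ae_tendsto_heatEvol_evol hη (fun n => h n i), hVfin] with X h1 h2
    refine (Tendsto.liminf_eq ?_).symm
    refine ENNReal.Tendsto.const_mul ?_ (.inr h2)
    exact ((ENNReal.continuous_pow 2).tendsto _).comp h1.enorm
  calc _ ≤ ∑ i, liminf (fun n => (∫⁻ X, V X * ‖heatEvol (η n) (𝓕 (u i)) X‖ₑ ^ 2) ^ (2 * κ)) atTop :=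
        Finset.sum_le_sum fun i _ => by
          rw [← liminf_rpow (by positivity)]
          gcongr
          exact hF i
    _ ≤ _ := sum_liminf_le_liminf_sum _
    _ ≤ _ := by
      refine liminf_le_of_le (by isBoundedDefault) fun b hb => ?_
      obtain ⟨n, hn⟩ := hb.exists
      exact hn.trans (sum_lintegral_heatEvol_rpow_le hV (hη n) hκ hFu)

end

/-! ### From the diagonal to mixed norms -/

section

variable {d : ℕ}

theorem mul_eq_rpow_mul_rpow {b v s : ℝ≥0∞} (hb0 : b ≠ 0) (hb : b ≠ ∞) {θ : ℝ} (hθ : 0 < θ)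
    (hθ1 : θ ≤ 1) :
    v * s = (b * s) ^ (1 - θ) * ((v * b ^ (-(1 - θ))) ^ (1 / θ) * s) ^ θ := by
  rw [ENNReal.mul_rpow_of_nonneg _ _ (sub_nonneg.2 hθ1), ENNReal.mul_rpow_of_nonneg _ _ hθ.le,
    ← ENNReal.rpow_mul, one_div, inv_mul_cancel₀ hθ.ne', ENNReal.rpow_one]
  have h1 : b ^ (1 - θ) * b ^ (-(1 - θ)) = 1 := by
    rw [← ENNReal.rpow_add _ _ hb0 hb, add_neg_cancel, ENNReal.rpow_zero]
  have h2 : s ^ (1 - θ) * s ^ θ = s := by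
    rw [← ENNReal.rpow_add_of_nonneg _ _ (sub_nonneg.2 hθ1) hθ.le, sub_add_cancel, ENNReal.rpow_one]
  calc v * s = v * (b ^ (1 - θ) * b ^ (-(1 - θ))) * (s ^ (1 - θ) * s ^ θ) := by
        rw [h1, h2, mul_one]
    _ = _ := by ring

theorem lintegral_prodVol {f : ℝ × RSpace d → ℝ≥0∞} (hf : Measurable f) :
    ∫⁻ X, f X = ∫⁻ t, ∫⁻ x, f (t, x) := by
  rw [Measure.volume_eq_prod, lintegral_prod _ hf.aemeasurable]

/-- Orthonormal Strichartz estimate for the densities tested against a nonnegative potential. -/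
theorem sum_lintegral_evol_rpow_le_mixed {V : ℝ × RSpace d → ℝ≥0∞} (hV : Measurable V)
    {κ p' q' : ℝ} (hκ : κ = (d + 2) / 2) (hp' : 1 ≤ p') (hq' : κ ≤ q')
    (hpq : 2 / p' + d / q' = 2) {ι : Type*} [Fintype ι] {u : ι → L2Space d}
    (hu : Orthonormal ℂ u) :
    ∑ i, (∫⁻ X, V X * ‖evol (u i) X‖ₑ ^ 2) ^ (2 * q') ≤
      ENNReal.ofReal (steinConst κ) ^ (2 * κ) *
        (∫⁻ t, (∫⁻ x, V (t, x) ^ q') ^ (p' / q')) ^ (2 * q' / p') := by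
  have hd0 : (0 : ℝ) ≤ d := Nat.cast_nonneg d
  have hκ1 : 1 ≤ κ := by rw [hκ]; linarith
  have hκ0 : 0 < κ := by linarith
  have hq0 : 0 < q' := by linarith
  have hp0 : 0 < p' := by linarith
  have hC : ENNReal.ofReal (steinConst κ) ^ (2 * κ) ≠ 0 :=
    (ENNReal.rpow_pos (ENNReal.ofReal_pos.2 (steinConst_pos hκ0)) ENNReal.ofReal_ne_top).ne'
  -- Interpolation parameter between unitarity (θ = 0) and the diagonal estimate (θ = 1).
  set θ := κ / q' with hθ
  have hθ0 : 0 < θ := by positivity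
  have hθ1 : θ ≤ 1 := (div_le_one hq0).2 hq'
  -- The scaling relation gives q'/p' = q' - d/2, while (1 - θ)q' = q' - d/2 - 1.
  have hθp : q' / p' - (1 - θ) * q' = 1 := by
    rw [hθ]; field_simp at hpq ⊢; rw [hκ]; linarith
  set a : ℝ → ℝ≥0∞ := fun t => ∫⁻ x, V (t, x) ^ q' with ha
  set b : ℝ → ℝ≥0∞ := fun t => a t ^ (p' / q') with hb
  set N := ∫⁻ t, b t with hN
  have ham : Measurable a := (hV.pow_const q').lintegral_prod_right'
  have hbm : Measurable b := ham.pow_const _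
  by_cases hNt : N = ∞
  · rw [hNt, ENNReal.top_rpow_of_pos (by positivity), ENNReal.mul_top hC]
    exact le_top
  have hbt : ∀ᵐ t, b t < ∞ := ae_lt_top hbm hNt
  have hba : ∀ t, b t ^ (q' / p') = a t := fun t => by
    rw [hb, ← ENNReal.rpow_mul]
    have : p' / q' * (q' / p') = 1 := by field_simp
    rw [this, ENNReal.rpow_one]
  -- With b(t) = ‖V(t)‖_{q'}^{p'}, this is the potential for which V = b^{1-θ} W^θ. The power of b
  -- is such that W^κ integrates in `x` to b(t), so both factors in Hölder's inequality are governed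
  -- by N.
  set W : ℝ × RSpace d → ℝ≥0∞ := fun X => (V X * b X.1 ^ (-(1 - θ))) ^ (1 / θ) with hW
  have hWm : Measurable W := (hV.mul ((hbm.comp measurable_fst).pow_const _)).pow_const _
  have hWκ : ∫⁻ X, W X ^ κ ≤ N := by
    rw [lintegral_prodVol (hWm.pow_const κ)]
    refine lintegral_mono_ae ?_
    filter_upwards [hbt] with t ht
    have h1 : ∀ x, W (t, x) ^ κ = V (t, x) ^ q' * b t ^ (-((1 - θ) * q')) := fun x => by
      simp only [hW]
      have : 1 / θ * κ = q' := by rw [hθ]; field_simp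
      rw [← ENNReal.rpow_mul, this, ENNReal.mul_rpow_of_nonneg _ _ hq0.le, ← ENNReal.rpow_mul,
        neg_mul]
    simp_rw [h1]
    have h2 : Measurable fun x => V (t, x) ^ q' := (hV.comp measurable_prodMk_left).pow_const q'
    rw [lintegral_mul_const _ h2]
    change a t * _ ≤ _
    by_cases hb0 : b t = 0
    · have : a t = 0 := by rw [← hba, hb0, ENNReal.zero_rpow_of_pos (by positivity)]
      rw [this, zero_mul]
      exact zero_le
    · rw [← hba, ← ENNReal.rpow_add _ _ hb0 ht.ne, ← sub_eq_add_neg, hθp, ENNReal.rpow_one]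
  have hZ : ∀ i, ∫⁻ X, V X * ‖evol (u i) X‖ₑ ^ 2 ≤
      N ^ (1 - θ) * (∫⁻ X, W X * ‖evol (u i) X‖ₑ ^ 2) ^ θ := fun i => by
    have hFm : Measurable fun X => ‖evol (u i) X‖ₑ ^ 2 := by fun_prop
    have hbF : Measurable fun X : ℝ × RSpace d => b X.1 * ‖evol (u i) X‖ₑ ^ 2 :=
      (hbm.comp measurable_fst).mul hFm
    -- The trivial endpoint: a potential depending only on time sees only the conserved `L²` norm.
    have h1 : ∫⁻ X, b X.1 * ‖evol (u i) X‖ₑ ^ 2 = N := by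
      rw [lintegral_prodVol hbF]
      refine lintegral_congr fun t => ?_
      have h2 : Measurable fun x => ‖evol (u i) (t, x)‖ₑ ^ 2 := hFm.comp measurable_prodMk_left
      change ∫⁻ x, b t * ‖evol (u i) (t, x)‖ₑ ^ 2 = b t
      rw [lintegral_const_mul _ h2, lintegral_enorm_evol_sq,
        ← ofReal_norm, hu.1 i]
      simp
    rw [← h1]
    refine le_trans ?_ (ENNReal.lintegral_mul_norm_pow_le
      hbF.aemeasurable (hWm.mul hFm).aemeasurable
      (sub_nonneg.2 hθ1) hθ0.le (sub_add_cancel 1 θ))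
    refine lintegral_mono_ae ?_
    refine ae_prod_of_forall_ae (measurableSet_le (hV.mul hFm) ((hbF.pow_const _).mul ((hWm.mul hFm).pow_const _))) ?_
    filter_upwards [hbt] with t ht
    -- The factorisation of V needs b ≠ 0. Where b(t) = 0, V(t, ·) vanishes almost everywhere.
    by_cases hb0 : b t = 0
    · have h2 : a t = 0 := by rw [← hba, hb0, ENNReal.zero_rpow_of_pos (by positivity)]
      have h3 := (lintegral_eq_zero_iff ((hV.comp measurable_prodMk_left).pow_const q')).1 h2
      filter_upwards [h3] with x hx
      have hx' : V (t, x) = 0 := by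
        have : V (t, x) ^ q' = 0 := hx
        simpa [hq0, hq0.not_gt] using this
      rw [hx', zero_mul]
      exact zero_le
    · exact .of_forall fun x => (mul_eq_rpow_mul_rpow hb0 ht.ne hθ0 hθ1).le
  calc ∑ i, (∫⁻ X, V X * ‖evol (u i) X‖ₑ ^ 2) ^ (2 * q')
      ≤ ∑ i, N ^ ((1 - θ) * (2 * q')) * (∫⁻ X, W X * ‖evol (u i) X‖ₑ ^ 2) ^ (2 * κ) := by
        refine Finset.sum_le_sum fun i _ => ?_
        refine (ENNReal.rpow_le_rpow (hZ i) (by positivity)).trans (le_of_eq ?_)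
        have : θ * (2 * q') = 2 * κ := by rw [hθ]; field_simp
        rw [ENNReal.mul_rpow_of_nonneg _ _ (by positivity), ← ENNReal.rpow_mul, ← ENNReal.rpow_mul,
          this]
    _ ≤ N ^ ((1 - θ) * (2 * q')) * (ENNReal.ofReal (steinConst κ) ^ (2 * κ) * N ^ 2) := by
        rw [← Finset.mul_sum]
        gcongr
        refine (sum_lintegral_evol_rpow_le hWm hκ hu).trans ?_
        gcongr
    _ = _ := by
        have h1 : (1 - θ) * (2 * q') + 2 = 2 * q' / p' := by linear_combination (-2) * hθp
        rw [mul_left_comm, ← ENNReal.rpow_natCast N 2,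
          ← ENNReal.rpow_add_of_nonneg _ _ (mul_nonneg (sub_nonneg.2 hθ1) (by positivity)) (by simp)]
        norm_num [h1]

end

/-! ### Duality in mixed norms and the orthonormal Strichartz inequality -/

section

variable {d : ℕ}

/-- Testing with the extremiser V = a(t)^{p/q - 1} ρ^{q-1}, a(t) = ∫ ρ(t,·)^q, gives I ≤ B I^{1/p'}
for the integral I on the left. Finiteness of I allows the division, and q ≤ p makes the power of a
nonnegative. -/
theorem lintegral_mixed_le_of_dual_of_ne_top {ρ : ℝ × RSpace d → ℝ≥0∞} (hρ : Measurable ρ)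
    {p q p' q' : ℝ} (hp : p.HolderConjugate p') (hq : q.HolderConjugate q') (hqp : q ≤ p)
    {B : ℝ≥0∞} (h : ∀ V : ℝ × RSpace d → ℝ≥0∞, Measurable V → ∫⁻ X, V X * ρ X ≤
      B * (∫⁻ t, (∫⁻ x, V (t, x) ^ q') ^ (p' / q')) ^ (1 / p'))
    (hfin : ∫⁻ t, (∫⁻ x, ρ (t, x) ^ q) ^ (p / q) ≠ ∞) :
    ∫⁻ t, (∫⁻ x, ρ (t, x) ^ q) ^ (p / q) ≤ B ^ p := by
  have hp0 := hp.pos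
  have hq0 := hq.pos
  have hp0' := hp.symm.pos
  have hq0' := hq.symm.pos
  have hpe := hp.sub_one_mul_conj
  have hqe := hq.sub_one_mul_conj
  have hq1 := hq.lt
  set a : ℝ → ℝ≥0∞ := fun t => ∫⁻ x, ρ (t, x) ^ q with ha
  have ham : Measurable a := (hρ.pow_const q).lintegral_prod_right'
  set s := p / q - 1 with hs
  have hs0 : 0 ≤ s := sub_nonneg.2 ((one_le_div hq0).2 hqp)
  have hρt : ∀ r : ℝ, ∀ t, Measurable fun x => ρ (t, x) ^ r := fun r t =>
    (hρ.comp measurable_prodMk_left).pow_const r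
  have hVm : Measurable fun X : ℝ × RSpace d => a X.1 ^ s * ρ X ^ (q - 1) :=
    ((ham.comp measurable_fst).pow_const s).mul (hρ.pow_const _)
  have key := h _ hVm
  have e1 : ∫⁻ X, a X.1 ^ s * ρ X ^ (q - 1) * ρ X = ∫⁻ t, a t ^ (p / q) := by
    have hVρ : Measurable fun X : ℝ × RSpace d => a X.1 ^ s * ρ X ^ (q - 1) * ρ X := hVm.mul hρ
    rw [lintegral_prodVol hVρ]
    refine lintegral_congr fun t => ?_
    have : ∀ x, a t ^ s * ρ (t, x) ^ (q - 1) * ρ (t, x) = a t ^ s * ρ (t, x) ^ q := fun x => by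
      rw [mul_assoc]
      congr 1
      nth_rewrite 2 [← ENNReal.rpow_one (ρ (t, x))]
      rw [← ENNReal.rpow_add_of_nonneg _ _ (by linarith) zero_le_one, sub_add_cancel]
    simp_rw [this]
    rw [lintegral_const_mul _ (hρt q t)]
    change a t ^ s * a t = _
    nth_rewrite 2 [← ENNReal.rpow_one (a t)]
    rw [← ENNReal.rpow_add_of_nonneg _ _ hs0 zero_le_one, hs, sub_add_cancel]
  have e2 : ∀ t, (∫⁻ x, (a t ^ s * ρ (t, x) ^ (q - 1)) ^ q') ^ (p' / q') = a t ^ (p / q) :=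
      fun t => by
    simp_rw [ENNReal.mul_rpow_of_nonneg _ _ hq0'.le, ← ENNReal.rpow_mul, hqe]
    rw [lintegral_const_mul _ (hρt q t)]
    change (a t ^ (s * q') * a t) ^ (p' / q') = _
    rw [ENNReal.mul_rpow_of_nonneg _ _ (by positivity), ← ENNReal.rpow_mul,
      ← ENNReal.rpow_add_of_nonneg _ _ (by positivity) (by positivity)]
    congr 1
    have h3 : s * q' * (p' / q') = s * p' := by field_simp
    have h4 : p' / q' = p' - p' / q := by
      field_simp
      linear_combination -hqe
    rw [h3, h4, hs]
    field_simp
    linear_combination hpe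
  rw [e1] at key
  simp_rw [e2] at key
  set I := ∫⁻ t, a t ^ (p / q) with hI
  by_cases hI0 : I = 0
  · rw [hI0]; exact zero_le
  have h5 : I ^ (1 / p) * I ^ (1 / p') = I := by
    rw [← ENNReal.rpow_add _ _ hI0 hfin, one_div, one_div, hp.inv_add_inv_eq_one, ENNReal.rpow_one]
  have h6 : I ^ (1 / p) ≤ B := by
    have h7 : I ^ (1 / p) * I ^ (1 / p') ≤ B * I ^ (1 / p') := by rw [h5]; exact key
    exact (ENNReal.mul_le_mul_iff_left (ENNReal.rpow_pos (pos_iff_ne_zero.2 hI0) hfin).ne'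
      (ENNReal.rpow_ne_top_of_nonneg (by positivity) hfin)).1 h7
  calc I = (I ^ (1 / p)) ^ p := by
        rw [← ENNReal.rpow_mul, one_div, inv_mul_cancel₀ hp0.ne', ENNReal.rpow_one]
    _ ≤ B ^ p := by gcongr

-- The bound passes to minorants of ρ. Cutting ρ off to a box and to height n makes the integral
-- finite, and monotone convergence in `x` and then in `t` removes the cutoff.
open Filter Topology in
theorem lintegral_mixed_le_of_dual {ρ : ℝ × RSpace d → ℝ≥0∞} (hρ : Measurable ρ)
    {p q p' q' : ℝ} (hp : p.HolderConjugate p') (hq : q.HolderConjugate q') (hqp : q ≤ p)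
    {B : ℝ≥0∞} (h : ∀ V : ℝ × RSpace d → ℝ≥0∞, Measurable V → ∫⁻ X, V X * ρ X ≤
      B * (∫⁻ t, (∫⁻ x, V (t, x) ^ q') ^ (p' / q')) ^ (1 / p')) :
    ∫⁻ t, (∫⁻ x, ρ (t, x) ^ q) ^ (p / q) ≤ B ^ p := by
  have hp0 := hp.pos
  have hq0 := hq.pos
  set S : ℕ → Set (ℝ × RSpace d) := fun n =>
    Set.Icc (-(n : ℝ)) n ×ˢ Metric.closedBall (0 : RSpace d) n with hS
  have hSm : ∀ n, MeasurableSet (S n) := fun n =>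
    measurableSet_Icc.prod Metric.isClosed_closedBall.measurableSet
  set r : ℕ → ℝ × RSpace d → ℝ≥0∞ := fun n => (S n).indicator fun X => min (ρ X) n with hr
  have hrm : ∀ n, Measurable (r n) := fun n => (hρ.min measurable_const).indicator (hSm n)
  have hrle : ∀ n X, r n X ≤ ρ X := fun n X =>
    Set.indicator_apply_le fun _ => min_le_left _ _
  have hmono : ∀ X, Monotone fun n => r n X := fun X => by
    intro m n hmn
    have h1 : (m : ℝ) ≤ n := by exact_mod_cast hmn
    have h2 : S m ⊆ S n := Set.prod_mono (Set.Icc_subset_Icc (by linarith) h1)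
      (Metric.closedBall_subset_closedBall h1)
    refine (Set.indicator_le_indicator_of_subset h2 (fun _ => zero_le) X).trans ?_
    refine Set.indicator_le_indicator ?_
    gcongr
  have hlim : ∀ X, Tendsto (fun n => r n X) atTop (𝓝 (ρ X)) := fun X => by
    have h1 : Tendsto (fun n : ℕ => min (ρ X) n) atTop (𝓝 (min (ρ X) ∞)) :=
      tendsto_const_nhds.min ENNReal.tendsto_nat_nhds_top
    rw [min_eq_left le_top] at h1
    refine h1.congr' ?_
    have h2 : ∀ᶠ n : ℕ in atTop, max |X.1| ‖X.2‖ ≤ n :=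
      tendsto_natCast_atTop_atTop.eventually_ge_atTop _
    filter_upwards [h2] with n hn
    have : X ∈ S n := ⟨abs_le.1 ((le_max_left _ _).trans hn), by
      simpa using (le_max_right _ _).trans hn⟩
    simp only [hr, Set.indicator_of_mem this]
  have hrt : ∀ n t, Measurable fun x => r n (t, x) ^ q := fun n t =>
    ((hrm n).comp measurable_prodMk_left).pow_const q
  have hfin : ∀ n, ∫⁻ t, (∫⁻ x, r n (t, x) ^ q) ^ (p / q) ≠ ∞ := fun n => by
    set c : ℝ≥0∞ := ((n : ℝ≥0∞) ^ q * volume (Metric.closedBall (0 : RSpace d) n)) ^ (p / q) with hc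
    have hcf : c ≠ ∞ := by
      refine ENNReal.rpow_ne_top_of_nonneg (by positivity) (ENNReal.mul_ne_top ?_
        measure_closedBall_lt_top.ne)
      exact ENNReal.rpow_ne_top_of_nonneg hq0.le (by simp)
    refine ne_top_of_le_ne_top ?_ (lintegral_mono (g := (Set.Icc (-(n : ℝ)) n).indicator
      fun _ => c) fun t => ?_)
    · rw [lintegral_indicator_const measurableSet_Icc]
      exact ENNReal.mul_ne_top hcf (by simp)
    · by_cases ht : t ∈ Set.Icc (-(n : ℝ)) n
      · rw [Set.indicator_of_mem ht, hc]
        refine ENNReal.rpow_le_rpow ?_ (by positivity)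
        rw [← lintegral_indicator_const Metric.isClosed_closedBall.measurableSet]
        refine lintegral_mono fun x => ?_
        by_cases hx : x ∈ Metric.closedBall (0 : RSpace d) n
        · rw [Set.indicator_of_mem hx]
          have : r n (t, x) ≤ n := Set.indicator_apply_le' (fun _ => min_le_right _ _) fun _ => zero_le
          exact ENNReal.rpow_le_rpow this hq0.le
        · have : (t, x) ∉ S n := fun h => hx h.2
          simp [hr, this, hq0]
      · have : ∀ x, r n (t, x) = 0 := fun x => Set.indicator_of_notMem (fun h => ht h.1) _
        simp only [this, ENNReal.zero_rpow_of_pos hq0, lintegral_zero]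
        rw [ENNReal.zero_rpow_of_pos (by positivity)]
        exact zero_le
  have hle : ∀ n, ∫⁻ t, (∫⁻ x, r n (t, x) ^ q) ^ (p / q) ≤ B ^ p := fun n =>
    lintegral_mixed_le_of_dual_of_ne_top (hrm n) hp hq hqp (fun V hV =>
      (lintegral_mono fun X => mul_le_mul_right (hrle n X) _).trans (h V hV)) (hfin n)
  refine le_of_tendsto' (lintegral_tendsto_of_tendsto_of_monotone (fun n =>
    ((((hrm n).pow_const q).lintegral_prod_right').pow_const _).aemeasurable) ?_ ?_) hle
  · refine .of_forall fun t m n hmn => ?_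
    refine ENNReal.rpow_le_rpow (lintegral_mono fun x => ?_) (by positivity)
    exact ENNReal.rpow_le_rpow (hmono (t, x) hmn) hq0.le
  · refine .of_forall fun t => ?_
    refine ((ENNReal.continuous_rpow_const (y := p / q)).tendsto _).comp ?_
    refine lintegral_tendsto_of_tendsto_of_monotone (fun n => (hrt n t).aemeasurable) ?_ ?_
    · exact .of_forall fun x m n hmn => ENNReal.rpow_le_rpow (hmono (t, x) hmn) hq0.le
    · exact .of_forall fun x =>
        ((ENNReal.continuous_rpow_const (y := q)).tendsto _).comp (hlim (t, x))

/-- The constant of the Strichartz inequalities. -/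
noncomputable def strichartzConst (d : ℕ) (q' : ℝ) : ℝ≥0 :=
  (steinConst (((d : ℝ) + 2) / 2)).toNNReal ^ (((d : ℝ) + 2) / 2 / q')

theorem sum_lintegral_evol_rpow_rpow_le {V : ℝ × RSpace d → ℝ≥0∞} (hV : Measurable V)
    {p' q' : ℝ} (hp' : 1 ≤ p') (hq' : 1 + (d : ℝ) / 2 ≤ q')
    (hpq : 2 / p' + d / q' = 2) {ι : Type*} [Fintype ι] {u : ι → L2Space d}
    (hu : Orthonormal ℂ u) :
    ∑ i, (∫⁻ X, V X * ‖evol (u i) X‖ₑ ^ 2) ^ (2 * q') ≤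
      (strichartzConst d q' *
        (∫⁻ t, (∫⁻ x, V (t, x) ^ q') ^ (p' / q')) ^ (1 / p')) ^ (2 * q') := by
  have hd0 : (0 : ℝ) ≤ d := Nat.cast_nonneg d
  have hq0 : 0 < q' := by linarith
  have hp0 : 0 < p' := by linarith
  refine (sum_lintegral_evol_rpow_le_mixed hV rfl hp' (by linarith) hpq hu).trans (le_of_eq ?_)
  rw [ENNReal.mul_rpow_of_nonneg _ _ (by positivity), ← ENNReal.rpow_mul, strichartzConst,
    ENNReal.coe_rpow_of_nonneg _ (by positivity), ← ENNReal.rpow_mul, ENNReal.ofReal]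
  congr 2
  · field_simp
  · field_simp

/-- Hölder's inequality for sums: 2q/(q+1) is the exponent conjugate to 2q'. -/
theorem tsum_mul_lintegral_evol_le {V : ℝ × RSpace d → ℝ≥0∞} (hV : Measurable V)
    {p' q' q : ℝ} (hp' : 1 ≤ p') (hq' : 1 + (d : ℝ) / 2 ≤ q')
    (hpq : 2 / p' + d / q' = 2) (hq : q.HolderConjugate q') {ι : Type*} {u : ι → L2Space d}
    (hu : Orthonormal ℂ u) (a : ι → ℝ≥0∞) :
    ∑' i, a i * ∫⁻ X, V X * ‖evol (u i) X‖ₑ ^ 2 ≤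
      (∑' i, a i ^ (2 * q / (q + 1))) ^ ((q + 1) / (2 * q)) * (strichartzConst d q' *
        (∫⁻ t, (∫⁻ x, V (t, x) ^ q') ^ (p' / q')) ^ (1 / p')) := by
  have hq0 := hq.pos
  have hq0' := hq.symm.pos
  have hc : (2 * q / (q + 1)).HolderConjugate (2 * q') := by
    have h1 := hq.lt
    have h2 := hq.sub_one_mul_conj
    rw [Real.holderConjugate_iff]
    refine ⟨by rw [lt_div_iff₀ (by linarith)]; linarith, ?_⟩
    rw [inv_div]
    field_simp
    linear_combination -h2
  rw [ENNReal.tsum_eq_iSup_sum]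
  refine iSup_le fun s => ?_
  refine (ENNReal.inner_le_Lp_mul_Lq s a _ hc).trans ?_
  have h3 : 1 / (2 * q / (q + 1)) = (q + 1) / (2 * q) := by rw [one_div, inv_div]
  rw [h3]
  gcongr
  · exact ENNReal.sum_le_tsum s
  · rw [← Finset.sum_coe_sort, one_div, ENNReal.rpow_inv_le_iff (by positivity)]
    exact sum_lintegral_evol_rpow_rpow_le hV hp' hq' hpq (hu.comp _ Subtype.val_injective)

theorem orthonormalStrichartz {p q p' q' : ℝ} (hp' : 1 ≤ p') (hq' : 1 + (d : ℝ) / 2 ≤ q')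
    (hpq : 2 / p' + d / q' = 2) (hp : p.HolderConjugate p') (hq : q.HolderConjugate q') :
    OrthonormalStrichartz d p q (strichartzConst d q') := by
  intro ι _ u n hu hn
  have hp0 := hp.pos
  have hq0 := hq.pos
  have hp0' := hp.symm.pos
  have hq0' := hq.symm.pos
  -- By scaling 1/p = d/(2q'), while 1/q = 1 - 1/q'; the comparison is exactly 1 + d/2 ≤ q'.
  have hqp : q ≤ p := by
    have h1 := hp.inv_add_inv_eq_one
    have h2 := hq.inv_add_inv_eq_one
    have h3 : p'⁻¹ = 1 - d / 2 * q'⁻¹ := by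
      have : 2 * p'⁻¹ + d * q'⁻¹ = 2 := by
        rw [div_eq_mul_inv, div_eq_mul_inv] at hpq; exact hpq
      linarith
    have h4 : (1 + (d : ℝ) / 2) * q'⁻¹ ≤ 1 := by
      rw [← div_eq_mul_inv]; exact (div_le_one hq0').2 hq'
    rw [← inv_le_inv₀ hp0 hq0]
    linarith
  set A := (∑' j, ‖n j‖ₑ ^ (2 * q / (q + 1))) ^ ((q + 1) / (2 * q)) with hA
  have hAfin : A ≠ ∞ := ENNReal.rpow_ne_top_of_nonneg (by positivity) hn.ne
  have hFm : ∀ j, Measurable fun X => ‖evol (u j) X‖ₑ ^ 2 := fun j => by fun_prop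
  -- The density with absolute values: its finiteness gives absolute convergence, and it dominates
  -- the actual density.
  set ρ : ℝ × RSpace d → ℝ≥0∞ := fun X => ∑' j, ‖n j‖ₑ * ‖evol (u j) X‖ₑ ^ 2 with hρ
  have hρm : Measurable ρ := Measurable.tsum fun j => (hFm j).const_mul _
  have key : ∫⁻ t, (∫⁻ x, ρ (t, x) ^ q) ^ (p / q) ≤ (strichartzConst d q' * A) ^ p := by
    refine lintegral_mixed_le_of_dual hρm hp hq hqp fun V hV => ?_
    refine le_trans (le_of_eq ?_) ((tsum_mul_lintegral_evol_le hV hp' hq' hpq hq hu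
      fun j => ‖n j‖ₑ).trans (le_of_eq (by ring)))
    simp_rw [hρ, ← ENNReal.tsum_mul_left]
    have hm1 : ∀ j, Measurable fun X => V X * (‖n j‖ₑ * ‖evol (u j) X‖ₑ ^ 2) := fun j =>
      hV.mul ((hFm j).const_mul _)
    have hm2 : ∀ j, Measurable fun X => V X * ‖evol (u j) X‖ₑ ^ 2 := fun j => hV.mul (hFm j)
    rw [lintegral_tsum fun j => (hm1 j).aemeasurable]
    congr 1
    ext j
    rw [← lintegral_const_mul _ (hm2 j)]
    exact lintegral_congr fun X => by ring
  have hae : ∀ t, ∀ᵐ x, ∀ j, evol (u j) (t, x) = freeProp t (u j) x := fun t =>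
    ae_all_iff.2 fun j => evol_ae_eq (u j) t
  have hnorm : ∀ (j : ι) (z : ℂ), ‖n j * (‖z‖ : ℂ) ^ 2‖ₑ = ‖n j‖ₑ * ‖z‖ₑ ^ 2 := fun j z => by
    rw [enorm_mul, enorm_pow]
    congr 2
    rw [← ofReal_norm, Complex.norm_real, norm_norm, ofReal_norm]
  constructor
  · have h1 : ∀ᵐ t, (∫⁻ x, ρ (t, x) ^ q) ^ (p / q) < ∞ := by
      refine ae_lt_top (((hρm.pow_const q).lintegral_prod_right').pow_const _)
        (ne_top_of_le_ne_top ?_ key)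
      finiteness
    filter_upwards [h1] with t ht
    have h2 : ∫⁻ x, ρ (t, x) ^ q ≠ ∞ := fun h => by
      rw [h, ENNReal.top_rpow_of_pos (by positivity)] at ht
      exact ht.ne rfl
    filter_upwards [ae_lt_top ((hρm.comp measurable_prodMk_left).pow_const q) h2, hae t]
      with x hx hx2
    have h3 : ρ (t, x) ≠ ∞ := fun h => by
      change ρ (t, x) ^ q < ∞ at hx
      rw [h, ENNReal.top_rpow_of_pos hq0] at hx
      exact hx.ne rfl
    refine Summable.of_enorm ?_
    simp_rw [hnorm, ← hx2]
    exact h3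
  · rw [mixedNorm, one_div, ENNReal.rpow_inv_le_iff hp0]
    refine le_trans (lintegral_mono fun t => ?_) key
    refine ENNReal.rpow_le_rpow (lintegral_mono_ae ?_) (by positivity)
    filter_upwards [hae t] with x hx
    refine ENNReal.rpow_le_rpow (enorm_tsum_le_tsum_enorm.trans (le_of_eq ?_)) hq0.le
    simp_rw [hnorm, hρ, hx]

end

/-! ### Schatten norms from sums over orthonormal systems -/

section Schatten

variable {H : Type*} [NormedAddCommGroup H] [InnerProductSpace ℂ H]

theorem norm_inner_map_self_of_smul (A : H →L[ℂ] H) (v : H) (hv : A v ≠ 0) :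
    ‖⟪((‖A v‖⁻¹ : ℝ) : ℂ) • A v, A v⟫_ℂ‖ = ‖A v‖ := by
  have h : ‖A v‖ ≠ 0 := norm_ne_zero_iff.2 hv
  rw [inner_smul_left, inner_self_eq_norm_sq_to_K, Complex.conj_ofReal, norm_mul, norm_pow,
    Complex.norm_real, RCLike.norm_ofReal, abs_norm, norm_inv, norm_norm]
  field_simp

/-- After diagonalising the Gram matrix of the images, the normalised nonzero A v_i form an
orthonormal system, and the pairing of A v_i with its own direction is ‖A v_i‖. Convexity of x^{r/2}
requires r ≥ 2. -/
theorem sum_norm_map_rpow_le (A : H →L[ℂ] H) {r K : ℝ} (hr : 2 ≤ r)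
    (hA : ∀ (ι : Type) [Fintype ι] (f g : ι → H), Orthonormal ℂ f → Orthonormal ℂ g →
      ∑ i, ‖⟪f i, A (g i)⟫_ℂ‖ ^ r ≤ K ^ r)
    {ι : Type} [Fintype ι] {u : ι → H} (hu : Orthonormal ℂ u) : ∑ i, ‖A (u i)‖ ^ r ≤ K ^ r := by
  classical
  have hpow : ∀ x : H, (‖A x‖ ^ 2) ^ (r / 2) = ‖A x‖ ^ r := fun x => by
    rw [← Real.rpow_natCast, ← Real.rpow_mul (norm_nonneg _)]
    congr 1
    push_cast
    ring
  have key := sum_norm_map_pow_le_of_orthogonal (A : H →ₗ[ℂ] H) (r := r / 2) (M := K ^ r)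
    (by linarith) (fun v hv hvo => ?_) hu
  · simpa only [ContinuousLinearMap.coe_coe, hpow] using key
  · simp only [ContinuousLinearMap.coe_coe, hpow] at hvo ⊢
    have h1 := hA {i // A (v i) ≠ 0} (fun i => ((‖A (v i)‖⁻¹ : ℝ) : ℂ) • A (v i))
      (fun i => v i) ⟨fun i => ?_, fun i j hij => ?_⟩ (hv.comp _ Subtype.val_injective)
    · refine le_trans (le_of_eq ?_) h1
      rw [← Finset.sum_filter_of_ne (p := fun i => A (v i) ≠ 0), Finset.sum_subtype (p := fun i => A (v i) ≠ 0)]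
      · exact Finset.sum_congr rfl fun i _ => by
          rw [norm_inner_map_self_of_smul A _ i.2]
      · simp
      · intro i _ h h0
        rw [h0, norm_zero, Real.zero_rpow (by linarith)] at h
        exact h rfl
    · have : ‖A (v i)‖ ≠ 0 := norm_ne_zero_iff.2 i.2
      rw [norm_smul, Complex.norm_real, norm_inv, norm_norm, inv_mul_cancel₀ this]
    · change ⟪((‖A (v i)‖⁻¹ : ℝ) : ℂ) • A (v i), ((‖A (v j)‖⁻¹ : ℝ) : ℂ) • A (v j)⟫_ℂ = 0
      rw [inner_smul_left, inner_smul_right, hvo i j fun h => hij (Subtype.ext h), mul_zero,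
        mul_zero]

/-- A subspace on which `A` is bounded below is finite-dimensional when the `ℓ^r` sums of `‖A u_i‖`
over finite orthonormal systems are bounded. -/
theorem finiteDimensional_of_sum_norm_map_rpow_le (A : H →L[ℂ] H) {r K ε : ℝ} (hε : 0 < ε)
    (hr : 0 < r) (hA : ∀ (ι : Type) [Fintype ι] (u : ι → H), Orthonormal ℂ u →
      ∑ i, ‖A (u i)‖ ^ r ≤ K ^ r)
    {M : Submodule ℂ H} (hM : ∀ v ∈ M, ε * ‖v‖ ≤ ‖A v‖) : FiniteDimensional ℂ M := by
  obtain ⟨m, hm⟩ := exists_nat_ge (K ^ r / ε ^ r)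
  have hεr : 0 < ε ^ r := Real.rpow_pos_of_pos hε r
  have h1 : Module.rank ℂ M ≤ m := by
    refine rank_le fun s hs => ?_
    have hfr := finrank_span_finset_eq_card (R := ℂ) (s := s) hs
    set b := stdOrthonormalBasis ℂ (Submodule.span ℂ (s : Set M)) with hb
    have hbo : Orthonormal ℂ fun i => ((b i : M) : H) :=
      (b.orthonormal.comp_linearIsometry (Submodule.subtypeₗᵢ _)).comp_linearIsometry
        (Submodule.subtypeₗᵢ _)
    have h2 := hA _ _ hbo
    have h3 : ∀ i, ε ^ r ≤ ‖A ((b i : M) : H)‖ ^ r := fun i => by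
      refine Real.rpow_le_rpow hε.le ?_ hr.le
      have := hM _ (b i : M).2
      rwa [hbo.1 i, mul_one] at this
    have h4 := (Finset.sum_le_sum fun i (_ : i ∈ Finset.univ) => h3 i).trans h2
    rw [Finset.sum_const, Finset.card_univ, Fintype.card_fin, hfr, nsmul_eq_mul,
      ← le_div_iff₀ hεr] at h4
    exact_mod_cast h4.trans hm
  exact Module.rank_lt_aleph0_iff.1 (h1.trans_lt (Cardinal.natCast_lt_aleph0))

variable [CompleteSpace H]

theorem re_inner_cfc_le {T : H →L[ℂ] H} {f g : ℝ → ℝ} (hf : Continuous f) (hg : Continuous g)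
    (hfg : ∀ x ∈ spectrum ℝ T, f x ≤ g x) (v : H) :
    (⟪v, cfc f T v⟫_ℂ).re ≤ (⟪v, cfc g T v⟫_ℂ).re := by
  have h := (ContinuousLinearMap.le_def _ _).1
    (cfc_mono hfg hf.continuousOn hg.continuousOn : cfc f T ≤ cfc g T)
  have h2 := h.re_inner_nonneg_right v
  simp only [sub_apply, inner_sub_right, map_sub] at h2
  exact sub_nonneg.1 h2

theorem inner_cfc_left {T : H →L[ℂ] H} (f : ℝ → ℝ) (v w : H) :
    ⟪cfc f T v, w⟫_ℂ = ⟪v, cfc f T w⟫_ℂ := by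
  have h : IsSelfAdjoint (cfc f T) := cfc_predicate f T
  exact h.isSymmetric v w

theorem norm_cfc_sq {T : H →L[ℂ] H} {f : ℝ → ℝ} (hf : Continuous f) (v : H) :
    ‖cfc f T v‖ ^ 2 = (⟪v, cfc (fun x => f x * f x) T v⟫_ℂ).re := by
  rw [cfc_mul f f T hf.continuousOn hf.continuousOn, mul_apply_eq_comp, ← inner_cfc_left,
    inner_self_eq_norm_sq_to_K]
  norm_cast

/-- The functional calculus acts on eigenvectors by evaluation at the eigenvalue. -/
theorem cfc_apply_of_eigenvector {T : H →L[ℂ] H} (hT : IsSelfAdjoint T) {f : ℝ → ℝ}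
    (hf : Continuous f) {v : H} {s : ℝ} (hv : T v = (s : ℂ) • v) :
    cfc f T v = (f s : ℂ) • v := by
  have hsub : ∀ (g : ℝ → ℝ) (_ : Continuous g) (c : ℝ), cfc (fun x => g x - c) T v =
      cfc g T v - (c : ℂ) • v := fun g hg c => by
    rw [cfc_sub g (fun _ => c) T hg.continuousOn continuousOn_const, cfc_const c T,
      sub_apply, Algebra.algebraMap_eq_smul_one]
    simp
  have hlin : cfc (fun x => x - s) T v = 0 := by
    rw [hsub (fun x => x) continuous_id s, cfc_id' ℝ T, hv, sub_self]
  obtain ⟨R, hR⟩ := (spectrum.isCompact (𝕜 := ℝ) T).exists_bound_of_continuousOn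
    (f := fun x => (f x - f s) * (f x - f s)) (by fun_prop)
  have hle : ∀ δ > 0, ‖cfc f T v - (f s : ℂ) • v‖ ^ 2 ≤ δ * ‖v‖ ^ 2 := fun δ hδ => by
    have hc : Continuous fun x => (f x - f s) * (f x - f s) := by fun_prop
    obtain ⟨η, hη, hη2⟩ := Metric.continuous_iff.1 hc s δ hδ
    -- Near `s` this is continuity of `f`; away from `s` the quadratic term dominates a bound of the
    -- left side on the compact spectrum. Under the calculus at `v` the quadratic term vanishes, as
    -- (T - s)v = 0.
    have hb : ∀ x ∈ spectrum ℝ T, (f x - f s) * (f x - f s) ≤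
        δ + |R| / η ^ 2 * ((x - s) * (x - s)) := fun x hx => by
      have h0 : 0 ≤ |R| / η ^ 2 * ((x - s) * (x - s)) :=
        mul_nonneg (by positivity) (mul_self_nonneg _)
      by_cases hxs : dist x s < η
      · have := hη2 x hxs
        simp only [sub_self, mul_zero, dist_zero_right, Real.norm_eq_abs] at this
        linarith [le_abs_self ((f x - f s) * (f x - f s))]
      · have h1 : η ^ 2 ≤ (x - s) * (x - s) := by
          rw [Real.dist_eq, not_lt] at hxs
          rw [← abs_mul_abs_self (x - s), sq]
          exact mul_self_le_mul_self hη.le hxs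
        have h2 : |R| ≤ |R| / η ^ 2 * ((x - s) * (x - s)) := by
          rw [div_mul_eq_mul_div, le_div_iff₀ (by positivity)]
          gcongr
        have h3 := (le_abs_self _).trans ((hR x hx).trans (le_abs_self R))
        linarith
    have h1 := re_inner_cfc_le hc (by fun_prop) hb v
    have h2 := norm_cfc_sq (T := T) (f := fun x => f x - f s) (by fun_prop) v
    have h3 := norm_cfc_sq (T := T) (f := fun x => x - s) (by fun_prop) v
    rw [hlin, norm_zero] at h3
    rw [hsub f hf] at h2
    rw [h2]
    refine h1.trans (le_of_eq ?_)
    rw [cfc_add T (fun _ => δ) (fun x => |R| / η ^ 2 * ((x - s) * (x - s))) (by fun_prop)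
      (by fun_prop), cfc_const_mul _ _ T (by fun_prop), cfc_const δ T,
      Algebra.algebraMap_eq_smul_one, add_apply, inner_add_right,
      Complex.add_re, smul_apply, smul_apply,
      ← Complex.coe_smul, ← Complex.coe_smul, inner_smul_right, inner_smul_right,
      Complex.re_ofReal_mul, Complex.re_ofReal_mul, ← h3,
      show (1 : H →L[ℂ] H) v = v from rfl, inner_self_eq_norm_sq_to_K]
    have h4 : (((‖v‖ : ℂ) ^ 2).re) = ‖v‖ ^ 2 := by norm_cast
    change δ * ((‖v‖ : ℂ) ^ 2).re + _ = _
    rw [h4]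
    ring
  have h0 : ‖cfc f T v - (f s : ℂ) • v‖ ^ 2 ≤ 0 := by
    refine le_of_forall_pos_le_add fun δ hδ => ?_
    have := hle (δ / (‖v‖ ^ 2 + 1)) (by positivity)
    refine this.trans ?_
    rw [zero_add, div_mul_eq_mul_div, div_le_iff₀ (by positivity)]
    nlinarith
  exact sub_eq_zero.1 (norm_eq_zero.1 (pow_eq_zero_iff two_ne_zero |>.1 (le_antisymm h0 (by positivity))))

theorem norm_abs_apply (A : H →L[ℂ] H) (v : H) : ‖CFC.abs A v‖ = ‖A v‖ := by
  have h := congrArg (fun B : H →L[ℂ] H => ⟪v, B v⟫_ℂ) (CFC.abs_mul_abs A)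
  have hs : IsSelfAdjoint (CFC.abs A) := (CFC.abs_nonneg A).isSelfAdjoint
  have h1 : ⟪CFC.abs A v, CFC.abs A v⟫_ℂ = ⟪A v, A v⟫_ℂ := by
    have e1 : ⟪CFC.abs A v, CFC.abs A v⟫_ℂ = ⟪v, CFC.abs A (CFC.abs A v)⟫_ℂ := hs.isSymmetric _ _
    rw [e1, ← ContinuousLinearMap.adjoint_inner_right]
    exact h
  rw [inner_self_eq_norm_sq_to_K, inner_self_eq_norm_sq_to_K] at h1
  have h2 : ‖CFC.abs A v‖ ^ 2 = ‖A v‖ ^ 2 := by exact_mod_cast h1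
  exact (pow_left_inj₀ (norm_nonneg _) (norm_nonneg _) two_ne_zero).1 h2

/-- A spectral cutoff avoids a compactness argument. On the range of (|A| - ε)_+ the operator is
bounded below by ε, so this range is finite-dimensional. It is invariant under |A| and has an
eigenbasis b_j, on which the eigenvalues are ‖A b_j‖. Bessel's inequality then compares the trace
with Σ ‖A b_j‖^r. -/
theorem sum_re_inner_cfc_le (A : H →L[ℂ] H) {r K ε : ℝ} (hε : 0 < ε) (hr : 2 ≤ r)
    (hA : ∀ (ι : Type) [Fintype ι] (u : ι → H), Orthonormal ℂ u →
      ∑ i, ‖A (u i)‖ ^ r ≤ K ^ r) {ι : Type*} {e : ι → H} (he : Orthonormal ℂ e) (S : Finset ι) :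
    ∑ i ∈ S, (⟪e i, cfc (fun x => max (x - ε) 0 * |x| ^ (r - 1)) (CFC.abs A) (e i)⟫_ℂ).re ≤
      K ^ r := by
  set T := CFC.abs A with hTdef
  have hT0 : 0 ≤ T := CFC.abs_nonneg A
  have hT : IsSelfAdjoint T := hT0.isSelfAdjoint
  set h : ℝ → ℝ := fun x => max (x - ε) 0 with hh
  have hhc : Continuous h := by fun_prop
  set k : ℝ → ℝ := fun x => |x| ^ (r - 1) with hk
  have hkc : Continuous k := continuous_abs.rpow_const fun _ => .inr (by linarith)
  set M : Submodule ℂ H := LinearMap.range ((cfc h T : H →L[ℂ] H) : H →ₗ[ℂ] H) with hM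
  have hMA : ∀ v ∈ M, ε * ‖v‖ ≤ ‖A v‖ := by
    rintro _ ⟨w, rfl⟩
    rw [← norm_abs_apply A, ContinuousLinearMap.coe_coe]
    have h1 : T (cfc h T w) = cfc (fun x => x * h x) T w := by
      rw [cfc_mul (fun x => x) h T (by fun_prop) hhc.continuousOn, cfc_id' ℝ T]
      rfl
    rw [← hTdef, h1]
    refine (sq_le_sq₀ (by positivity) (norm_nonneg _)).1 ?_
    have h2 : (ε * ‖cfc h T w‖) ^ 2 = ‖cfc (fun x => ε * h x) T w‖ ^ 2 := by
      rw [cfc_const_mul ε h T hhc.continuousOn, smul_apply, norm_smul, Real.norm_of_nonneg hε.le]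
    rw [h2, norm_cfc_sq (by fun_prop), norm_cfc_sq (by fun_prop)]
    refine re_inner_cfc_le (by fun_prop) (by fun_prop) (fun x hx => ?_) w
    have hx0 : 0 ≤ h x := le_max_right _ _
    by_cases hxε : x ≤ ε
    · have : h x = 0 := max_eq_right (by linarith)
      simp [this]
    · have : ε ≤ x := (not_le.1 hxε).le
      have h3 : ε * h x ≤ x * h x := mul_le_mul_of_nonneg_right this hx0
      exact mul_self_le_mul_self (by positivity) h3
  have hfd : FiniteDimensional ℂ M :=
    finiteDimensional_of_sum_norm_map_rpow_le A hε (by linarith) hA hMA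
  have hinv : ∀ v ∈ M, (T : H →ₗ[ℂ] H) v ∈ M := by
    rintro _ ⟨w, rfl⟩
    have h1 : Commute (cfc h T) T := (Commute.refl T).cfc_real h
    exact ⟨T w, congrArg (fun B : H →L[ℂ] H => B w) h1.eq⟩
  have hTs : (T : H →ₗ[ℂ] H).IsSymmetric := hT.isSymmetric
  have hTM := hTs.restrict_invariant hinv
  set b := hTM.eigenvectorBasis rfl with hb
  set s := hTM.eigenvalues rfl with hs
  have hbe : ∀ i, T (b i : H) = (s i : ℂ) • (b i : H) := fun i =>
    congrArg Subtype.val (hTM.apply_eigenvectorBasis rfl i)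
  have hbo : Orthonormal ℂ fun i => (b i : H) :=
    b.orthonormal.comp_linearIsometry (Submodule.subtypeₗᵢ M)
  have hs0 : ∀ i, 0 ≤ s i := fun i => by
    have h1 := ((ContinuousLinearMap.nonneg_iff_isPositive _).1 hT0).re_inner_nonneg_right (b i : H)
    rw [hbe, inner_smul_right, inner_self_eq_norm_sq_to_K, hbo.1 i] at h1
    simpa using h1
  have hsn : ∀ i, s i = ‖A (b i : H)‖ := fun i => by
    rw [← norm_abs_apply A, ← hTdef, hbe, norm_smul, hbo.1 i, mul_one, Complex.norm_real,
      Real.norm_of_nonneg (hs0 i)]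
  have hg : Continuous fun x => h x * k x := hhc.mul hkc
  set g : ℝ → ℝ := fun x => h x * k x with hgd
  have hg0 : ∀ x, 0 ≤ g x := fun x => mul_nonneg (le_max_right _ _) (by positivity)
  have hgle : ∀ i, g (s i) ≤ s i ^ r := fun i => by
    have h1 : h (s i) ≤ s i := max_le (by linarith) (hs0 i)
    calc g (s i) ≤ s i * s i ^ (r - 1) := by
          simp only [hgd, hk, abs_of_nonneg (hs0 i)]
          gcongr
          exact Real.rpow_nonneg (hs0 i) _
      _ = s i ^ r := by
          nth_rewrite 1 [← Real.rpow_one (s i)]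
          rw [← Real.rpow_add_of_nonneg (hs0 i) zero_le_one (by linarith), add_sub_cancel]
  have hexp : ∀ v : H, (⟪v, cfc g T v⟫_ℂ).re = ∑ i, g (s i) * ‖⟪(b i : H), v⟫_ℂ‖ ^ 2 := fun v => by
    have hmem : cfc g T v ∈ M := by
      rw [hgd, cfc_mul h k T hhc.continuousOn hkc.continuousOn]
      exact ⟨cfc k T v, rfl⟩
    have h1 := congrArg Subtype.val (b.sum_repr' ⟨cfc g T v, hmem⟩)
    simp only [Submodule.coe_sum, Submodule.coe_smul, Submodule.coe_inner] at h1
    rw [← h1, inner_sum, Complex.re_sum]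
    refine Finset.sum_congr rfl fun i _ => ?_
    rw [inner_smul_right, ← inner_cfc_left, cfc_apply_of_eigenvector hT hg (hbe i),
      inner_smul_left, Complex.conj_ofReal, mul_assoc, Complex.re_ofReal_mul,
      ← inner_conj_symm v (b i : H), Complex.mul_conj, Complex.ofReal_re, Complex.normSq_eq_norm_sq]
  calc ∑ i ∈ S, (⟪e i, cfc g T (e i)⟫_ℂ).re
      = ∑ j, g (s j) * ∑ i ∈ S, ‖⟪e i, (b j : H)⟫_ℂ‖ ^ 2 := by
        simp_rw [hexp, Finset.mul_sum, norm_inner_symm (𝕜 := ℂ) (e _)]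
        exact Finset.sum_comm
    _ ≤ ∑ j, g (s j) * 1 := by
        refine Finset.sum_le_sum fun j _ => mul_le_mul_of_nonneg_left ?_ (hg0 _)
        refine (he.sum_inner_products_le (b j : H)).trans ?_
        rw [hbo.1 j, one_pow]
    _ ≤ ∑ j, ‖A (b j : H)‖ ^ r := Finset.sum_le_sum fun j _ => by
        rw [mul_one, ← hsn]
        exact hgle j
    _ ≤ K ^ r := hA _ _ hbo

/-- It is enough to bound finite partial sums of the trace. For x ≥ 0, x^r ≤ (x - ε)_+ x^{r-1} + ε
x^{r-1}; the first term is the cutoff trace, and over a fixed finite set the second vanishes as ε →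
0. -/
theorem schattenNorm_le_of_sum_norm_map_rpow_le (A : H →L[ℂ] H) {r : ℝ} {K : ℝ≥0} (hr : 2 ≤ r)
    (hA : ∀ (ι : Type) [Fintype ι] (u : ι → H), Orthonormal ℂ u →
      ∑ i, ‖A (u i)‖ ^ r ≤ (K : ℝ) ^ r) : schattenNorm r A ≤ K := by
  have hr0 : 0 < r := by linarith
  have hT0 : 0 ≤ CFC.abs A := CFC.abs_nonneg A
  have hT : IsSelfAdjoint (CFC.abs A) := hT0.isSelfAdjoint
  rw [schattenNorm, one_div, ENNReal.rpow_inv_le_iff hr0, positiveTrace]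
  have he : Orthonormal ℂ (fun e : (exists_hilbertBasis ℂ H).choose => (e : H)) := by
    obtain ⟨b, hb⟩ := (exists_hilbertBasis ℂ H).choose_spec
    rw [← hb]
    exact b.orthonormal
  have hpow : ∀ s : ℝ, 0 ≤ s → Continuous fun x : ℝ => |x| ^ s := fun s hs =>
    continuous_abs.rpow_const fun _ => .inr hs
  have hTr : CFC.abs A ^ r = cfc (fun x : ℝ => |x| ^ r) (CFC.abs A) := by
    rw [CFC.rpow_eq_cfc_real hT0]
    refine cfc_congr fun x hx => ?_
    rw [abs_of_nonneg (spectrum_nonneg_of_nonneg hT0 hx)]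
  have hpos : ∀ v : H, 0 ≤ (⟪v, (CFC.abs A ^ r) v⟫_ℂ).re := fun v => by
    have h1 : 0 ≤ CFC.abs A ^ r := CFC.rpow_nonneg
    exact ((ContinuousLinearMap.nonneg_iff_isPositive _).1 h1).re_inner_nonneg_right v
  rw [ENNReal.tsum_eq_iSup_sum]
  refine iSup_le fun S => ?_
  change ∑ e ∈ S, ENNReal.ofReal (⟪(e : H), (CFC.abs A ^ r) (e : H)⟫_ℂ).re ≤ _
  rw [← ENNReal.ofReal_sum_of_nonneg (s := S)
    (f := fun e => (⟪(e : H), (CFC.abs A ^ r) (e : H)⟫_ℂ).re) fun e _ => hpos (e : H), ← ENNReal.ofReal_coe_nnreal,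
    ENNReal.ofReal_rpow_of_nonneg K.coe_nonneg hr0.le]
  refine ENNReal.ofReal_le_ofReal ?_
  have hε : ∀ ε > 0, ∑ e ∈ S, (⟪(e : H), (CFC.abs A ^ r) (e : H)⟫_ℂ).re ≤ (K : ℝ) ^ r +
      ε * ∑ e ∈ S, (⟪(e : H), cfc (fun x : ℝ => |x| ^ (r - 1)) (CFC.abs A) (e : H)⟫_ℂ).re :=
      fun ε hε => by
    refine le_trans ?_ (add_le_add_left (sum_re_inner_cfc_le A hε hr hA he S) _)
    rw [Finset.mul_sum, ← Finset.sum_add_distrib]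
    refine Finset.sum_le_sum fun e _ => ?_
    have hk := hpow (r - 1) (by linarith)
    have hm : Continuous fun x : ℝ => max (x - ε) 0 * |x| ^ (r - 1) :=
      (by fun_prop : Continuous fun x : ℝ => max (x - ε) 0).mul hk
    have hmk : Continuous fun x : ℝ => max (x - ε) 0 * |x| ^ (r - 1) + ε * |x| ^ (r - 1) :=
      hm.add (hk.const_mul ε)
    have h1 := re_inner_cfc_le (T := CFC.abs A) (hpow r hr0.le) hmk
      (fun x hx => ?_) (e : H)
    · rw [hTr]
      refine h1.trans (le_of_eq ?_)
      rw [cfc_add _ _ _ hm.continuousOn (hk.const_mul ε).continuousOn,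
        cfc_const_mul _ _ _ hk.continuousOn, add_apply, inner_add_right, Complex.add_re,
        smul_apply, ← Complex.coe_smul, inner_smul_right, Complex.re_ofReal_mul]
    · have hx0 := spectrum_nonneg_of_nonneg hT0 hx
      have h2 : x ^ r = x * x ^ (r - 1) := by
        nth_rewrite 2 [← Real.rpow_one x]
        rw [← Real.rpow_add_of_nonneg hx0 zero_le_one (by linarith), add_sub_cancel]
      simp only [abs_of_nonneg hx0]
      rw [h2, ← add_mul]
      refine mul_le_mul_of_nonneg_right ?_ (Real.rpow_nonneg hx0 _)
      linarith [le_max_left (x - ε) 0]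
  refine le_of_forall_pos_le_add fun δ hδ => ?_
  set c := ∑ e ∈ S, (⟪(e : H), cfc (fun x : ℝ => |x| ^ (r - 1)) (CFC.abs A) (e : H)⟫_ℂ).re
  refine (hε (δ / (|c| + 1)) (by positivity)).trans ?_
  gcongr
  rw [div_mul_eq_mul_div, div_le_iff₀ (by positivity)]
  gcongr
  linarith [le_abs_self c]

end Schatten

/-! ### The operator and its Schatten bound -/

section

variable {d : ℕ}

/-- The quadratic form `∫∫ |W| |e^{itΔ} f|²`. -/
noncomputable def evolWeight (W : ℝ × RSpace d → ℂ) (f : L2Space d) : ℝ≥0∞ :=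
  ∫⁻ X, ‖W X‖ₑ * ‖evol f X‖ₑ ^ 2

theorem evolWeight_smul {W : ℝ × RSpace d → ℂ} (hW : Measurable W) (c : ℂ) (f : L2Space d) :
    evolWeight W (c • f) = ‖c‖ₑ ^ 2 * evolWeight W f := by
  rw [evolWeight, evolWeight, ← lintegral_const_mul _ (by fun_prop)]
  refine lintegral_congr_ae ?_
  filter_upwards [evol_smul c f] with X hX
  rw [hX, enorm_mul, mul_pow]
  ring

theorem evolWeight_le {W : ℝ × RSpace d → ℂ} (hW : Measurable W) {B : ℝ≥0∞}
    (hB : ∀ f : L2Space d, ‖f‖ = 1 → evolWeight W f ≤ B) (f : L2Space d) :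
    evolWeight W f ≤ ‖f‖ₑ ^ 2 * B := by
  by_cases hf : f = 0
  · have := evolWeight_smul hW 0 f
    rw [zero_smul, ← hf] at this
    rw [this]
    simp
  · have hf' : ‖f‖ ≠ 0 := norm_ne_zero_iff.2 hf
    have h1 : f = (‖f‖ : ℂ) • ((‖f‖⁻¹ : ℝ) : ℂ) • f := by
      rw [smul_smul, ← Complex.ofReal_mul, mul_inv_cancel₀ hf', Complex.ofReal_one, one_smul]
    have h2 : ‖(((‖f‖⁻¹ : ℝ) : ℂ) • f)‖ = 1 := by
      rw [norm_smul, Complex.norm_real, norm_inv, norm_norm, inv_mul_cancel₀ hf']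
    have h3 : ‖(‖f‖ : ℂ)‖ₑ = ‖f‖ₑ := by
      rw [← ofReal_norm, Complex.norm_real, norm_norm, ofReal_norm]
    conv_lhs => rw [h1]
    rw [evolWeight_smul hW, h3]
    gcongr
    exact hB _ h2

/-- The integrand of the sesquilinear form of `∫ e^{-itΔ} W e^{itΔ} dt`. -/
noncomputable def evolIntegrand (W : ℝ × RSpace d → ℂ) (g f : L2Space d)
    (X : ℝ × RSpace d) : ℂ :=
  conj (evol g X) * (W X * evol f X)

theorem lintegral_enorm_evolIntegrand_le {W : ℝ × RSpace d → ℂ} (hW : Measurable W)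
    (g f : L2Space d) :
    ∫⁻ X, ‖evolIntegrand W g f X‖ₑ ≤
      evolWeight W g ^ (1 / 2 : ℝ) * evolWeight W f ^ (1 / 2 : ℝ) := by
  refine le_trans (le_of_eq ?_) (ENNReal.lintegral_mul_norm_pow_le (by fun_prop) (by fun_prop)
    (by norm_num) (by norm_num) (by norm_num))
  refine lintegral_congr fun X => ?_
  have h1 : ∀ a : ℝ≥0∞, (a ^ 2) ^ (1 / 2 : ℝ) = a := fun a => by
    rw [← ENNReal.rpow_natCast, ← ENNReal.rpow_mul]
    norm_num
  have h2 : ∀ a : ℝ≥0∞, a ^ (1 / 2 : ℝ) * a ^ (1 / 2 : ℝ) = a := fun a => by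
    rw [← ENNReal.rpow_add_of_nonneg _ _ (by norm_num) (by norm_num)]
    norm_num
  have h3 : ‖conj (evol g X)‖ₑ = ‖evol g X‖ₑ := by
    rw [← ofReal_norm, RCLike.norm_conj, ofReal_norm]
  rw [ENNReal.mul_rpow_of_nonneg _ _ (by norm_num), ENNReal.mul_rpow_of_nonneg _ _ (by norm_num),
    h1, h1, evolIntegrand, enorm_mul, enorm_mul, h3]
  conv_lhs => rw [← h2 ‖W X‖ₑ]
  ring

theorem lintegral_enorm_evolIntegrand_le_mul {W : ℝ × RSpace d → ℂ} (hW : Measurable W) {B : ℝ≥0∞}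
    (hB : ∀ f : L2Space d, ‖f‖ = 1 → evolWeight W f ≤ B) (g f : L2Space d) :
    ∫⁻ X, ‖evolIntegrand W g f X‖ₑ ≤ B * ‖g‖ₑ * ‖f‖ₑ := by
  have h1 : ∀ f : L2Space d, evolWeight W f ^ (1 / 2 : ℝ) ≤ ‖f‖ₑ * B ^ (1 / 2 : ℝ) := fun f => by
    refine (ENNReal.rpow_le_rpow (evolWeight_le hW hB f) (by norm_num)).trans (le_of_eq ?_)
    rw [ENNReal.mul_rpow_of_nonneg _ _ (by norm_num), ← ENNReal.rpow_natCast, ← ENNReal.rpow_mul]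
    norm_num
  refine (lintegral_enorm_evolIntegrand_le hW g f).trans ((mul_le_mul' (h1 g) (h1 f)).trans
    (le_of_eq ?_))
  have h2 : B ^ (1 / 2 : ℝ) * B ^ (1 / 2 : ℝ) = B := by
    rw [← ENNReal.rpow_add_of_nonneg _ _ (by norm_num) (by norm_num)]
    norm_num
  calc _ = B ^ (1 / 2 : ℝ) * B ^ (1 / 2 : ℝ) * ‖g‖ₑ * ‖f‖ₑ := by ring
    _ = _ := by rw [h2]

theorem integrable_evolIntegrand {W : ℝ × RSpace d → ℂ} (hW : Measurable W) {B : ℝ≥0}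
    (hB : ∀ f : L2Space d, ‖f‖ = 1 → evolWeight W f ≤ B) (g f : L2Space d) :
    Integrable (evolIntegrand W g f) := by
  refine ⟨(Measurable.aestronglyMeasurable ?_), ?_⟩
  · unfold evolIntegrand
    exact (Complex.continuous_conj.measurable.comp (measurable_evol g)).mul
      (hW.mul (measurable_evol f))
  · refine (lintegral_enorm_evolIntegrand_le_mul hW hB g f).trans_lt ?_
    finiteness

/-- By Cauchy–Schwarz the form is sesquilinear and bounded by B ‖g‖ ‖f‖, so the Riesz representation
theorem produces the operator. -/
theorem exists_operator_of_evolWeight_le {W : ℝ × RSpace d → ℂ} (hW : Measurable W) {B : ℝ≥0}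
    (hB : ∀ f : L2Space d, ‖f‖ = 1 → evolWeight W f ≤ B) :
    ∃ A : L2Space d →L[ℂ] L2Space d, ∀ f g, ⟪g, A f⟫_ℂ = ∫ X, evolIntegrand W g f X := by
  have hi := integrable_evolIntegrand hW hB
  have hadd_left : ∀ g₁ g₂ f, ∫ X, evolIntegrand W (g₁ + g₂) f X =
      (∫ X, evolIntegrand W g₁ f X) + ∫ X, evolIntegrand W g₂ f X := fun g₁ g₂ f => by
    rw [← integral_add (hi _ _) (hi _ _)]
    refine integral_congr_ae ?_
    filter_upwards [evol_add g₁ g₂] with X hX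
    simp only [evolIntegrand, hX, map_add]
    ring
  have hsmul_left : ∀ (c : ℂ) g f, ∫ X, evolIntegrand W (c • g) f X =
      conj c * ∫ X, evolIntegrand W g f X := fun c g f => by
    rw [← integral_const_mul]
    refine integral_congr_ae ?_
    filter_upwards [evol_smul c g] with X hX
    simp only [evolIntegrand, hX, map_mul]
    ring
  have hadd_right : ∀ g f₁ f₂, ∫ X, evolIntegrand W g (f₁ + f₂) X =
      (∫ X, evolIntegrand W g f₁ X) + ∫ X, evolIntegrand W g f₂ X := fun g f₁ f₂ => by
    rw [← integral_add (hi _ _) (hi _ _)]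
    refine integral_congr_ae ?_
    filter_upwards [evol_add f₁ f₂] with X hX
    simp only [evolIntegrand, hX]
    ring
  have hsmul_right : ∀ (c : ℂ) g f, ∫ X, evolIntegrand W g (c • f) X =
      c * ∫ X, evolIntegrand W g f X := fun c g f => by
    rw [← integral_const_mul]
    refine integral_congr_ae ?_
    filter_upwards [evol_smul c f] with X hX
    simp only [evolIntegrand, hX]
    ring
  let b : L2Space d →ₗ⋆[ℂ] L2Space d →ₗ[ℂ] ℂ := LinearMap.mk₂'ₛₗ (starRingEnd ℂ) (RingHom.id ℂ)
    (fun g f => ∫ X, evolIntegrand W g f X) hadd_left hsmul_left hadd_right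
    fun c g f => hsmul_right c g f
  have hb : ∀ g f, ‖b g f‖ ≤ B * ‖g‖ * ‖f‖ := fun g f => by
    have h1 := (enorm_integral_le_lintegral_enorm _).trans
      (lintegral_enorm_evolIntegrand_le_mul hW hB g f)
    have h2 := ENNReal.toReal_mono (by finiteness) h1
    change ‖∫ X, evolIntegrand W g f X‖ ≤ _
    simpa using h2
  let b' : L2Space d →L⋆[ℂ] L2Space d →L[ℂ] ℂ := b.mkContinuous₂ B hb
  -- The representing operator acts on the conjugate-linear argument `g`; its adjoint acts on `f`.
  refine ⟨ContinuousLinearMap.adjoint (InnerProductSpace.continuousLinearMapOfBilin b'),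
    fun f g => ?_⟩
  rw [ContinuousLinearMap.adjoint_inner_right,
    InnerProductSpace.continuousLinearMapOfBilin_apply]
  rfl

theorem isConjugatedTimeIntegral_of_inner {V : ℝ → RSpace d → ℂ} {W : ℝ × RSpace d → ℂ}
    (hVW : Function.uncurry V =ᵐ[volume] W) {A : L2Space d →L[ℂ] L2Space d}
    (hi : ∀ g f, Integrable (evolIntegrand W g f))
    (hA : ∀ f g, ⟪g, A f⟫_ℂ = ∫ X, evolIntegrand W g f X) : IsConjugatedTimeIntegral V A := by
  intro f g
  have hF := hi g f
  rw [Measure.volume_eq_prod] at hF hVW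
  have hae : ∀ᵐ t : ℝ, (fun x => evolIntegrand W g f (t, x)) =ᵐ[volume]
      fun x => conj (freeProp t g x) * (V t x * freeProp t f x) := by
    filter_upwards [Measure.ae_ae_of_ae_prod hVW] with t ht
    filter_upwards [ht, evol_ae_eq f t, evol_ae_eq g t] with x h1 h2 h3
    rw [evolIntegrand, h2, h3, ← h1]
    rfl
  refine ⟨?_, ?_, ?_⟩
  · filter_upwards [hae, hF.prod_right_ae] with t h1 h2
    exact h2.congr h1
  · refine hF.integral_norm_prod_left.congr ?_
    filter_upwards [hae] with t h1
    exact integral_congr_ae (h1.fun_comp norm)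
  · rw [hA, Measure.volume_eq_prod, integral_prod _ hF]
    refine integral_congr_ae ?_
    filter_upwards [hae] with t h1
    exact integral_congr_ae h1

/-- The density estimate for |V| is used twice: on single unit vectors it bounds the form, and on
the two orthonormal systems separately, joined by Cauchy–Schwarz in the sum, it bounds Σ |⟨f_i, A
g_i⟩|^{2q'}. -/
theorem exists_isConjugatedTimeIntegral {p' q' : ℝ} (hp' : 1 ≤ p') (hq' : 1 + (d : ℝ) / 2 ≤ q')
    (hpq : 2 / p' + d / q' = 2) {V : ℝ → RSpace d → ℂ}
    (hV : AEStronglyMeasurable (Function.uncurry V) (volume : Measure (ℝ × RSpace d)))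
    (hVN : mixedNorm p' q' V < ∞) :
    ∃ A : L2Space d →L[ℂ] L2Space d, IsConjugatedTimeIntegral V A ∧
      schattenNorm (2 * q') A ≤ strichartzConst d q' * mixedNorm p' q' V := by
  have hd0 : (0 : ℝ) ≤ d := Nat.cast_nonneg d
  have hq1 : 1 ≤ q' := by linarith
  -- A measurable representative; for almost every `t` it agrees with V(t, ·) almost everywhere, so
  -- neither the mixed norm nor the form changes.
  set W := hV.mk _ with hWdef
  have hW : Measurable W := hV.stronglyMeasurable_mk.measurable
  have hVW : Function.uncurry V =ᵐ[volume] W := hV.ae_eq_mk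
  have hN : (∫⁻ t, (∫⁻ x, ‖W (t, x)‖ₑ ^ q') ^ (p' / q')) ^ (1 / p') = mixedNorm p' q' V := by
    rw [mixedNorm]
    congr 1
    have hVW' := hVW
    rw [Measure.volume_eq_prod] at hVW'
    refine lintegral_congr_ae ?_
    filter_upwards [Measure.ae_ae_of_ae_prod hVW'] with t ht
    congr 1
    refine lintegral_congr_ae ?_
    filter_upwards [ht] with x hx
    rw [← hx]
    rfl
  set K : ℝ≥0 := strichartzConst d q' * (mixedNorm p' q' V).toNNReal with hK
  have hKe : (K : ℝ≥0∞) = strichartzConst d q' * mixedNorm p' q' V := by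
    rw [hK, ENNReal.coe_mul, ENNReal.coe_toNNReal hVN.ne]
  have hsum : ∀ {ι : Type} [Fintype ι] {u : ι → L2Space d}, Orthonormal ℂ u →
      ∑ i, evolWeight W (u i) ^ (2 * q') ≤ (K : ℝ≥0∞) ^ (2 * q') := fun hu => by
    rw [hKe, ← hN]
    exact sum_lintegral_evol_rpow_rpow_le hW.enorm hp' hq' hpq hu
  have hB : ∀ f : L2Space d, ‖f‖ = 1 → evolWeight W f ≤ K := fun f hf => by
    have ho : Orthonormal ℂ fun _ : Unit => f :=
      ⟨fun _ => hf, fun i j hij => (hij (Subsingleton.elim i j)).elim⟩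
    have := hsum ho
    simp only [Finset.univ_unique, Finset.sum_singleton] at this
    exact (ENNReal.rpow_le_rpow_iff (by positivity)).1 this
  obtain ⟨A, hA⟩ := exists_operator_of_evolWeight_le hW hB
  refine ⟨A, isConjugatedTimeIntegral_of_inner hVW (integrable_evolIntegrand hW hB) hA, ?_⟩
  rw [← hKe]
  refine schattenNorm_le_of_sum_norm_map_rpow_le A (by linarith) fun ι _ u hu =>
    sum_norm_map_rpow_le A (by linarith) (fun ι _ f g hf hg => ?_) hu
  have h1 : ∀ i, ‖⟪f i, A (g i)⟫_ℂ‖ₑ ^ (2 * q') ≤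
      evolWeight W (f i) ^ q' * evolWeight W (g i) ^ q' := fun i => by
    rw [hA]
    have h2 := (enorm_integral_le_lintegral_enorm (evolIntegrand W (f i) (g i))).trans
      (lintegral_enorm_evolIntegrand_le hW (f i) (g i))
    refine (ENNReal.rpow_le_rpow h2 (by positivity)).trans (le_of_eq ?_)
    rw [ENNReal.mul_rpow_of_nonneg _ _ (by positivity), ← ENNReal.rpow_mul, ← ENNReal.rpow_mul]
    congr 2 <;> ring
  have h3 : ∑ i, ‖⟪f i, A (g i)⟫_ℂ‖ₑ ^ (2 * q') ≤ (K : ℝ≥0∞) ^ (2 * q') := by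
    refine (Finset.sum_le_sum fun i _ => h1 i).trans ?_
    refine (ENNReal.inner_le_Lp_mul_Lq _ _ _ Real.HolderConjugate.two_two).trans ?_
    simp_rw [← ENNReal.rpow_mul, mul_comm q' 2]
    refine (mul_le_mul' (ENNReal.rpow_le_rpow (hsum hf) (by norm_num))
      (ENNReal.rpow_le_rpow (hsum hg) (by norm_num))).trans (le_of_eq ?_)
    rw [← ENNReal.rpow_add_of_nonneg _ _ (by norm_num) (by norm_num)]
    norm_num
  have h4 := ENNReal.toReal_mono (by finiteness) h3
  rw [ENNReal.toReal_sum fun i _ => by finiteness] at h4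
  simpa [← ENNReal.toReal_rpow] using h4

end

theorem mainTheorem2 (d : ℕ) (hd : 1 ≤ d) (p' q' : ℝ) (hp' : 1 ≤ p')
    (hq' : 1 + (d : ℝ) / 2 ≤ q') (hpq : 2 / p' + (d : ℝ) / q' = 2) :
    ∃ C : ℝ≥0,
      (∀ V : ℝ → RSpace d → ℂ,
        AEStronglyMeasurable (Function.uncurry V) (volume : Measure (ℝ × RSpace d)) →
        mixedNorm p' q' V < ∞ →
        ∃ A : L2Space d →L[ℂ] L2Space d,
          IsConjugatedTimeIntegral V A ∧
          schattenNorm (2 * q') A ≤ C * mixedNorm p' q' V) ∧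
      (∀ p q : ℝ, p.HolderConjugate p' → q.HolderConjugate q' →
        OrthonormalStrichartz d p q C) := by
  exact ⟨strichartzConst d q',
    fun V hV hVN => exists_isConjugatedTimeIntegral hp' hq' hpq hV hVN,
    fun p q hp hq => orthonormalStrichartz hp' hq' hpq hp hq⟩
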